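/- **Setting.** Let $m\ge 1$ and let $\kappa:\{0,1\}^m\to\{0,1\}$ be a non-constant function (a classifier with features $\mathcal F=\{1,\dots,m\}$). For $\mathbf v\in\{0,1\}^m$, a *weak contrastive explanation* (weak CXp) of the decision $\kappa(\mathbf v)$ is a set $\mathcal Y\subseteq\mathcal F$ such that some $\mathbf x\in\{0,1\}^m$ satisfies $x_j=v_j$ for all $j\in\mathcal F\setminus\mathcal Y$ and $\kappa(\mathbf x)\neq\kappa(\mathbf v)$. A *contrastive explanation* (CXp) is a subset-minimal weak CXp. **Theorem.** For each of the ten languages d-DNNF, cd-PDAG, SDD, OBDD, PI, IP, renH-C, AFF, dFSD and EADT there is a polynomial-time algorithm which, given a sentence of the language over $x_1,\dots,x_m$ that represents a non-constant $\kappa$, and given $\mathbf v\in\{0,1\}^m$, outputs one CXp of the decision $\kappa(\mathbf v)$. Polynomial time means: there are one program and one polynomial $P$ for the language such that the running time is at most $P(n)$, where $n$ is the size of the written input (the sentence and $\mathbf v$). The programs are while-programs over binary trees, in which each elementary instruction costs one plus the sizes of the trees that it reads and writes. **The languages.** The graphs are finite rooted directed acyclic graphs, written as a topologically ordered list of nodes.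 * *cd-PDAG*: graphs with leaves $\top,\bot,x_i,\neg x_i$ and inner nodes $\land,\lor,\neg$, where the conjuncts of each $\land$-node share no variables and the disjuncts of each $\lor$-node are pairwise inconsistent. *d-DNNF*: those without $\neg$-nodes. * *SDD*: graphs of the same kind that respect a vtree, i.e. a full binary tree whose leaves correspond one-to-one to the variables. A constant respects every vtree node, and a literal over $x_i$ respects the leaf $x_i$. A decision node $\bigvee_k(p_k\land s_k)$ respects an inner vtree node if every prime $p_k$ respects a node of its left subtree, every sub $s_k$ respects a node of its right subtree, and the primes are consistent, pairwise inconsistent and jointly valid. * *OBDD*: graphs whose root is a decision node, where a decision node is a constant or of the form $(x_i\land\alpha)\lor(\neg x_i\land\beta)$ with decision nodes $\alpha,\beta$, and the decision variables strictly increase, in some total order of the variables, along every path. * *PI*: CNFs in which every entailed (non-tautological) clause is entailed by a clause of the CNF, and no clause of which is entailed by another. *IP*: dually, DNFs in which every (consistent) term entailing the DNF entails a term of the DNF, and no term of which is entailed by another. In both, the literals of a clause or term are over distinct variables. * *renH-C*: CNFs for which there is a set $V$ of variables such that, after complementing all literals over $V$, every clause has at most one positive literal. * *AFF*: finite conjunctions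 of affine (XOR) clauses. * *dFSD*: graphs whose nodes are the sink, disjunctive nodes, or nodes labeled with a variable, the edges leaving a variable node being labeled with subsets of $\{0,1\}$. A point is a model iff some path from the root to the sink has only labels that contain the point's value of the respective variable. Determinism: the labels of the edges leaving a node are pairwise disjoint (so a disjunctive node, whose edges all carry the same label, has at most one edge). Focusing: along every path from the root, the labels of the edges leaving nodes with the same variable decrease with respect to inclusion. * *EADT*: trees with leaves $\top,\bot$, binary affine decision nodes (which branch on whether an affine clause holds), and affine decomposable $\land$- and $\lor$-nodes. A node $N$ is affine decomposable if no variable of one child of $N$ is equal to, or connected to, a variable of another child of $N$, where connected means joined by a chain of variables in which consecutive ones occur together in an affine clause decided at an ancestor of $N$. -/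

import Mathlib

namespace KC

/-! ## Machine model: data, programs, step count -/

/-- Binary trees, the only data type of the machine model. -/
inductive Data where
  | nil : Data
  | cons : Data → Data → Data

namespace Data

/-- Number of nodes of a tree. -/
def size : Data → ℕ
  | nil => 1
  | cons a b => a.size + b.size + 1

/-- First component. -/
def hd : Data → Data
  | nil => nil
  | cons a _ => a

/-- Second component. -/
def tl : Data → Data
  | nil => nil
  | cons _ b => b

/-- Lists are right combs. -/
def ofList {α : Type} (f : α → Data) : List α → Data
  | [] => nil
  | a :: l => cons (f a) (ofList f l)

/-- Truth values: `nil` is false. -/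
def ofBool : Bool → Data
  | false => nil
  | true => cons nil nil

/-- Numbers in unary notation. All numbers in an input are indices of features or of nodes that are
themselves listed in the input, so binary notation would give polynomially related sizes. -/
def ofNat : ℕ → Data
  | 0 => nil
  | n + 1 => cons nil (ofNat n)

end Data

/-- Programs: while-programs over binary trees with one store variable (which may hold tuples). -/
inductive Prog where
  | id : Prog
  | nil : Prog
  | hd : Prog
  | tl : Prog
  | cons : Prog → Prog → Prog
  | seq : Prog → Prog → Prog
  | ite : Prog → Prog → Prog → Prog
  | loop : Prog → Prog → Prog

/-- `Runs p a b t`: on input `a` the program `p` halts with output `b` at cost `t`.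
Every elementary instruction costs one plus the sizes of the trees it reads and writes, so that
neither copying nor sharing is free. `ite c p q` branches on whether the output of `c` is `nil`,
and `loop c p` repeats `p` as long as the output of `c` is not `nil`. -/
inductive Runs : Prog → Data → Data → ℕ → Prop where
  | id (a : Data) : Runs .id a a (a.size + a.size + 1)
  | nil (a : Data) : Runs .nil a .nil (a.size + Data.nil.size + 1)
  | hd (a : Data) : Runs .hd a a.hd (a.size + a.hd.size + 1)
  | tl (a : Data) : Runs .tl a a.tl (a.size + a.tl.size + 1)
  | cons {p q : Prog} {a b c : Data} {s t : ℕ} (hp : Runs p a b s) (hq : Runs q a c t) :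
      Runs (.cons p q) a (.cons b c) (s + t + a.size + (Data.cons b c).size + 1)
  | seq {p q : Prog} {a b c : Data} {s t : ℕ} (hp : Runs p a b s) (hq : Runs q b c t) :
      Runs (.seq p q) a c (s + t + 1)
  | iteTrue {c p q : Prog} {a d e b : Data} {s t : ℕ} (hc : Runs c a (.cons d e) s)
      (hp : Runs p a b t) : Runs (.ite c p q) a b (s + t + a.size + 1)
  | iteFalse {c p q : Prog} {a b : Data} {s t : ℕ} (hc : Runs c a .nil s)
      (hq : Runs q a b t) : Runs (.ite c p q) a b (s + t + a.size + 1)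
  | loopStop {c p : Prog} {a : Data} {s : ℕ} (hc : Runs c a .nil s) :
      Runs (.loop c p) a a (s + a.size + 1)
  | loopStep {c p : Prog} {a d e b z : Data} {s t u : ℕ} (hc : Runs c a (.cons d e) s)
      (hp : Runs p a b t) (hl : Runs (.loop c p) b z u) :
      Runs (.loop c p) a z (s + t + u + a.size + 1)

/-- The machine model is deterministic: output and cost are determined by program and input. -/
theorem Runs.det {p : Prog} {a b : Data} {t : ℕ} (h : Runs p a b t) :
    ∀ {b' : Data} {t' : ℕ}, Runs p a b' t' → b = b' ∧ t = t' := by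
  induction h with
  | id a => intro b' t' h'; cases h'; exact ⟨rfl, rfl⟩
  | nil a => intro b' t' h'; cases h'; exact ⟨rfl, rfl⟩
  | hd a => intro b' t' h'; cases h'; exact ⟨rfl, rfl⟩
  | tl a => intro b' t' h'; cases h'; exact ⟨rfl, rfl⟩
  | cons _ _ ih1 ih2 =>
    intro b' t' h'
    cases h' with
    | cons h1 h2 =>
      obtain ⟨rfl, rfl⟩ := ih1 h1
      obtain ⟨rfl, rfl⟩ := ih2 h2
      exact ⟨rfl, rfl⟩
  | seq _ _ ih1 ih2 =>
    intro b' t' h'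
    cases h' with
    | seq h1 h2 =>
      obtain ⟨rfl, rfl⟩ := ih1 h1
      obtain ⟨rfl, rfl⟩ := ih2 h2
      exact ⟨rfl, rfl⟩
  | iteTrue _ _ ih1 ih2 =>
    intro b' t' h'
    cases h' with
    | iteTrue h1 h2 =>
      obtain ⟨_, rfl⟩ := ih1 h1
      obtain ⟨rfl, rfl⟩ := ih2 h2
      exact ⟨rfl, rfl⟩
    | iteFalse h1 h2 => exact absurd (ih1 h1).1 (by simp)
  | iteFalse _ _ ih1 ih2 =>
    intro b' t' h'
    cases h' with
    | iteTrue h1 h2 => exact absurd (ih1 h1).1 (by simp)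
    | iteFalse h1 h2 =>
      obtain ⟨_, rfl⟩ := ih1 h1
      obtain ⟨rfl, rfl⟩ := ih2 h2
      exact ⟨rfl, rfl⟩
  | loopStop _ ih1 =>
    intro b' t' h'
    cases h' with
    | loopStop h1 =>
      obtain ⟨_, rfl⟩ := ih1 h1
      exact ⟨rfl, rfl⟩
    | loopStep h1 h2 h3 => exact absurd (ih1 h1).1 (by simp)
  | loopStep _ _ _ ih1 ih2 ih3 =>
    intro b' t' h'
    cases h' with
    | loopStop h1 => exact absurd (ih1 h1).1 (by simp)
    | loopStep h1 h2 h3 =>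
      obtain ⟨_, rfl⟩ := ih1 h1
      obtain ⟨rfl, rfl⟩ := ih2 h2
      obtain ⟨rfl, rfl⟩ := ih3 h3
      exact ⟨rfl, rfl⟩

/-! ## Classifiers and contrastive explanations -/

/-- Feature space with `m` boolean features. -/
abbrev Point (m : ℕ) := Fin m → Bool

/-- `Y` is a weak contrastive explanation of the prediction `κ v`: freeing the features in `Y`
allows the prediction to change. -/
def IsWeakCXp {m : ℕ} (κ : Point m → Bool) (v : Point m) (Y : Finset (Fin m)) : Prop :=
  ∃ x : Point m, (∀ j, j ∉ Y → x j = v j) ∧ κ x ≠ κ v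

/-- A contrastive explanation is a subset-minimal weak contrastive explanation. -/
def IsCXp {m : ℕ} (κ : Point m → Bool) (v : Point m) (Y : Finset (Fin m)) : Prop :=
  Minimal (IsWeakCXp κ v) Y

/-- A representation language: sentences over `m` variables, membership in the language, the
represented boolean function, and the way sentences are written down as machine data. -/
structure Lang where
  Sentence : ℕ → Type
  Mem : {m : ℕ} → Sentence m → Prop
  eval : {m : ℕ} → Sentence m → Point m → Bool
  encode : {m : ℕ} → Sentence m → Data

/-- A point is written as the list of its coordinates. -/
def encodePoint {m : ℕ} (v : Point m) : Data := Data.ofList Data.ofBool (List.ofFn v)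

/-- A set of features is written as its characteristic vector. -/
def encodeSet {m : ℕ} (Y : Finset (Fin m)) : Data := encodePoint fun i => decide (i ∈ Y)

/-- One contrastive explanation of a decision taken by a (non-constant) classifier given in the
language `L` can be computed in polynomial time. -/
def OneCXpInPolyTime (L : Lang) : Prop :=
  ∃ (p : Prog) (P : Polynomial ℕ), ∀ (m : ℕ) (φ : L.Sentence m), L.Mem φ →
    (∃ x y : Point m, L.eval φ x ≠ L.eval φ y) → ∀ v : Point m,
      ∃ (Y : Finset (Fin m)) (t : ℕ), IsCXp (L.eval φ) v Y ∧
        Runs p (.cons (L.encode φ) (encodePoint v)) (encodeSet Y) t ∧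
        t ≤ P.eval (Data.cons (L.encode φ) (encodePoint v)).size

/-! ## Rooted directed acyclic graphs

A DAG is the list of (the labels of) its nodes in a topological order, root first. A node occupying
a position is identified with the suffix of the list that starts there. An edge from the node
`g :: r` is a number `j`, and leads to the node `r.drop j`. -/

section Dag

variable {α β : Type}

/-- Bottom-up evaluation: the list of the values of all nodes. -/
def dagFold (f : α → List β → β) : List α → List β
  | [] => []
  | g :: r => f g (dagFold f r) :: dagFold f r

/-- The targets of all edges. -/
def dagTargets (refs : α → List ℕ) : List α → List (List α)
  | [] => []
  | g :: r => (refs g).map (fun j => r.drop j) ++ dagTargets refs r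

/-- All edges lead to nodes, and every node other than the root has an incoming edge. -/
def IsDag (refs : α → List ℕ) (c : List α) : Prop :=
  c ≠ [] ∧
  (∀ g r, (g :: r) <:+ c → ∀ j ∈ refs g, j < r.length) ∧
  (∀ r, r <:+ c → r ≠ [] → r ≠ c → r ∈ dagTargets refs c)

/-- No node has two incoming edges. -/
def IsTreeDag (refs : α → List ℕ) (c : List α) : Prop := IsDag refs c ∧ (dagTargets refs c).Nodup

/-- `d` is reached from `c` by a directed path, possibly of length zero. -/
def DagReach (refs : α → List ℕ) : List α → List α → Prop :=
  Relation.ReflTransGen fun c d => ∃ g r, c = g :: r ∧ ∃ j ∈ refs g, d = r.drop j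

end Dag

/-! ## Circuits: NNF and PDAG -/

/-- Node labels of a propositional DAG. `lit i true` is `xᵢ` and `lit i false` is `¬ xᵢ`. -/
inductive Gate (m : ℕ) where
  | const : Bool → Gate m
  | lit : Fin m → Bool → Gate m
  | neg : ℕ → Gate m
  | and : List ℕ → Gate m
  | or : List ℕ → Gate m

namespace Gate

variable {m : ℕ}

/-- Outgoing edges. -/
def refs : Gate m → List ℕ
  | const _ => []
  | lit _ _ => []
  | neg j => [j]
  | and js => js
  | or js => js

/-- Value of a node from the values `vs` of the nodes below. -/
def val (x : Point m) : Gate m → List Bool → Bool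
  | const b, _ => b
  | lit i b, _ => x i == b
  | neg j, vs => !(vs.getD j false)
  | and js, vs => js.all fun j => vs.getD j false
  | or js, vs => js.any fun j => vs.getD j false

/-- Variables at or below a node from the variable sets of the nodes below. -/
def supp : Gate m → List (Finset (Fin m)) → Finset (Fin m)
  | const _, _ => ∅
  | lit i _, _ => {i}
  | neg j, vs => vs.getD j ∅
  | and js, vs => js.toFinset.biUnion fun j => vs.getD j ∅
  | or js, vs => js.toFinset.biUnion fun j => vs.getD j ∅

/-- Written form of a node. -/
def encode : Gate m → Data
  | const b => .cons (.ofNat 0) (.ofBool b)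
  | lit i b => .cons (.ofNat 1) (.cons (.ofNat i) (.ofBool b))
  | neg j => .cons (.ofNat 2) (.ofNat j)
  | and js => .cons (.ofNat 3) (.ofList .ofNat js)
  | or js => .cons (.ofNat 4) (.ofList .ofNat js)

end Gate

abbrev Circuit (m : ℕ) := List (Gate m)

namespace Circuit

variable {m : ℕ}

/-- The function represented by the root. -/
def eval (c : Circuit m) (x : Point m) : Bool := (dagFold (Gate.val x) c).headD false

/-- The variables occurring at or below the root. -/
def vars (c : Circuit m) : Finset (Fin m) := (dagFold Gate.supp c).headD ∅

def encode (c : Circuit m) : Data := .ofList Gate.encode c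

/-- Two nodes are mutually inconsistent. -/
def Exclusive (c d : Circuit m) : Prop := ∀ x, ¬ (c.eval x = true ∧ d.eval x = true)

/-- The conjuncts of every conjunction share no variables. -/
def Decomposable (c : Circuit m) : Prop :=
  ∀ js (r : Circuit m), (Gate.and js :: r) <:+ c →
    js.Pairwise fun j k => Disjoint (vars (r.drop j)) (vars (r.drop k))

/-- The disjuncts of every disjunction are pairwise inconsistent. -/
def Deterministic (c : Circuit m) : Prop :=
  ∀ js (r : Circuit m), (Gate.or js :: r) <:+ c →
    js.Pairwise fun j k => Exclusive (r.drop j) (r.drop k)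

/-- Negation occurs in leaves only. -/
def IsNNF (c : Circuit m) : Prop := IsDag Gate.refs c ∧ ∀ j, Gate.neg j ∉ c

def IsDDNNF (c : Circuit m) : Prop := c.IsNNF ∧ c.Decomposable ∧ c.Deterministic

def IsCdPDAG (c : Circuit m) : Prop := IsDag Gate.refs c ∧ c.Decomposable ∧ c.Deterministic

end Circuit

/-- Variable trees. -/
inductive Vtree (m : ℕ) where
  | leaf : Fin m → Vtree m
  | node : Vtree m → Vtree m → Vtree m

def Vtree.leaves {m : ℕ} : Vtree m → List (Fin m)
  | .leaf i => [i]
  | .node l r => l.leaves ++ r.leaves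

namespace Circuit

variable {m : ℕ}

/-- The prime of an element `prime ∧ sub`. -/
def prime : Circuit m → Circuit m
  | Gate.and [p, _] :: e => e.drop p
  | _ => []

/-- The circuits are consistent, mutually exclusive and jointly exhaustive. -/
def IsPartition (ps : List (Circuit m)) : Prop :=
  (∀ p ∈ ps, ∃ x, p.eval x = true) ∧ ps.Pairwise Exclusive ∧ ∀ x, ∃ p ∈ ps, p.eval x = true

/-- The root of the circuit is an SDD that respects some node (subtree) of the vtree. A decision
node that respects an inner node with children `l` and `r` is a disjunction of elements
`prime ∧ sub`, where the primes form a partition and respect nodes of `l`, while the subs respect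
nodes of `r`. -/
def SDDUnder : Vtree m → Circuit m → Prop
  | .leaf i, c => (∃ b r, c = Gate.const b :: r) ∨ ∃ b r, c = Gate.lit i b :: r
  | .node l r, c => SDDUnder l c ∨ SDDUnder r c ∨
      ∃ js d, c = Gate.or js :: d ∧
        (∀ j ∈ js, ∃ p s e, d.drop j = Gate.and [p, s] :: e ∧
          SDDUnder l (e.drop p) ∧ SDDUnder r (e.drop s)) ∧
        IsPartition (js.map fun j => prime (d.drop j))

/-- A sentential decision diagram respecting some vtree, whose leaves are in one-to-one
correspondence with the variables. -/
def IsSDD (c : Circuit m) : Prop :=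
  IsDag Gate.refs c ∧
  ∃ T : Vtree m, T.leaves.Nodup ∧ (∀ i, i ∈ T.leaves) ∧ SDDUnder T c

/-- The root of the circuit is a decision node: a constant, or `(x ∧ α) ∨ (¬x ∧ β)` with decision
nodes `α` and `β`; the decision variables have rank at least `k`, and their ranks increase strictly
along every path. -/
inductive OBDDFrom (rank : Fin m → ℕ) : ℕ → Circuit m → Prop where
  | const (k : ℕ) (b : Bool) (r : Circuit m) : OBDDFrom rank k (Gate.const b :: r)
  | decision (k : ℕ) (i : Fin m) (j₁ j₀ a₁ a₀ b₁ b₀ : ℕ) (r r₁ r₀ s₁ s₀ : Circuit m) :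
      k ≤ rank i →
      r.drop j₁ = Gate.and [a₁, b₁] :: r₁ → r₁.drop a₁ = Gate.lit i true :: s₁ →
      r.drop j₀ = Gate.and [a₀, b₀] :: r₀ → r₀.drop a₀ = Gate.lit i false :: s₀ →
      OBDDFrom rank (rank i + 1) (r₁.drop b₁) → OBDDFrom rank (rank i + 1) (r₀.drop b₀) →
      OBDDFrom rank k (Gate.or [j₁, j₀] :: r)

/-- A binary decision diagram that is ordered for some total order of the variables. -/
def IsOBDD (c : Circuit m) : Prop :=
  IsDag Gate.refs c ∧ ∃ rank : Fin m → ℕ, Function.Injective rank ∧ OBDDFrom rank 0 c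

end Circuit

def dDNNF : Lang := ⟨Circuit, Circuit.IsDDNNF, Circuit.eval, Circuit.encode⟩
def cdPDAG : Lang := ⟨Circuit, Circuit.IsCdPDAG, Circuit.eval, Circuit.encode⟩
def SDD : Lang := ⟨Circuit, Circuit.IsSDD, Circuit.eval, Circuit.encode⟩
def OBDD : Lang := ⟨Circuit, Circuit.IsOBDD, Circuit.eval, Circuit.encode⟩

/-! ## Flat languages: PI, IP, renamable Horn, affine -/

/-- The literal `(i, true)` is `xᵢ`, and `(i, false)` is `¬ xᵢ`. -/
abbrev Literal (m : ℕ) := Fin m × Bool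

/-- A set of literals, read as a clause or as a term; a list of these is a CNF or a DNF. -/
abbrev Flat (m : ℕ) := List (List (Literal m))

def encodeLits {m : ℕ} (l : List (Literal m)) : Data :=
  .ofList (fun a => .cons (.ofNat a.1) (.ofBool a.2)) l

namespace Flat

variable {m : ℕ}

def clauseVal (C : List (Literal m)) (x : Point m) : Bool := C.any fun a => x a.1 == a.2

def termVal (C : List (Literal m)) (x : Point m) : Bool := C.all fun a => x a.1 == a.2

def evalCNF (f : Flat m) (x : Point m) : Bool := f.all fun C => clauseVal C x

def evalDNF (f : Flat m) (x : Point m) : Bool := f.any fun C => termVal C x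

/-- Logical entailment. -/
def Entails (f g : Point m → Bool) : Prop := ∀ x, f x = true → g x = true

/-- The literals share no variables. -/
def Simple (C : List (Literal m)) : Prop := (C.map Prod.fst).Nodup

def encode (f : Flat m) : Data := .ofList encodeLits f

/-- A CNF in which every entailed clause is entailed by a clause of the CNF, and no clause of which
is entailed by another. -/
def IsPI (f : Flat m) : Prop :=
  (∀ C ∈ f, Simple C) ∧
  (∀ C, Simple C → Entails (evalCNF f) (clauseVal C) →
    ∃ D ∈ f, Entails (clauseVal D) (clauseVal C)) ∧
  f.Pairwise fun C D =>
    ¬ Entails (clauseVal C) (clauseVal D) ∧ ¬ Entails (clauseVal D) (clauseVal C)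

/-- A DNF in which every term that entails the DNF entails a term of the DNF, and no term of which
is entailed by another. -/
def IsIP (f : Flat m) : Prop :=
  (∀ C ∈ f, Simple C) ∧
  (∀ C, Simple C → Entails (termVal C) (evalDNF f) →
    ∃ D ∈ f, Entails (termVal C) (termVal D)) ∧
  f.Pairwise fun C D =>
    ¬ Entails (termVal C) (termVal D) ∧ ¬ Entails (termVal D) (termVal C)

/-- A CNF each of whose clauses has at most one positive literal after complementing all literals
over the variables in some set `V`. -/
def IsRenHorn (f : Flat m) : Prop :=
  ∃ V : Finset (Fin m), ∀ C ∈ f, ∀ a ∈ C, ∀ b ∈ C,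
    (a.2 = true ↔ a.1 ∉ V) → (b.2 = true ↔ b.1 ∉ V) → a = b

end Flat

def PI : Lang := ⟨Flat, Flat.IsPI, Flat.evalCNF, Flat.encode⟩
def IP : Lang := ⟨Flat, Flat.IsIP, Flat.evalDNF, Flat.encode⟩
def renHC : Lang := ⟨Flat, Flat.IsRenHorn, Flat.evalCNF, Flat.encode⟩

/-- An affine clause: the exclusive disjunction of the literals and of the constant. -/
structure XorClause (m : ℕ) where
  lits : List (Literal m)
  parity : Bool

namespace XorClause

variable {m : ℕ}

def eval (δ : XorClause m) (x : Point m) : Bool :=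
  δ.lits.foldr (fun a b => xor (x a.1 == a.2) b) δ.parity

def vars (δ : XorClause m) : Finset (Fin m) := (δ.lits.map Prod.fst).toFinset

def encode (δ : XorClause m) : Data := .cons (encodeLits δ.lits) (.ofBool δ.parity)

end XorClause

/-- Conjunctions of affine clauses. -/
def AFF : Lang where
  Sentence m := List (XorClause m)
  Mem _ := True
  eval f x := f.all fun δ => δ.eval x
  encode f := .ofList XorClause.encode f

/-! ## Deterministic focusing set-labeled diagrams -/

/-- Node labels of a set-labeled diagram over boolean variables: the sink, a disjunctive node, or a
node testing a variable, whose outgoing edges are labeled with sets of values. -/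
inductive SetNode (m : ℕ) where
  | sink : SetNode m
  | disj : List ℕ → SetNode m
  | var : Fin m → List (Finset Bool × ℕ) → SetNode m

namespace SetNode

variable {m : ℕ}

def refs : SetNode m → List ℕ
  | sink => []
  | disj js => js
  | var _ es => es.map Prod.snd

/-- There is a path to the sink all of whose edge labels allow the values in `x`. -/
def val (x : Point m) : SetNode m → List Bool → Bool
  | sink, _ => true
  | disj js, vs => js.any fun j => vs.getD j false
  | var i es, vs => es.any fun e => decide (x i ∈ e.1) && vs.getD e.2 false

def encode : SetNode m → Data
  | sink => .cons (.ofNat 0) .nil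
  | disj js => .cons (.ofNat 1) (.ofList .ofNat js)
  | var i es => .cons (.ofNat 2) (.cons (.ofNat i) (.ofList (fun e =>
      .cons (.cons (.ofBool (decide (false ∈ e.1))) (.ofBool (decide (true ∈ e.1)))) (.ofNat e.2))
      es))

end SetNode

abbrev SetDiagram (m : ℕ) := List (SetNode m)

namespace SetDiagram

variable {m : ℕ}

def eval (c : SetDiagram m) (x : Point m) : Bool := (dagFold (SetNode.val x) c).headD false

def encode (c : SetDiagram m) : Data := .ofList SetNode.encode c

/-- The labels of the edges leaving a node are pairwise disjoint. The edges leaving a disjunctive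
node all carry the same non-empty label, hence there is at most one. -/
def Deterministic (c : SetDiagram m) : Prop :=
  (∀ js, SetNode.disj js ∈ c → js.length ≤ 1) ∧
  ∀ i es, SetNode.var i es ∈ c → es.Pairwise fun e e' => Disjoint e.1 e'.1

/-- Along every path from the root, the labels of the edges for a fixed variable decrease. -/
def Focusing (c : SetDiagram m) : Prop :=
  ∀ i es (r : SetDiagram m), DagReach SetNode.refs c (SetNode.var i es :: r) → ∀ e ∈ es,
    ∀ es' (r' : SetDiagram m), DagReach SetNode.refs (r.drop e.2) (SetNode.var i es' :: r') →
      ∀ e' ∈ es', e'.1 ⊆ e.1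

def IsDFSD (c : SetDiagram m) : Prop := IsDag SetNode.refs c ∧ c.Deterministic ∧ c.Focusing

end SetDiagram

def dFSD : Lang := ⟨SetDiagram, SetDiagram.IsDFSD, SetDiagram.eval, SetDiagram.encode⟩

/-! ## Extended affine decision trees -/

/-- Node labels of an extended affine decision tree. `decide δ j₀ j₁` continues at `j₁` if the
affine clause `δ` holds, and at `j₀` otherwise. -/
inductive AffNode (m : ℕ) where
  | leaf : Bool → AffNode m
  | decide : XorClause m → ℕ → ℕ → AffNode m
  | conj : List ℕ → AffNode m
  | disj : List ℕ → AffNode m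

namespace AffNode

variable {m : ℕ}

def refs : AffNode m → List ℕ
  | leaf _ => []
  | decide _ j₀ j₁ => [j₀, j₁]
  | conj js => js
  | disj js => js

def val (x : Point m) : AffNode m → List Bool → Bool
  | leaf b, _ => b
  | decide δ j₀ j₁, vs => if δ.eval x then vs.getD j₁ false else vs.getD j₀ false
  | conj js, vs => js.all fun j => vs.getD j false
  | disj js, vs => js.any fun j => vs.getD j false

def supp : AffNode m → List (Finset (Fin m)) → Finset (Fin m)
  | leaf _, _ => ∅
  | decide δ j₀ j₁, vs => δ.vars ∪ vs.getD j₀ ∅ ∪ vs.getD j₁ ∅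
  | conj js, vs => js.toFinset.biUnion fun j => vs.getD j ∅
  | disj js, vs => js.toFinset.biUnion fun j => vs.getD j ∅

def encode : AffNode m → Data
  | leaf b => .cons (.ofNat 0) (.ofBool b)
  | decide δ j₀ j₁ => .cons (.ofNat 1) (.cons δ.encode (.cons (.ofNat j₀) (.ofNat j₁)))
  | conj js => .cons (.ofNat 2) (.ofList .ofNat js)
  | disj js => .cons (.ofNat 3) (.ofList .ofNat js)

end AffNode

abbrev AffTree (m : ℕ) := List (AffNode m)

namespace AffTree

variable {m : ℕ}

def eval (c : AffTree m) (x : Point m) : Bool := (dagFold (AffNode.val x) c).headD false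

def vars (c : AffTree m) : Finset (Fin m) := (dagFold AffNode.supp c).headD ∅

def encode (c : AffTree m) : Data := .ofList AffNode.encode c

/-- Two variables occur in the same affine clause at a decision node of `c` above the node `n`. -/
def Linked (c n : AffTree m) (i k : Fin m) : Prop :=
  ∃ δ j₀ j₁ r, (AffNode.decide δ j₀ j₁ :: r) <:+ c ∧
    DagReach AffNode.refs (AffNode.decide δ j₀ j₁ :: r) n ∧ i ∈ δ.vars ∧ k ∈ δ.vars

/-- Different children of the conjunctive or disjunctive node `n` of `c` share no variable, and
their variables are not connected through the affine clauses decided above `n`. -/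
def Separated (c n r : AffTree m) (js : List ℕ) : Prop :=
  js.Pairwise fun j k => ∀ a ∈ vars (r.drop j), ∀ b ∈ vars (r.drop k),
    ¬ Relation.ReflTransGen (Linked c n) a b

/-- A tree of affine decision nodes and affine decomposable conjunctive and disjunctive nodes. -/
def IsEADT (c : AffTree m) : Prop :=
  IsTreeDag AffNode.refs c ∧
  (∀ js r, (AffNode.conj js :: r) <:+ c → Separated c (AffNode.conj js :: r) r js) ∧
  (∀ js r, (AffNode.disj js :: r) <:+ c → Separated c (AffNode.disj js :: r) r js)

end AffTree

def EADT : Lang := ⟨AffTree, AffTree.IsEADT, AffTree.eval, AffTree.encode⟩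

end KC

/-! Weak contrastive explanations are closed under supersets, and the set of all features is one
because the classifier is not constant. Deleting the features one after the other, whenever a weak
explanation remains, therefore ends in a minimal one after a single pass (`greedy_isCXp`). Each
deletion test asks whether the classifier takes a value `b` on the subcube of the points that agree
with `v` outside a set `Y`. So it suffices to decide this question in polynomial time for each
language and for both values of `b` (`OneCXpInPolyTime.of_sat`).

Running times are handled by a class `PolyTime` of functions between encodable types. It is closed
under composition, pairing, branching and iteration over lists, the latter provided that the
intermediate results stay polynomially small (`PolyTime.foldl_of_bdd`). `fun_prop` then assembles
the programs.

CNFs: a CNF can be falsified on a subcube iff one of its clauses can. For satisfiability, unit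
propagation is run. In a renamable Horn CNF without conflict, every variable that is still open can
be set to the value that is false after the renaming (`CNF.model_of_satisfiable`). In a PI formula
without a model in the subcube, the clause that denies the fixed literals is entailed, hence a
clause of the formula is already falsified by the fixed literals (`CNF.sat_iff_of_isPI`). IP follows
by complementing points and values.

AFF: Gaussian elimination over the field with two elements, with one system per clause for
falsification (`Affine.solvable_iff`).

dFSD: thanks to focusing, every path whose labels are possible one by one is followed by a single
point (`SetLabeled.Reach.exists_run`), so satisfiability is reachability of the sink. By determinism
a point is a non-model once it follows a path to a node where it is stuck, and this is again tested
by reachability, for each choice of the variable and value responsible.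

d-DNNF, cd-PDAG, SDD, OBDD: all are circuits with decomposable conjunctions and deterministic
disjunctions, so the density of the models in the subcube is computed bottom-up by products, sums
and `1 - a` (`Counting.cast_value`). Numbers are unary, so the computation is carried out modulo `2k
+ 1` for all small `k`; there 2 is invertible. The number of models is at most `2 ^ m`, and if it is
positive, one of these moduli does not divide it (`exists_odd_not_dvd`).

EADT: for each node it is computed bottom-up whether the value `b` occurs there at a point that
satisfies the affine clauses decided on the path to the node. Leaves need Gaussian elimination. At
affine decomposable nodes, points found for different children are glued along sets of connected
variables, which respects all clauses on the path (`AffineTree.exists_compatible_forall`). -/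

namespace KC

/-! ## Encodable types and polynomial-time functions -/

/-- Types whose elements are written as trees. -/
class Enc (α : Type) where
  enc : α → Data

open Enc (enc)

instance : Enc Data := ⟨fun d => d⟩
instance : Enc Unit := ⟨fun _ => Data.nil⟩
instance : Enc Bool := ⟨Data.ofBool⟩
instance : Enc ℕ := ⟨Data.ofNat⟩
instance {α β : Type} [Enc α] [Enc β] : Enc (α × β) := ⟨fun x => .cons (enc x.1) (enc x.2)⟩
instance {α : Type} [Enc α] : Enc (List α) := ⟨fun l => Data.ofList enc l⟩

/-- Size of the written form. -/
def sz {α : Type} [Enc α] (a : α) : ℕ := (enc a).size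

/-! ### Sizes of encodings and polynomial bounds -/

section Infrastructure

variable {α β γ δ ι σ : Type} [Enc α] [Enc β] [Enc γ] [Enc δ] [Enc ι] [Enc σ]

theorem Data.size_pos (d : Data) : 1 ≤ d.size := by cases d <;> simp [Data.size]

theorem sz_pos (a : α) : 1 ≤ sz a := Data.size_pos _

@[simp] theorem sz_pair (a : α) (b : β) : sz (a, b) = sz a + sz b + 1 := rfl
@[simp] theorem sz_nil : sz ([] : List α) = 1 := rfl
@[simp] theorem sz_cons (a : α) (l : List α) : sz (a :: l) = sz a + sz l + 1 := rfl
@[simp] theorem sz_unit (a : Unit) : sz a = 1 := rfl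
@[simp] theorem sz_zero : sz (0 : ℕ) = 1 := rfl
@[simp] theorem sz_succ (n : ℕ) : sz (n + 1) = sz n + 2 := by
  simp [sz, enc, Data.ofNat, Data.size]; omega
theorem sz_nat (n : ℕ) : sz n = 2 * n + 1 := by
  induction n with
  | zero => rfl
  | succ n ih => rw [sz_succ, ih]; omega
theorem sz_bool_le (b : Bool) : sz b ≤ 3 := by cases b <;> simp [sz, enc, Data.ofBool, Data.size]

theorem sz_mem_le {l : List α} {a : α} (h : a ∈ l) : sz a ≤ sz l := by
  induction l with
  | nil => simp at h
  | cons b l ih =>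
    rw [sz_cons]
    rcases List.mem_cons.1 h with rfl | h
    · omega
    · have := ih h; omega

theorem length_le_sz (l : List α) : l.length ≤ sz l := by
  induction l with
  | nil => simp
  | cons b l ih => simp; omega

theorem sz_list_le {l : List α} {B : ℕ} (h : ∀ a ∈ l, sz a ≤ B) :
    sz l ≤ l.length * (B + 1) + 1 := by
  induction l with
  | nil => simp
  | cons b l ih =>
    have h1 := h b (by simp)
    have h2 := ih fun a ha => h a (by simp [ha])
    simp only [sz_cons, List.length_cons, Nat.add_mul]
    omega

theorem sz_drop_le (l : List α) (k : ℕ) : sz (l.drop k) ≤ sz l := by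
  induction l generalizing k with
  | nil => simp
  | cons b l ih =>
    cases k with
    | zero => simp
    | succ k => have := ih k; simp; omega

/-- Every instruction pays for the trees that it reads and writes, so the cost dominates both sizes.
Hence outputs of polynomial-time functions have polynomial size (`PolyBdd.sz_comp`). -/
theorem Runs.size_le {p : Prog} {a b : Data} {t : ℕ} (h : Runs p a b t) :
    a.size ≤ t ∧ b.size ≤ t := by
  induction h <;> constructor <;> (try simp only [Data.size] at *) <;> omega

theorem eval_mono (P : Polynomial ℕ) {m n : ℕ} (h : m ≤ n) : P.eval m ≤ P.eval n := by
  rw [Polynomial.eval_eq_sum_range, Polynomial.eval_eq_sum_range]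
  exact Finset.sum_le_sum fun i _ => Nat.mul_le_mul_left _ (Nat.pow_le_pow_left h i)

/-- A quantity that is at most polynomial in the size of the argument. -/
@[fun_prop] def PolyBdd (b : α → ℕ) : Prop := ∃ Q : Polynomial ℕ, ∀ a, b a ≤ Q.eval (sz a)

namespace PolyBdd

theorem mono {b c : α → ℕ} (hc : PolyBdd c) (h : ∀ a, b a ≤ c a) : PolyBdd b := by
  obtain ⟨Q, hQ⟩ := hc
  exact ⟨Q, fun a => (h a).trans (hQ a)⟩

@[fun_prop] theorem const (n : ℕ) : PolyBdd (fun _ : α => n) := ⟨Polynomial.C n, by simp⟩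

@[fun_prop] theorem size : PolyBdd (fun a : α => sz a) := ⟨Polynomial.X, by simp⟩

@[fun_prop] theorem add {b c : α → ℕ} (hb : PolyBdd b) (hc : PolyBdd c) :
    PolyBdd (fun a => b a + c a) := by
  obtain ⟨P, hP⟩ := hb
  obtain ⟨Q, hQ⟩ := hc
  exact ⟨P + Q, fun a => by rw [Polynomial.eval_add]; exact Nat.add_le_add (hP a) (hQ a)⟩

@[fun_prop] theorem mul {b c : α → ℕ} (hb : PolyBdd b) (hc : PolyBdd c) :
    PolyBdd (fun a => b a * c a) := by
  obtain ⟨P, hP⟩ := hb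
  obtain ⟨Q, hQ⟩ := hc
  exact ⟨P * Q, fun a => by rw [Polynomial.eval_mul]; exact Nat.mul_le_mul (hP a) (hQ a)⟩

@[fun_prop] theorem eval (P : Polynomial ℕ) {b : α → ℕ} (hb : PolyBdd b) :
    PolyBdd (fun a => P.eval (b a)) := by
  obtain ⟨Q, hQ⟩ := hb
  exact ⟨P.comp Q, fun a => by rw [Polynomial.eval_comp]; exact eval_mono P (hQ a)⟩

end PolyBdd

/-- Functions computed by a program in polynomial time. -/
@[fun_prop] def PolyTime (f : α → β) : Prop :=
  ∃ (p : Prog) (P : Polynomial ℕ), ∀ a, ∃ t, Runs p (enc a) (enc (f a)) t ∧ t ≤ P.eval (sz a)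

theorem PolyTime.of_runs {f : α → β} (p : Prog) {b : α → ℕ} (hb : PolyBdd b)
    (h : ∀ a, ∃ t, Runs p (enc a) (enc (f a)) t ∧ t ≤ b a) : PolyTime f := by
  obtain ⟨Q, hQ⟩ := hb
  refine ⟨p, Q, fun a => ?_⟩
  obtain ⟨t, h1, h2⟩ := h a
  exact ⟨t, h1, h2.trans (hQ a)⟩

/-- Programs only see trees, so the codomain may change as long as the written output stays the
same. This turns operations on trees into operations on typed data. -/
theorem PolyTime.of_enc_eq {f : α → β} {g : α → γ} (hf : PolyTime f)
    (h : ∀ a, enc (g a) = enc (f a)) : PolyTime g := by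
  obtain ⟨p, P, hp⟩ := hf
  exact ⟨p, P, fun a => by rw [h]; exact hp a⟩

@[fun_prop] theorem PolyBdd.sz_comp {f : α → β} (hf : PolyTime f) :
    PolyBdd (fun a => sz (f a)) := by
  obtain ⟨p, P, hp⟩ := hf
  refine ⟨P, fun a => ?_⟩
  obtain ⟨t, h1, h2⟩ := hp a
  exact h1.size_le.2.trans h2

@[fun_prop] theorem PolyBdd.length {f : α → List β} (hf : PolyTime f) :
    PolyBdd (fun a => (f a).length) :=
  (PolyBdd.sz_comp hf).mono fun _ => length_le_sz _

/-! ### Composition, pairing, constants and branching in polynomial time -/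

namespace PolyTime

@[fun_prop] theorem id : PolyTime (fun x : α => x) :=
  of_runs .id (b := fun a => sz a + sz a + 1) (by fun_prop) fun _ => ⟨_, .id _, le_rfl⟩

@[fun_prop] theorem comp {g : β → γ} {f : α → β} (hg : PolyTime g) (hf : PolyTime f) :
    PolyTime (fun x => g (f x)) := by
  obtain ⟨q, Q, hq⟩ := hg
  have hf' := hf
  obtain ⟨p, P, hp⟩ := hf'
  refine of_runs (.seq p q) (b := fun a => P.eval (sz a) + Q.eval (sz (f a)) + 1)
    (by fun_prop) fun a => ?_
  obtain ⟨s, h1, h2⟩ := hp a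
  obtain ⟨t, h3, h4⟩ := hq (f a)
  exact ⟨_, .seq h1 h3, by omega⟩

@[fun_prop] theorem pair {g : α → γ} {f : α → β} (hg : PolyTime g) (hf : PolyTime f) :
    PolyTime (fun x => (g x, f x)) := by
  have hg' := hg
  have hf' := hf
  obtain ⟨q, Q, hq⟩ := hg'
  obtain ⟨p, P, hp⟩ := hf'
  refine of_runs (.cons q p) (b := fun a => Q.eval (sz a) + P.eval (sz a) + sz a + sz (g a)
    + sz (f a) + 2) (by fun_prop) fun a => ?_
  obtain ⟨s, h1, h2⟩ := hp a
  obtain ⟨t, h3, h4⟩ := hq a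
  refine ⟨_, .cons h3 h1, ?_⟩
  simp only [sz, Data.size] at *
  omega

@[fun_prop] theorem data_hd {f : α → Data} (hf : PolyTime f) : PolyTime (fun x => (f x).hd) := by
  refine comp (g := Data.hd) (of_runs .hd (b := fun a => sz a + sz a + 1) (by fun_prop)
    fun a => ⟨_, .hd _, ?_⟩) hf
  cases a <;> simp [sz, enc, Data.hd, Data.size]; omega

@[fun_prop] theorem data_tl {f : α → Data} (hf : PolyTime f) : PolyTime (fun x => (f x).tl) := by
  refine comp (g := Data.tl) (of_runs .tl (b := fun a => sz a + sz a + 1) (by fun_prop)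
    fun a => ⟨_, .tl _, ?_⟩) hf
  cases a <;> simp [sz, enc, Data.tl, Data.size]; omega

theorem toData : PolyTime (fun x : α => enc x) := id.of_enc_eq fun _ => rfl

@[fun_prop] theorem fst {g : α → β × γ} (hg : PolyTime g) : PolyTime (fun x => (g x).1) :=
  (data_hd (comp toData hg)).of_enc_eq fun _ => rfl

@[fun_prop] theorem snd {g : α → β × γ} (hg : PolyTime g) : PolyTime (fun x => (g x).2) :=
  (data_tl (comp toData hg)).of_enc_eq fun _ => rfl

theorem const_data (d : Data) : PolyTime (fun _ : α => d) := by
  induction d with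
  | nil =>
    exact of_runs .nil (b := fun a => sz a + 2) (by fun_prop) fun _ => ⟨_, .nil _, by
      simp [sz, Data.size]⟩
  | cons a b iha ihb => exact (pair iha ihb).of_enc_eq fun _ => rfl

@[fun_prop] theorem const (b : β) : PolyTime (fun _ : α => b) :=
  (const_data (enc b)).of_enc_eq fun _ => rfl

@[fun_prop] theorem cond {c : α → Bool} {f g : α → β} (hc : PolyTime c) (hf : PolyTime f)
    (hg : PolyTime g) : PolyTime (fun x => bif c x then f x else g x) := by
  obtain ⟨pc, C, hc⟩ := hc
  obtain ⟨p, P, hp⟩ := hf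
  obtain ⟨q, Q, hq⟩ := hg
  refine of_runs (.ite pc p q) (b := fun a => C.eval (sz a) + P.eval (sz a) + Q.eval (sz a)
    + sz a + 1) (by fun_prop) fun a => ?_
  obtain ⟨r, h1, h2⟩ := hc a
  obtain ⟨s, h3, h4⟩ := hp a
  obtain ⟨t, h5, h6⟩ := hq a
  cases h : c a with
  | true =>
    rw [h] at h1
    exact ⟨_, .iteTrue h1 h3, by simp only [sz] at *; omega⟩
  | false =>
    rw [h] at h1
    exact ⟨_, .iteFalse h1 h5, by simp only [sz] at *; omega⟩

end PolyTime

/-- `D k` is the store before round `k`. A round costs at most `3 * T + 1`: the test, the body, and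
the size of the store, which is itself bounded by the cost of the test. -/
theorem runs_loop {c p : Prog} {T : ℕ} (n : ℕ) (D : ℕ → Data)
    (hc : ∀ k < n, ∃ d e t, Runs c (D k) (.cons d e) t ∧ t ≤ T)
    (hn : ∃ t, Runs c (D n) .nil t ∧ t ≤ T)
    (hp : ∀ k < n, ∃ t, Runs p (D k) (D (k + 1)) t ∧ t ≤ T) :
    ∃ t, Runs (.loop c p) (D 0) (D n) t ∧ t ≤ (n + 1) * (3 * T + 1) := by
  induction n generalizing D with
  | zero =>
    obtain ⟨t, h1, h2⟩ := hn
    have := h1.size_le.1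
    exact ⟨_, .loopStop h1, by omega⟩
  | succ n ih =>
    obtain ⟨d, e, r, h1, h2⟩ := hc 0 (by omega)
    obtain ⟨s, h3, h4⟩ := hp 0 (by omega)
    obtain ⟨t, h5, h6⟩ := ih (fun k => D (k + 1)) (fun k hk => hc (k + 1) (by omega)) hn
      (fun k hk => hp (k + 1) (by omega))
    have := h1.size_le.1
    refine ⟨_, .loopStep h1 h3 h5, ?_⟩
    rw [Nat.add_mul (n + 1) 1]
    omega

/-! ### Iteration over lists -/

namespace PolyTime

/-- Iteration over a list is polynomial if the intermediate results have polynomial size. -/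
theorem foldl_of_bdd {l : ι → List α} {s : ι → σ} {f : ι → σ → α → σ} (hl : PolyTime l)
    (hs : PolyTime s) (hf : PolyTime fun x : ι × σ × α => f x.1 x.2.1 x.2.2) {b : ι → ℕ}
    (hb : PolyBdd b) (h : ∀ i k, sz (((l i).take k).foldl (f i) (s i)) ≤ b i) :
    PolyTime (fun i => (l i).foldl (f i) (s i)) := by
  have hinit : PolyTime fun i => (i, l i, s i) := by fun_prop
  -- The remaining list is itself the loop test, because exactly the empty list is written as `nil`.
  have hcond : PolyTime fun x : ι × List α × σ => x.2.1 := by fun_prop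
  have hfin : PolyTime fun x : ι × List α × σ => x.2.2 := by fun_prop
  -- A nonempty list and the pair of its head and tail are the same tree, so the body may be typed
  -- with the pair.
  have hbody : PolyTime fun x : ι × (α × List α) × σ =>
      (x.1, x.2.1.2, f x.1 x.2.2 x.2.1.1) := by
    have := comp hf (f := fun x : ι × (α × List α) × σ => (x.1, x.2.2, x.2.1.1)) (by fun_prop)
    fun_prop
  obtain ⟨p0, P0, hp0⟩ := hinit
  obtain ⟨pc, Pc, hpc⟩ := hcond
  obtain ⟨pb, Pb, hpb⟩ := hbody
  obtain ⟨pf, Pf, hpf⟩ := hfin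
  refine of_runs (.seq p0 (.seq (.loop pc pb) pf))
    (b := fun i => P0.eval (sz i) + ((((l i).length + 1) *
      (3 * (Pc.eval (sz i + sz (l i) + b i + 2) + Pb.eval (sz i + sz (l i) + b i + 2)) + 1))
      + Pf.eval (sz i + sz (l i) + b i + 2) + 1) + 1) (by fun_prop) fun i => ?_
  obtain ⟨t0, h1, h2⟩ := hp0 i
  -- Bounds the size of every loop state; the summand 2 comes from the two pairings.
  set M := sz i + sz (l i) + b i + 2 with hM
  let X : ℕ → ι × List α × σ := fun k => (i, (l i).drop k, ((l i).take k).foldl (f i) (s i))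
  have hX : ∀ k, sz (X k) ≤ M := fun k => by
    have h1 := h i k
    have h2 := sz_drop_le (l i) k
    simp only [X, sz_pair]
    omega
  obtain ⟨t1, h3, h4⟩ := runs_loop (c := pc) (p := pb) (T := Pc.eval M + Pb.eval M)
    (l i).length (fun k => enc (X k))
    (fun k hk => by
      obtain ⟨t, h5, h6⟩ := hpc (X k)
      refine ⟨enc ((l i)[k]), enc ((l i).drop (k + 1)), t, ?_, ?_⟩
      · have : enc (X k).2.1 = .cons (enc ((l i)[k])) (enc ((l i).drop (k + 1))) := by
          simp only [X]
          rw [List.drop_eq_getElem_cons hk]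
          rfl
        rw [← this]
        exact h5
      · exact h6.trans ((eval_mono Pc (hX k)).trans (by omega)))
    (by
      obtain ⟨t, h5, h6⟩ := hpc (X (l i).length)
      refine ⟨t, ?_, h6.trans ((eval_mono Pc (hX _)).trans (by omega))⟩
      have : enc (X (l i).length).2.1 = .nil := by
        simp only [X, List.drop_length]
        rfl
      rw [← this]
      exact h5)
    (fun k hk => by
      obtain ⟨t, h5, h6⟩ := hpb (i, ((l i)[k], (l i).drop (k + 1)), ((l i).take k).foldl (f i) (s i))
      have e1 : enc (X k) = enc (i, ((l i)[k], (l i).drop (k + 1)),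
          ((l i).take k).foldl (f i) (s i)) := by
        simp only [X]
        rw [List.drop_eq_getElem_cons hk]
        rfl
      have e2 : X (k + 1) = (i, (l i).drop (k + 1),
          f i (((l i).take k).foldl (f i) (s i)) (l i)[k]) := by
        simp only [X]
        rw [List.take_succ_eq_append_getElem hk, List.foldl_append]
        rfl
      refine ⟨t, ?_, h6.trans ?_⟩
      · rw [e2]
        simp only [e1]
        exact h5
      · have := hX k
        have h7 := eval_mono Pb this
        rw [sz] at h7
        rw [e1] at h7
        exact h7.trans (by omega))
  obtain ⟨t2, h7, h8⟩ := hpf (X (l i).length)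
  have e3 : (X (l i).length).2.2 = (l i).foldl (f i) (s i) := by simp [X]
  have e4 : X 0 = (i, l i, s i) := by simp [X]
  beta_reduce at h7
  rw [e3] at h7
  simp only [e4] at h3
  refine ⟨_, .seq h1 (.seq h3 h7), ?_⟩
  have := eval_mono Pf (hX (l i).length)
  omega

theorem sz_foldl_le {τ : Type} {f : σ → τ → σ} {c : ℕ} (l : List τ) (s : σ)
    (h : ∀ s, ∀ a ∈ l, sz (f s a) ≤ sz s + c) : sz (l.foldl f s) ≤ sz s + l.length * c := by
  induction l generalizing s with
  | nil => simp
  | cons a l ih =>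
    have h1 := ih (f s a) fun s a ha => h s a (by simp [ha])
    have h2 := h s a (by simp)
    simp only [List.foldl_cons, List.length_cons, Nat.add_mul]
    omega

/-- Iteration over a list is polynomial if each step adds polynomially to the size. -/
theorem foldl {l : ι → List α} {s : ι → σ} {f : ι → σ → α → σ} (hl : PolyTime l)
    (hs : PolyTime s) (hf : PolyTime fun x : ι × σ × α => f x.1 x.2.1 x.2.2) {b : ι → ℕ}
    (hb : PolyBdd b) (h : ∀ i s, ∀ a ∈ l i, sz (f i s a) ≤ sz s + b i) :
    PolyTime (fun i => (l i).foldl (f i) (s i)) := by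
  refine foldl_of_bdd hl hs hf (b := fun i => sz (s i) + (l i).length * b i) (by fun_prop)
    fun i k => (sz_foldl_le _ _ fun s a ha => h i s a (List.mem_of_mem_take ha)).trans ?_
  exact Nat.add_le_add_left (Nat.mul_le_mul_right _ (by simp)) _

/-- A member of a list is no larger than the list, so the polynomial bound for `g` becomes uniform
over the members. Such bounds are what the iteration lemmas ask for. -/
theorem exists_bdd_mem {l : ι → List α} {g : ι → α → β} (hl : PolyTime l)
    (hg : PolyTime fun x : ι × α => g x.1 x.2) :
    ∃ b : ι → ℕ, PolyBdd b ∧ ∀ i, ∀ a ∈ l i, sz (g i a) ≤ b i := by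
  obtain ⟨Q, hQ⟩ := PolyBdd.sz_comp hg
  refine ⟨fun i => Q.eval (sz i + sz (l i) + 1), by fun_prop, fun i a ha => ?_⟩
  refine (hQ (i, a)).trans (eval_mono Q ?_)
  have := sz_mem_le ha
  simp only [sz_pair]
  omega

/-! ### Lists and numbers -/

@[fun_prop] theorem list_cons {f : α → β} {l : α → List β} (hf : PolyTime f) (hl : PolyTime l) :
    PolyTime (fun x => f x :: l x) := (pair hf hl).of_enc_eq fun _ => rfl

/-- The tree is not a leaf. -/
def _root_.KC.Data.toBool : Data → Bool
  | .nil => false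
  | .cons _ _ => true

@[fun_prop] theorem data_toBool {f : α → Data} (hf : PolyTime f) :
    PolyTime (fun x => (f x).toBool) := by
  obtain ⟨p, P, hp⟩ : PolyTime fun _ : Data => true := by fun_prop
  obtain ⟨q, Q, hq⟩ : PolyTime fun _ : Data => false := by fun_prop
  obtain ⟨r, R, hr⟩ : PolyTime fun d : Data => d := by fun_prop
  refine comp (g := Data.toBool) (of_runs (.ite r p q) (b := fun a => R.eval (sz a) +
    P.eval (sz a) + Q.eval (sz a) + sz a + 1) (by fun_prop) fun a => ?_) hf
  obtain ⟨s, h1, h2⟩ := hp a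
  obtain ⟨t, h3, h4⟩ := hq a
  obtain ⟨u, h5, h6⟩ := hr a
  cases a with
  | nil => exact ⟨_, .iteFalse h5 h3, by simp only [sz, enc] at *; omega⟩
  | cons a b => exact ⟨_, .iteTrue h5 h1, by simp only [sz, enc] at *; omega⟩

@[fun_prop] theorem isEmpty {l : α → List β} (hl : PolyTime l) :
    PolyTime (fun x => (l x).isEmpty) := by
  have h : PolyTime (fun x => bif (enc (l x)).toBool then false else true) := by
    have := comp toData hl
    fun_prop
  refine h.of_enc_eq fun x => ?_
  cases l x <;> rfl

@[fun_prop] theorem not {f : α → Bool} (hf : PolyTime f) : PolyTime (fun x => !(f x)) := by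
  have h : PolyTime (fun x => bif f x then false else true) := by fun_prop
  exact h.of_enc_eq fun x => by cases f x <;> rfl

@[fun_prop] theorem and {f g : α → Bool} (hf : PolyTime f) (hg : PolyTime g) :
    PolyTime (fun x => f x && g x) := by
  have h : PolyTime (fun x => bif f x then g x else false) := by fun_prop
  exact h.of_enc_eq fun x => by cases f x <;> rfl

@[fun_prop] theorem or {f g : α → Bool} (hf : PolyTime f) (hg : PolyTime g) :
    PolyTime (fun x => f x || g x) := by
  have h : PolyTime (fun x => bif f x then true else g x) := by fun_prop
  exact h.of_enc_eq fun x => by cases f x <;> rfl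

@[fun_prop] theorem xor {f g : α → Bool} (hf : PolyTime f) (hg : PolyTime g) :
    PolyTime (fun x => Bool.xor (f x) (g x)) := by
  have h : PolyTime (fun x => bif f x then !(g x) else g x) := by fun_prop
  exact h.of_enc_eq fun x => by cases f x <;> simp

@[fun_prop] theorem bool_beq {f g : α → Bool} (hf : PolyTime f) (hg : PolyTime g) :
    PolyTime (fun x => f x == g x) := by
  have h : PolyTime (fun x => bif f x then g x else !(g x)) := by fun_prop
  exact h.of_enc_eq fun x => by cases f x <;> simp

@[fun_prop] theorem headD {l : α → List β} {d : α → β} (hl : PolyTime l) (hd : PolyTime d) :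
    PolyTime (fun x => (l x).headD (d x)) := by
  have h : PolyTime (fun x => bif (l x).isEmpty then enc (d x) else (enc (l x)).hd) := by
    have := comp toData hl
    have := comp toData hd
    fun_prop
  refine h.of_enc_eq fun x => ?_
  cases l x <;> rfl

@[fun_prop] theorem tail {l : α → List β} (hl : PolyTime l) : PolyTime (fun x => (l x).tail) := by
  refine (data_tl (comp toData hl)).of_enc_eq fun x => ?_
  cases l x <;> rfl

theorem sz_tail_le (l : List α) : sz l.tail ≤ sz l := by
  cases l <;> simp; omega

@[fun_prop] theorem reverse {l : α → List β} (hl : PolyTime l) :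
    PolyTime (fun x => (l x).reverse) := by
  have h : PolyTime (fun x => (l x).foldl (fun s a => a :: s) []) := by
    refine foldl hl (by fun_prop) (by fun_prop) (b := fun x => sz (l x) + 1) (by fun_prop)
      fun i s a ha => ?_
    have := sz_mem_le ha
    simp only [sz_cons]
    omega
  simpa only [List.foldl_flip_cons_eq_append', List.append_nil] using h

theorem foldr {l : ι → List α} {s : ι → σ} {f : ι → α → σ → σ} (hl : PolyTime l)
    (hs : PolyTime s) (hf : PolyTime fun x : ι × α × σ => f x.1 x.2.1 x.2.2) {b : ι → ℕ}
    (hb : PolyBdd b) (h : ∀ i s, ∀ a ∈ l i, sz (f i a s) ≤ sz s + b i) :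
    PolyTime (fun i => (l i).foldr (f i) (s i)) := by
  have h1 : PolyTime (fun i => (l i).reverse.foldl (fun t a => f i a t) (s i)) := by
    refine foldl (by fun_prop) hs ?_ hb fun i s a ha => h i s a (by simpa using ha)
    exact comp hf (f := fun x : ι × σ × α => (x.1, x.2.2, x.2.1)) (by fun_prop)
  simpa only [List.foldl_reverse] using h1

@[fun_prop] theorem append {l k : α → List β} (hl : PolyTime l) (hk : PolyTime k) :
    PolyTime (fun x => l x ++ k x) := by
  have h : PolyTime (fun x => (l x).foldr (fun a s => a :: s) (k x)) := by
    refine foldr hl hk (by fun_prop) (b := fun x => sz (l x) + 1) (by fun_prop)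
      fun i s a ha => ?_
    have := sz_mem_le ha
    simp only [sz_cons]
    omega
  simpa only [List.foldr_cons_eq_append', List.foldr_cons_eq_append] using h

@[fun_prop] theorem map {g : ι → α → β} {l : ι → List α} (hl : PolyTime l)
    (hg : PolyTime fun x : ι × α => g x.1 x.2) : PolyTime (fun i => (l i).map (g i)) := by
  obtain ⟨b, hb, hb'⟩ := exists_bdd_mem hl hg
  have h : PolyTime (fun i => (l i).foldr (fun a s => g i a :: s) []) := by
    refine foldr hl (by fun_prop) ?_ (b := fun x => b x + 1) (by fun_prop) fun i s a ha => ?_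
    · have := comp hg (f := fun x : ι × α × List β => (x.1, x.2.1)) (by fun_prop)
      fun_prop
    · have := hb' i a ha
      simp only [sz_cons]
      omega
  refine h.of_enc_eq fun i => ?_
  rw [List.map_eq_foldr]

@[fun_prop] theorem any {g : ι → α → Bool} {l : ι → List α} (hl : PolyTime l)
    (hg : PolyTime fun x : ι × α => g x.1 x.2) : PolyTime (fun i => (l i).any (g i)) := by
  have h : PolyTime (fun i => (l i).foldr (fun a s => g i a || s) false) := by
    refine foldr hl (by fun_prop) ?_ (b := fun _ => 3) (by fun_prop)
      fun i s a ha => (sz_bool_le _).trans (by omega)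
    have := comp hg (f := fun x : ι × α × Bool => (x.1, x.2.1)) (by fun_prop)
    fun_prop
  refine h.of_enc_eq fun i => ?_
  congr 1
  induction l i <;> simp_all

@[fun_prop] theorem all {g : ι → α → Bool} {l : ι → List α} (hl : PolyTime l)
    (hg : PolyTime fun x : ι × α => g x.1 x.2) : PolyTime (fun i => (l i).all (g i)) := by
  have h : PolyTime (fun i => !((l i).any fun a => !(g i a))) := by fun_prop
  refine h.of_enc_eq fun i => ?_
  rw [List.all_eq_not_any_not]

@[fun_prop] theorem filter {g : ι → α → Bool} {l : ι → List α} (hl : PolyTime l)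
    (hg : PolyTime fun x : ι × α => g x.1 x.2) : PolyTime (fun i => (l i).filter (g i)) := by
  have h : PolyTime (fun i => (l i).foldr (fun a s => bif g i a then a :: s else s) []) := by
    refine foldr hl (by fun_prop) ?_ (b := fun x => sz (l x) + 1) (by fun_prop)
      fun i s a ha => ?_
    · have := comp hg (f := fun x : ι × α × List α => (x.1, x.2.1)) (by fun_prop)
      fun_prop
    · have := sz_mem_le ha
      cases g i a <;> simp only [cond_true, cond_false, sz_cons] <;> omega
  refine h.of_enc_eq fun i => ?_
  congr 1
  induction l i with
  | nil => rfl
  | cons a l ih => cases h : g i a <;> simp [h, ih]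

-- In unary notation a successor is the same tree as the pair `((), n)`.
@[fun_prop] theorem succ {n : α → ℕ} (hn : PolyTime n) : PolyTime (fun x => n x + 1) := by
  have h : PolyTime fun x => ((), n x) := by fun_prop
  exact h.of_enc_eq fun _ => rfl

theorem pred {n : α → ℕ} (hn : PolyTime n) : PolyTime (fun x => n x - 1) := by
  refine (data_tl (comp toData hn)).of_enc_eq fun x => ?_
  cases n x <;> rfl

-- A unary number and a list of units are the same tree. Loops over numbers thereby become loops
-- over lists.
@[fun_prop] theorem replicate_unit {n : α → ℕ} (hn : PolyTime n) :
    PolyTime (fun x => List.replicate (n x) ()) := by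
  refine hn.of_enc_eq fun x => ?_
  induction n x with
  | zero => rfl
  | succ n ih => exact congrArg (Data.cons .nil) ih

@[fun_prop] theorem add {m n : α → ℕ} (hm : PolyTime m) (hn : PolyTime n) :
    PolyTime (fun x => m x + n x) := by
  have h : PolyTime (fun x => (List.replicate (n x) ()).foldl (fun s _ => s + 1) (m x)) :=
    foldl (by fun_prop) hm (by fun_prop) (b := fun _ => 2) (by fun_prop)
      fun i s a ha => (sz_succ s).le
  have e : ∀ k a : ℕ, (List.replicate k ()).foldl (fun s _ => s + 1) a = a + k := by
    intro k
    induction k with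
    | zero => simp
    | succ k ih => intro a; rw [List.replicate_succ, List.foldl_cons, ih]; omega
  simpa only [e] using h

@[fun_prop] theorem sub {m n : α → ℕ} (hm : PolyTime m) (hn : PolyTime n) :
    PolyTime (fun x => m x - n x) := by
  have h : PolyTime (fun x => (List.replicate (n x) ()).foldl (fun s _ => s - 1) (m x)) := by
    refine foldl (by fun_prop) hm (pred (by fun_prop)) (b := fun _ => 2) (by fun_prop)
      fun i s a ha => ?_
    rw [sz_nat, sz_nat]
    omega
  have e : ∀ k a : ℕ, (List.replicate k ()).foldl (fun s _ => s - 1) a = a - k := by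
    intro k
    induction k with
    | zero => simp
    | succ k ih => intro a; rw [List.replicate_succ, List.foldl_cons, ih]; omega
  simpa only [e] using h

@[fun_prop] theorem mul {m n : α → ℕ} (hm : PolyTime m) (hn : PolyTime n) :
    PolyTime (fun x => m x * n x) := by
  have h : PolyTime (fun x => (List.replicate (n x) ()).foldl (fun s _ => s + m x) 0) := by
    refine foldl (by fun_prop) (by fun_prop) (by fun_prop) (b := fun x => sz (m x)) (by fun_prop)
      fun i s a ha => ?_
    rw [sz_nat, sz_nat, sz_nat]
    omega
  have e : ∀ k a b : ℕ, (List.replicate k ()).foldl (fun s _ => s + a) b = a * k + b := by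
    intro k
    induction k with
    | zero => simp
    | succ k ih => intro a b; rw [List.replicate_succ, List.foldl_cons, ih]; ring
  simpa only [e, add_zero] using h

@[fun_prop] theorem nat_le {m n : α → ℕ} (hm : PolyTime m) (hn : PolyTime n) :
    PolyTime (fun x => Nat.ble (m x) (n x)) := by
  have h : PolyTime (fun x => (List.replicate (m x - n x) ()).isEmpty) := by fun_prop
  refine h.of_enc_eq fun x => ?_
  congr 1
  rw [Bool.eq_iff_iff]
  simp [Nat.ble_eq]
  omega

@[fun_prop] theorem nat_beq {m n : α → ℕ} (hm : PolyTime m) (hn : PolyTime n) :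
    PolyTime (fun x => m x == n x) := by
  have h : PolyTime (fun x => Nat.ble (m x) (n x) && Nat.ble (n x) (m x)) := by fun_prop
  refine h.of_enc_eq fun x => ?_
  congr 1
  rw [Bool.eq_iff_iff]
  simp [Nat.ble_eq]
  omega

-- A counter that returns to 0 whenever it reaches the modulus. For modulus 0 it never returns, in
-- accordance with `k % 0 = k`.
@[fun_prop] theorem mod {m n : α → ℕ} (hm : PolyTime m) (hn : PolyTime n) :
    PolyTime (fun x => m x % n x) := by
  have h : PolyTime (fun x => (List.replicate (m x) ()).foldl
      (fun s _ => bif s + 1 == n x then 0 else s + 1) 0) := by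
    refine foldl (by fun_prop) (by fun_prop) (by fun_prop) (b := fun x => 2) (by fun_prop)
      fun i s a ha => ?_
    cases h : (s + 1 == n i) <;> simp only [cond_true, cond_false, sz_nat] <;> omega
  have e : ∀ q k : ℕ, (List.replicate k ()).foldl
      (fun s _ => bif s + 1 == q then 0 else s + 1) 0 = k % q := by
    intro q k
    induction k with
    | zero => simp
    | succ k ih =>
      rw [List.replicate_succ', List.foldl_append, ih]
      simp only [List.foldl_cons, List.foldl_nil]
      rw [← Nat.mod_add_mod k q 1]
      by_cases hk : k % q + 1 = q
      · simp [hk]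
      · have hk' : (k % q + 1 == q) = false := by simpa using hk
        rw [hk', cond_false]
        rcases Nat.eq_zero_or_pos q with rfl | hq
        · simp
        · have := Nat.mod_lt k hq
          exact (Nat.mod_eq_of_lt (by omega)).symm
  simpa only [e] using h

@[fun_prop] theorem length {l : α → List β} (hl : PolyTime l) :
    PolyTime (fun x => (l x).length) := by
  have h : PolyTime (fun x => ((l x).map fun _ => ())) := by fun_prop
  refine h.of_enc_eq fun x => ?_
  induction l x with
  | nil => rfl
  | cons a l ih => exact congrArg (Data.cons .nil) ih

@[fun_prop] theorem range {n : α → ℕ} (hn : PolyTime n) :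
    PolyTime (fun x => List.range (n x)) := by
  have e : ∀ k : ℕ, (List.replicate k ()).foldl (fun s _ => s.length :: s) []
      = (List.range k).reverse := by
    intro k
    induction k with
    | zero => rfl
    | succ k ih => rw [List.replicate_succ', List.foldl_append, ih]; simp [List.range_succ]
  have h : PolyTime (fun x => ((List.replicate (n x) ()).foldl
      (fun s _ => s.length :: s) []).reverse) := by
    -- The element added depends on the length of the accumulator, so the size is bounded globally
    -- and not step by step.
    refine reverse (foldl_of_bdd (by fun_prop) (by fun_prop) (by fun_prop)
      (b := fun x => sz (n x) * (sz (n x) + 1) + 1) (by fun_prop) fun i k => ?_)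
    rw [List.take_replicate, e]
    refine (sz_list_le (B := sz (n i)) fun a ha => ?_).trans ?_
    · simp only [List.mem_reverse, List.mem_range] at ha
      rw [sz_nat, sz_nat]
      omega
    · refine Nat.add_le_add_right (Nat.mul_le_mul_right _ ?_) _
      simp only [List.length_reverse, List.length_range, sz_nat]
      omega
  simpa only [e, List.reverse_reverse] using h

@[fun_prop] theorem drop {n : α → ℕ} {l : α → List β} (hn : PolyTime n) (hl : PolyTime l) :
    PolyTime (fun x => (l x).drop (n x)) := by
  have h : PolyTime (fun x => (List.replicate (n x) ()).foldl (fun s _ => s.tail) (l x)) := by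
    refine foldl (by fun_prop) hl (by fun_prop) (b := fun _ => 0) (by fun_prop)
      fun i s a ha => sz_tail_le s
  have e : ∀ (k : ℕ) (a : List β),
      (List.replicate k ()).foldl (fun s _ => s.tail) a = a.drop k := by
    intro k
    induction k with
    | zero => simp
    | succ k ih => intro a; rw [List.replicate_succ, List.foldl_cons, ih]; simp
  simpa only [e] using h

@[fun_prop] theorem take {n : α → ℕ} {l : α → List β} (hn : PolyTime n) (hl : PolyTime l) :
    PolyTime (fun x => (l x).take (n x)) := by
  have h : PolyTime (fun x => ((l x).reverse.drop ((l x).length - n x)).reverse) := by fun_prop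
  refine h.of_enc_eq fun x => ?_
  rw [← List.length_reverse (as := l x), ← List.take_reverse, List.reverse_reverse]

@[fun_prop] theorem getD {n : α → ℕ} {l : α → List β} {d : α → β} (hl : PolyTime l)
    (hn : PolyTime n) (hd : PolyTime d) : PolyTime (fun x => (l x).getD (n x) (d x)) := by
  have h : PolyTime (fun x => ((l x).drop (n x)).headD (d x)) := by fun_prop
  refine h.of_enc_eq fun x => ?_
  simp [List.getD_eq_getElem?_getD, List.headD_eq_head?_getD, List.head?_drop]

@[fun_prop] theorem set {n : α → ℕ} {l : α → List β} {d : α → β} (hl : PolyTime l)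
    (hn : PolyTime n) (hd : PolyTime d) : PolyTime (fun x => (l x).set (n x) (d x)) := by
  have h : PolyTime (fun x => (List.range (l x).length).map
      fun k => bif n x == k then d x else (l x).getD k (d x)) := by fun_prop
  refine h.of_enc_eq fun x => ?_
  congr 1
  refine List.ext_getElem (by simp) fun k h1 h2 => ?_
  have h3 : k < (l x).length := by simpa using h1
  by_cases hk : n x = k
  · simp [hk]
  · have hk' : (n x == k) = false := by simpa using hk
    simp [hk, hk', h3]

end PolyTime

/-! ### Decoding -/

namespace Data

def toList : Data → List Data
  | nil => []
  | cons a b => a :: b.toList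

def toNat (d : Data) : ℕ := d.toList.length

@[simp] theorem toList_ofList {α : Type} (f : α → Data) (l : List α) :
    (ofList f l).toList = l.map f := by
  induction l with
  | nil => rfl
  | cons a l ih => simp [ofList, toList, ih]

@[simp] theorem toNat_ofNat (n : ℕ) : (ofNat n).toNat = n := by
  induction n with
  | zero => rfl
  | succ n ih => simpa [toNat, ofNat, toList] using ih

@[simp] theorem toBool_ofBool (b : Bool) : (ofBool b).toBool = b := by cases b <;> rfl

@[simp] theorem hd_cons (a b : Data) : (cons a b).hd = a := rfl
@[simp] theorem tl_cons (a b : Data) : (cons a b).tl = b := rfl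

end Data

namespace PolyTime

@[fun_prop] theorem data_toList {f : α → Data} (hf : PolyTime f) :
    PolyTime (fun x => (f x).toList) := by
  refine hf.of_enc_eq fun x => ?_
  induction f x with
  | nil => rfl
  | cons a b _ ih => exact congrArg (Data.cons a) ih

@[fun_prop] theorem data_toNat {f : α → Data} (hf : PolyTime f) :
    PolyTime (fun x => (f x).toNat) := by
  unfold Data.toNat
  fun_prop

/-- The bound on the value of a node must not depend on the values below, since values that reuse
shared nodes could otherwise grow exponentially. -/
theorem dagFold {l : ι → List α} {f : ι → α → List β → β} (hl : PolyTime l)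
    (hf : PolyTime fun x : ι × α × List β => f x.1 x.2.1 x.2.2) {b : ι → ℕ}
    (hb : PolyBdd b) (h : ∀ i vs, ∀ a ∈ l i, sz (f i a vs) ≤ b i) :
    PolyTime (fun i => dagFold (f i) (l i)) := by
  have h : PolyTime (fun i => (l i).foldr (fun a s => f i a s :: s) []) := by
    refine foldr hl (by fun_prop) (by fun_prop) (b := fun i => b i + 1) (by fun_prop)
      fun i s a ha => ?_
    have := h i s a ha
    simp only [sz_cons]
    omega
  refine h.of_enc_eq fun i => ?_
  congr 1
  induction l i with
  | nil => rfl
  | cons a l ih => simp [KC.dagFold, ih]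

end PolyTime

end Infrastructure

/-! ## Computing a contrastive explanation by deletion -/

theorem sz_set_le {α : Type} [Enc α] (l : List α) (i : ℕ) (a : α) :
    sz (l.set i a) ≤ sz l + sz a := by
  induction l generalizing i with
  | nil => simp
  | cons b l ih =>
    cases i with
    | zero => simp; omega
    | succ i => have := ih i; simp; omega

theorem ofFn_set {m : ℕ} {α : Type} (f : Fin m → α) (i : Fin m) (a : α) :
    (List.ofFn f).set i a = List.ofFn (Function.update f i a) := by
  refine List.ext_getElem (by simp) fun k h1 h2 => ?_
  have hk : k < m := by simpa using h2
  simp only [List.getElem_set, List.getElem_ofFn, Function.update_apply]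
  by_cases h : (i : ℕ) = k
  · have : (⟨k, hk⟩ : Fin m) = i := Fin.ext h.symm
    simp [h, this]
  · have : (⟨k, hk⟩ : Fin m) ≠ i := fun e => h (by rw [← e])
    simp [h, this]

theorem getD_ofFn {m : ℕ} {α : Type} (f : Fin m → α) (i : Fin m) (d : α) :
    (List.ofFn f).getD i d = f i := by
  simp [List.getD_eq_getElem?_getD]

theorem IsWeakCXp.mono {m : ℕ} {κ : Point m → Bool} {v : Point m} {Y Z : Finset (Fin m)}
    (h : IsWeakCXp κ v Y) (hYZ : Y ⊆ Z) : IsWeakCXp κ v Z := by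
  obtain ⟨x, hx, hκ⟩ := h
  exact ⟨x, fun j hj => hx j fun hj' => hj (hYZ hj'), hκ⟩

/-- Drops the features one after the other as long as a weak explanation remains, where
`S d v Y b` tells whether the features in `Y` can be changed so that the decision becomes `b`. -/
def greedy (S : Data → List Bool → List Bool → Bool → Bool) (d : Data) (v : List Bool) :
    List Bool :=
  (List.range v.length).foldl (fun Y i =>
    -- With no feature free, `S` returns the decision on `v` itself; its negation is the decision to
    -- be reached.
    bif S d v (Y.set i false) (!S d v (v.map fun _ => false) true) then Y.set i false else Y)
    (v.map fun _ => true)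

theorem greedy_polyTime {S : Data → List Bool → List Bool → Bool → Bool}
    (hS : PolyTime fun x : Data × List Bool × List Bool × Bool => S x.1 x.2.1 x.2.2.1 x.2.2.2) :
    PolyTime fun x : Data × List Bool => greedy S x.1 x.2 := by
  unfold greedy
  refine PolyTime.foldl (by fun_prop) (by fun_prop) ?_ (b := fun _ => 3) (by fun_prop)
    fun i s a ha => ?_
  · have h1 := PolyTime.comp hS (f := fun x : (Data × List Bool) × List Bool × ℕ =>
      (x.1.1, x.1.2, x.1.2.map fun _ => false, true)) (by fun_prop)
    have h2 := PolyTime.comp hS (f := fun x : (Data × List Bool) × List Bool × ℕ =>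
      (x.1.1, x.1.2, x.2.1.set x.2.2 false,
        !S x.1.1 x.1.2 (x.1.2.map fun _ => false) true)) (by fun_prop)
    fun_prop
  · have h1 := sz_set_le s a false
    have h2 := sz_bool_le false
    cases S i.1 i.2 (s.set a false) (!S i.1 i.2 (i.2.map fun _ => false) true) <;>
      simp only [cond_true, cond_false] <;> omega

/-- `x` agrees with `v` on the features that are not marked in `Y`. -/
def Agree {m : ℕ} (v Y x : Point m) : Prop := ∀ j, Y j = false → x j = v j

theorem greedy_isCXp {m : ℕ} {κ : Point m → Bool} {v : Point m} {d : Data}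
    {S : Data → List Bool → List Bool → Bool → Bool}
    (hS : ∀ (Y : Point m) b, S d (List.ofFn v) (List.ofFn Y) b = true ↔
      ∃ x, Agree v Y x ∧ κ x = b)
    (hκ : ∃ x y : Point m, κ x ≠ κ y) :
    ∃ Y : Finset (Fin m), IsCXp κ v Y ∧
      greedy S d (List.ofFn v) = List.ofFn fun i => decide (i ∈ Y) := by
  have hv : S d (List.ofFn v) ((List.ofFn v).map fun _ => false) true = κ v := by
    rw [Bool.eq_iff_iff, List.map_ofFn]
    refine (hS (fun _ => false) true).trans ⟨?_, fun h => ⟨v, fun _ _ => rfl, h⟩⟩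
    rintro ⟨x, hx, h⟩
    rwa [show x = v from funext fun j => hx j rfl] at h
  have hS' : ∀ Y : Finset (Fin m), S d (List.ofFn v) (List.ofFn fun i => decide (i ∈ Y)) (!κ v)
      = true ↔ IsWeakCXp κ v Y := by
    intro Y
    rw [hS]
    simp [IsWeakCXp, Agree, Bool.eq_not]
  unfold greedy
  rw [hv]
  -- Invariant: each kept feature among the first `k` is indispensable. It persists when `Y`
  -- shrinks, by monotonicity of weak explanations.
  have key : ∀ k ≤ m, ∃ Y : Finset (Fin m), IsWeakCXp κ v Y ∧
      (∀ i : Fin m, (i : ℕ) < k → i ∈ Y → ¬ IsWeakCXp κ v (Y.erase i)) ∧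
      (List.range k).foldl (fun Y i =>
        bif S d (List.ofFn v) (Y.set i false) (!κ v) then Y.set i false else Y)
        ((List.ofFn v).map fun _ => true) = List.ofFn fun i => decide (i ∈ Y) := by
    intro k
    induction k with
    | zero =>
      intro _
      refine ⟨Finset.univ, ?_, fun i hi => absurd hi (by omega), ?_⟩
      · obtain ⟨x, y, hxy⟩ := hκ
        by_cases h : κ x = κ v
        · exact ⟨y, by simp, fun h' => hxy (h.trans h'.symm)⟩
        · exact ⟨x, by simp, h⟩
      · simp [List.map_ofFn, Function.comp_def]
    | succ k ih =>
      intro hk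
      obtain ⟨Y, h1, h2, h3⟩ := ih (by omega)
      have hset : (List.ofFn fun i => decide (i ∈ Y)).set k false
          = List.ofFn fun i => decide (i ∈ Y.erase ⟨k, hk⟩) := by
        refine (ofFn_set (fun i => decide (i ∈ Y)) ⟨k, hk⟩ false).trans ?_
        congr 1
        funext i
        by_cases hi : i = ⟨k, hk⟩
        · simp [hi]
        · simp [hi]
      rw [List.range_succ, List.foldl_append, h3, List.foldl_cons, List.foldl_nil, hset]
      by_cases hw : IsWeakCXp κ v (Y.erase ⟨k, hk⟩)
      · refine ⟨Y.erase ⟨k, hk⟩, hw, fun i hi hiY hwi => ?_, by rw [(hS' _).2 hw, cond_true]⟩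
        rcases Nat.lt_succ_iff_lt_or_eq.1 hi with hi | hi
        · exact h2 i hi (Finset.mem_of_mem_erase hiY)
            (hwi.mono (Finset.erase_subset_erase _ (Finset.erase_subset _ _)))
        · exact (Finset.ne_of_mem_erase hiY) (Fin.ext hi)
      · have : S d (List.ofFn v) (List.ofFn fun i => decide (i ∈ Y.erase ⟨k, hk⟩)) (!κ v)
            = false := by
          rw [← Bool.not_eq_true, hS']
          exact hw
        refine ⟨Y, h1, fun i hi hiY hwi => ?_, by rw [this, cond_false]⟩
        rcases Nat.lt_succ_iff_lt_or_eq.1 hi with hi | hi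
        · exact h2 i hi hiY hwi
        · rw [show i = ⟨k, hk⟩ from Fin.ext hi] at hwi
          exact hw hwi
  obtain ⟨Y, h1, h2, h3⟩ := key m le_rfl
  -- A weak explanation inside `Y` that misses `i` is contained in `Y.erase i`, so by monotonicity
  -- single deletions suffice for minimality.
  refine ⟨Y, ⟨h1, fun Z hZ hZY i hiY => ?_⟩, by rw [List.length_ofFn]; exact h3⟩
  by_contra hiZ
  refine h2 i i.2 hiY (hZ.mono fun j hj => Finset.mem_erase.2 ⟨?_, hZY hj⟩)
  rintro rfl
  exact hiZ hj

/-- It suffices to decide in polynomial time whether a decision can be reached by changing the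
features in a given set. -/
theorem OneCXpInPolyTime.of_sat {L : Lang} {S : Data → List Bool → List Bool → Bool → Bool}
    (hS : PolyTime fun x : Data × List Bool × List Bool × Bool => S x.1 x.2.1 x.2.2.1 x.2.2.2)
    (h : ∀ (m : ℕ) (φ : L.Sentence m), L.Mem φ → 0 < m → ∀ (v Y : Point m) (b : Bool),
      S (L.encode φ) (List.ofFn v) (List.ofFn Y) b = true ↔
        ∃ x, Agree v Y x ∧ L.eval φ x = b) : OneCXpInPolyTime L := by
  obtain ⟨p, P, hp⟩ := greedy_polyTime hS
  refine ⟨p, P, fun m φ hφ hκ v => ?_⟩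
  -- Without features there is only one point. Positivity of `m` is needed where some variable must
  -- be named, as for diagrams with a dead disjunctive node.
  have hm : 0 < m := by
    rcases Nat.eq_zero_or_pos m with rfl | hm
    · obtain ⟨x, y, hxy⟩ := hκ
      exact absurd (congrArg _ (Subsingleton.elim x y)) hxy
    · exact hm
  obtain ⟨Y, hY, hg⟩ := greedy_isCXp (h m φ hφ hm v) hκ
  obtain ⟨t, h1, h2⟩ := hp (L.encode φ, List.ofFn v)
  refine ⟨Y, t, hY, ?_, h2⟩
  beta_reduce at h1
  rw [hg] at h1
  exact h1

/-! ## Conjunctive normal forms -/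

def Data.toLit (d : Data) : ℕ × Bool := (d.hd.toNat, d.tl.toBool)

def Data.toLits (d : Data) : List (ℕ × Bool) := d.toList.map Data.toLit

def Data.toFlat (d : Data) : List (List (ℕ × Bool)) := d.toList.map Data.toLits

/-- A literal, with its variable as a number. -/
def rawLit {m : ℕ} (a : Literal m) : ℕ × Bool := (a.1, a.2)

@[simp] theorem toLits_encodeLits {m : ℕ} (l : List (Literal m)) :
    (encodeLits l).toLits = l.map rawLit := by
  simp [Data.toLits, encodeLits, Data.toLit, rawLit, Function.comp_def]

theorem toFlat_encode {m : ℕ} (f : Flat m) : f.encode.toFlat = f.map (List.map rawLit) := by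
  simp [Data.toFlat, Flat.encode, Function.comp_def]

namespace CNF

def litEq (a b : ℕ × Bool) : Bool := a.1 == b.1 && a.2 == b.2

@[simp] theorem litEq_iff {a b : ℕ × Bool} : litEq a b = true ↔ a = b := by
  simp [litEq, Prod.ext_iff]

/-- The clause is not tautological, and each literal is or can be made false. -/
def clauseFalsifiable (v Y : List Bool) (C : List (ℕ × Bool)) : Bool :=
  C.all fun a => (Y.getD a.1 false || !(v.getD a.1 false == a.2)) &&
    C.all fun b => !litEq b (a.1, !a.2)

def falsifiable (f : List (List (ℕ × Bool))) (v Y : List Bool) : Bool :=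
  f.any (clauseFalsifiable v Y)

/-- The literals of a clause that are not falsified by the literals in `T`. -/
def live (T C : List (ℕ × Bool)) : List (ℕ × Bool) :=
  C.filter fun a => !T.any fun b => litEq b (a.1, !a.2)

/-- Propagation of a unit clause. -/
def unitStep (T C : List (ℕ × Bool)) : List (ℕ × Bool) :=
  bif !(live T C).isEmpty && ((live T C).all fun b => litEq b ((live T C).headD (0, false))) &&
      !T.any fun b => litEq b ((live T C).headD (0, false)) then
    (live T C).headD (0, false) :: T
  else T

def unitRound (f : List (List (ℕ × Bool))) (T : List (ℕ × Bool)) : List (ℕ × Bool) :=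
  f.foldl unitStep T

/-- The literals of the fixed features. -/
def fixedLits (v Y : List Bool) : List (ℕ × Bool) :=
  ((List.range v.length).filter fun i => !Y.getD i false).map fun i => (i, v.getD i false)

/-- As many rounds as variables are enough: an unfinished round adds a literal over a new variable.
-/
def unitClosure (f : List (List (ℕ × Bool))) (v Y : List Bool) : List (ℕ × Bool) :=
  (List.range v.length).foldl (fun T _ => unitRound f T) (fixedLits v Y)

/-- Unit propagation finds no empty clause. -/
def satisfiable (f : List (List (ℕ × Bool))) (v Y : List Bool) : Bool :=
  f.all fun C => !(live (unitClosure f v Y) C).isEmpty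

def sat (d : Data) (v Y : List Bool) (b : Bool) : Bool :=
  bif b then satisfiable d.toFlat v Y else falsifiable d.toFlat v Y

/-! ### Running time of the tests for CNFs -/

section PolyTime

variable {α : Type} [Enc α]

@[fun_prop] theorem toFlat_polyTime {d : α → Data} (hd : PolyTime d) :
    PolyTime fun x => (d x).toFlat := by
  unfold Data.toFlat Data.toLits Data.toLit
  fun_prop

@[fun_prop] theorem litEq_polyTime {a b : α → ℕ × Bool} (ha : PolyTime a) (hb : PolyTime b) :
    PolyTime fun x => litEq (a x) (b x) := by
  unfold litEq
  fun_prop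

@[fun_prop] theorem falsifiable_polyTime {f : α → List (List (ℕ × Bool))} {v Y : α → List Bool}
    (hf : PolyTime f) (hv : PolyTime v) (hY : PolyTime Y) :
    PolyTime fun x => falsifiable (f x) (v x) (Y x) := by
  unfold falsifiable clauseFalsifiable
  fun_prop

@[fun_prop] theorem live_polyTime {T C : α → List (ℕ × Bool)} (hT : PolyTime T)
    (hC : PolyTime C) : PolyTime fun x => live (T x) (C x) := by
  unfold live
  fun_prop

@[fun_prop] theorem unitStep_polyTime {T C : α → List (ℕ × Bool)} (hT : PolyTime T)
    (hC : PolyTime C) : PolyTime fun x => unitStep (T x) (C x) := by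
  unfold unitStep
  fun_prop

theorem sz_unitStep_le (T C : List (ℕ × Bool)) : sz (unitStep T C) ≤ sz T + (sz C + 6) := by
  have h : sz ((live T C).headD (0, false)) ≤ sz C + 5 := by
    cases h : live T C with
    | nil => have := sz_bool_le false; simp; omega
    | cons a l =>
      have : a ∈ C := by
        have : a ∈ live T C := by simp [h]
        exact (List.mem_filter.1 this).1
      have := sz_mem_le this
      simp only [List.headD_cons]
      omega
  unfold unitStep
  generalize (!(live T C).isEmpty && ((live T C).all fun b =>
    litEq b ((live T C).headD (0, false))) &&
      !T.any fun b => litEq b ((live T C).headD (0, false))) = c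
  cases c <;> simp only [cond_true, cond_false, sz_cons] <;> omega

@[fun_prop] theorem unitRound_polyTime {f : α → List (List (ℕ × Bool))}
    {T : α → List (ℕ × Bool)} (hf : PolyTime f) (hT : PolyTime T) :
    PolyTime fun x => unitRound (f x) (T x) := by
  unfold unitRound
  refine PolyTime.foldl hf hT (by fun_prop) (b := fun x => sz (f x) + 6) (by fun_prop)
    fun i s C hC => ?_
  have h1 := sz_unitStep_le s C
  have h2 := sz_mem_le hC
  omega

@[fun_prop] theorem unitClosure_polyTime {f : α → List (List (ℕ × Bool))} {v Y : α → List Bool}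
    (hf : PolyTime f) (hv : PolyTime v) (hY : PolyTime Y) :
    PolyTime fun x => unitClosure (f x) (v x) (Y x) := by
  unfold unitClosure fixedLits
  refine PolyTime.foldl (by fun_prop) (by fun_prop) (by fun_prop)
    (b := fun x => (f x).length * (sz (f x) + 6)) (by fun_prop) fun i s _ _ => ?_
  refine PolyTime.sz_foldl_le _ _ fun s C hC => ?_
  have h1 := sz_unitStep_le s C
  have h2 := sz_mem_le hC
  omega

@[fun_prop] theorem sat_polyTime {d : α → Data} {v Y : α → List Bool} {b : α → Bool}
    (hd : PolyTime d) (hv : PolyTime v) (hY : PolyTime Y) (hb : PolyTime b) :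
    PolyTime fun x => sat (d x) (v x) (Y x) (b x) := by
  unfold sat satisfiable
  fun_prop

end PolyTime

/-! ### Falsifying a clause, and correctness of unit propagation -/

/-- The assignment satisfies the clause. -/
def Holds (x : ℕ → Bool) (C : List (ℕ × Bool)) : Prop := ∃ a ∈ C, x a.1 = a.2

theorem clauseFalsifiable_iff {v Y : List Bool} {C : List (ℕ × Bool)} :
    clauseFalsifiable v Y C = true ↔
      ∃ x : ℕ → Bool, (∀ i, Y.getD i false = false → x i = v.getD i false) ∧ ¬ Holds x C := by
  simp only [clauseFalsifiable, List.all_eq_true, Bool.and_eq_true, Bool.or_eq_true,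
    Bool.not_eq_true', Holds, ← Bool.not_eq_true, litEq_iff]
  constructor
  · intro h
    -- Makes each literal of the clause false, which is unambiguous as the clause is not
    -- tautological, and follows `v` elsewhere.
    refine ⟨fun i => if (i, true) ∈ C then false else if (i, false) ∈ C then true
      else v.getD i false, fun i hi => ?_, ?_⟩
    · beta_reduce
      split_ifs with h1 h2
      · have := (h _ h1).1
        simp only [hi] at this
        simpa using this
      · have := (h _ h2).1
        simp only [hi] at this
        simpa using this
      · rfl
    · rintro ⟨⟨i, s⟩, ha, hx⟩
      cases s with
      | true => simp [ha] at hx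
      | false =>
        have : (i, true) ∉ C := fun h' => (h _ ha).2 _ h' rfl
        simp [ha, this] at hx
  · rintro ⟨x, hx, hC⟩ a ha
    refine ⟨?_, ?_⟩
    · by_cases hY : Y.getD a.1 false = true
      · exact Or.inl hY
      · refine Or.inr fun hv => hC ⟨a, ha, ?_⟩
        rw [hx _ hY]; exact beq_iff_eq.1 hv
    · rintro b hb rfl
      by_cases h : x a.1 = a.2
      · exact hC ⟨a, ha, h⟩
      · exact hC ⟨_, hb, by simpa [Bool.eq_not] using h⟩

theorem mem_live {T C : List (ℕ × Bool)} {a : ℕ × Bool} :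
    a ∈ live T C ↔ a ∈ C ∧ (a.1, !a.2) ∉ T := by
  simp [live, List.mem_filter, ← Bool.not_eq_true]

theorem mem_fixedLits {v Y : List Bool} {a : ℕ × Bool} :
    a ∈ fixedLits v Y ↔ a.1 < v.length ∧ Y.getD a.1 false = false ∧ a.2 = v.getD a.1 false := by
  obtain ⟨i, s⟩ := a
  simp only [fixedLits, List.mem_map, List.mem_filter, List.mem_range, Prod.mk.injEq,
    Bool.not_eq_true']
  constructor
  · rintro ⟨j, ⟨h1, h2⟩, rfl, rfl⟩
    exact ⟨h1, h2, rfl⟩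
  · rintro ⟨h1, h2, h3⟩
    exact ⟨i, ⟨h1, h2⟩, rfl, h3.symm⟩

/-- Either nothing is propagated, or a new literal of the clause is. -/
theorem unitStep_cases (T C : List (ℕ × Bool)) :
    (∃ a ∈ live T C, (∀ b ∈ live T C, b = a) ∧ a ∉ T ∧ unitStep T C = a :: T) ∨
    (unitStep T C = T ∧ ∀ a ∈ live T C, a ∈ T ∨ ∃ b ∈ live T C, ∃ c ∈ live T C, b ≠ c) := by
  unfold unitStep
  cases h : live T C with
  | nil => right; simp
  | cons a l =>
    simp only [List.isEmpty_cons, Bool.not_false, Bool.true_and, List.headD_cons]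
    by_cases h1 : ∀ b ∈ a :: l, b = a
    · by_cases h2 : a ∈ T
      · right
        refine ⟨?_, fun b hb => Or.inl (by rw [h1 b hb]; exact h2)⟩
        have : (T.any fun b => litEq b a) = true := by simpa using h2
        simp [this]
      · left
        refine ⟨a, by simp, h1, h2, ?_⟩
        have e1 : (T.any fun b => litEq b a) = false := by
          rw [← Bool.not_eq_true]; simpa using h2
        have e2 : ((a :: l).all fun b => litEq b a) = true := by
          rw [List.all_eq_true]; simpa using h1
        rw [e1, e2]
        rfl
    · right
      have e2 : ((a :: l).all fun b => litEq b a) = false := by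
        rw [← Bool.not_eq_true, List.all_eq_true]; simpa using h1
      refine ⟨by rw [e2]; rfl, fun _ _ => Or.inr ?_⟩
      push Not at h1
      obtain ⟨b, hb, hba⟩ := h1
      exact ⟨b, hb, a, by simp, hba⟩

theorem suffix_unitStep (T C : List (ℕ × Bool)) : T <:+ unitStep T C := by
  rcases unitStep_cases T C with ⟨a, _, _, _, h⟩ | ⟨h, _⟩ <;> rw [h]
  exact List.suffix_cons _ _

theorem suffix_unitRound (f : List (List (ℕ × Bool))) (T : List (ℕ × Bool)) :
    T <:+ unitRound f T := by
  unfold unitRound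
  induction f generalizing T with
  | nil => exact List.suffix_rfl
  | cons C f ih => exact (suffix_unitStep T C).trans (ih _)

/-- Steps only extend the list, so a round without any effect consists of steps without effect. -/
theorem unitStep_eq_of_unitRound_eq {f : List (List (ℕ × Bool))} {T : List (ℕ × Bool)}
    (h : unitRound f T = T) {C : List (ℕ × Bool)} (hC : C ∈ f) : unitStep T C = T := by
  induction f with
  | nil => simp at hC
  | cons D f ih =>
    have h1 : unitRound f (unitStep T D) = T := h
    have h2 : unitStep T D = T := by
      have h3 := suffix_unitRound f (unitStep T D)
      rw [h1] at h3
      exact h3.eq_of_length (le_antisymm h3.length_le (suffix_unitStep T D).length_le)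
    rcases List.mem_cons.1 hC with rfl | hC
    · exact h2
    · rw [h2] at h1
      exact ih h1 hC

/-- An invariant of unit steps is an invariant of unit propagation. -/
theorem unitRound_induction {f : List (List (ℕ × Bool))} {P : List (ℕ × Bool) → Prop}
    (hP : ∀ T, ∀ C ∈ f, P T → P (unitStep T C)) {T : List (ℕ × Bool)} (h : P T) :
    P (unitRound f T) := by
  unfold unitRound
  induction f generalizing T with
  | nil => exact h
  | cons C f ih =>
    exact ih (fun T D hD => hP T D (by simp [hD])) (hP T C (by simp) h)

theorem unitClosure_eq_iterate (f : List (List (ℕ × Bool))) (v Y : List Bool) :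
    unitClosure f v Y = (unitRound f)^[v.length] (fixedLits v Y) := by
  unfold unitClosure
  induction v.length with
  | zero => rfl
  | succ k ih => rw [List.range_succ, List.foldl_append, ih, Function.iterate_succ_apply']; rfl

theorem unitClosure_induction {f : List (List (ℕ × Bool))} {v Y : List Bool}
    {P : List (ℕ × Bool) → Prop} (hP : ∀ T, ∀ C ∈ f, P T → P (unitStep T C))
    (h : P (fixedLits v Y)) : P (unitClosure f v Y) := by
  rw [unitClosure_eq_iterate]
  induction v.length with
  | zero => exact h
  | succ k ih => rw [Function.iterate_succ_apply']; exact unitRound_induction hP ih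

theorem fixedLits_subset (f : List (List (ℕ × Bool))) (v Y : List Bool) :
    fixedLits v Y ⊆ unitClosure f v Y :=
  unitClosure_induction (P := fun T => fixedLits v Y ⊆ T)
    (fun T C _ h _ ha => (suffix_unitStep T C).subset (h ha)) (List.Subset.refl _)

/-- The literals have distinct variables below `m`. -/
def Proper (m : ℕ) (T : List (ℕ × Bool)) : Prop := (T.map Prod.fst).Nodup ∧ ∀ a ∈ T, a.1 < m

theorem Proper.length_le {m : ℕ} {T : List (ℕ × Bool)} (h : Proper m T) : T.length ≤ m := by
  have h1 : T.map Prod.fst ⊆ List.range m := by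
    intro i hi
    obtain ⟨a, ha, rfl⟩ := List.mem_map.1 hi
    exact List.mem_range.2 (h.2 a ha)
  simpa using (h.1.subperm h1).length_le

theorem Proper.notMem {m : ℕ} {T : List (ℕ × Bool)} (h : Proper m T) {a : ℕ × Bool}
    (ha : a ∈ T) : (a.1, !a.2) ∉ T := by
  intro hb
  have := List.inj_on_of_nodup_map h.1 ha hb rfl
  simp [Prod.ext_iff] at this

theorem proper_fixedLits (v Y : List Bool) : Proper v.length (fixedLits v Y) := by
  refine ⟨?_, fun a ha => (mem_fixedLits.1 ha).1⟩
  simp only [fixedLits, List.map_map, Function.comp_def, List.map_id']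
  exact List.nodup_range.filter _

/-- The variable of the new literal is new: the literal is absent by the guard of the step, and its
complement is absent because the literal is live. -/
theorem Proper.unitStep {m : ℕ} {T C : List (ℕ × Bool)} (h : Proper m T)
    (hC : ∀ a ∈ C, a.1 < m) : Proper m (unitStep T C) := by
  rcases unitStep_cases T C with ⟨a, ha, _, haT, e⟩ | ⟨e, _⟩
  · rw [e]
    obtain ⟨h1, h2⟩ := mem_live.1 ha
    refine ⟨?_, ?_⟩
    · rw [List.map_cons, List.nodup_cons]
      refine ⟨fun hm => ?_, h.1⟩
      obtain ⟨⟨i, s⟩, hb, hi⟩ := List.mem_map.1 hm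
      obtain ⟨j, t⟩ := a
      simp only at hi h2 haT
      subst hi
      cases s <;> cases t <;> simp_all
    · intro b hb
      rcases List.mem_cons.1 hb with rfl | hb
      · exact hC _ h1
      · exact h.2 b hb
  · rw [e]
    exact h

theorem proper_unitClosure {f : List (List (ℕ × Bool))} {v Y : List Bool}
    (hf : ∀ C ∈ f, ∀ a ∈ C, a.1 < v.length) : Proper v.length (unitClosure f v Y) :=
  unitClosure_induction (fun _ C hC h => h.unitStep (hf C hC)) (proper_fixedLits v Y)

/-- Unit propagation has reached a fixed point. -/
theorem unitRound_unitClosure {f : List (List (ℕ × Bool))} {v Y : List Bool}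
    (hf : ∀ C ∈ f, ∀ a ∈ C, a.1 < v.length) :
    unitRound f (unitClosure f v Y) = unitClosure f v Y := by
  have hp : ∀ k, Proper v.length ((unitRound f)^[k] (fixedLits v Y)) := by
    intro k
    induction k with
    | zero => exact proper_fixedLits v Y
    | succ k ih =>
      rw [Function.iterate_succ_apply']
      exact unitRound_induction (fun _ C hC h => h.unitStep (hf C hC)) ih
  -- Either round `k` changes nothing, or all rounds so far have added literals. For `k = v.length`
  -- the latter gives more literals than there are variables.
  have key : ∀ k, unitRound f ((unitRound f)^[k] (fixedLits v Y))
      = (unitRound f)^[k] (fixedLits v Y) ∨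
      k + 1 ≤ ((unitRound f)^[k + 1] (fixedLits v Y)).length := by
    intro k
    by_cases h : unitRound f ((unitRound f)^[k] (fixedLits v Y))
        = (unitRound f)^[k] (fixedLits v Y)
    · exact Or.inl h
    right
    rw [Function.iterate_succ_apply']
    have h1 := suffix_unitRound f ((unitRound f)^[k] (fixedLits v Y))
    have h2 : ((unitRound f)^[k] (fixedLits v Y)).length
        < (unitRound f ((unitRound f)^[k] (fixedLits v Y))).length := by
      rcases h1.length_le.lt_or_eq with h2 | h2
      · exact h2
      · exact absurd (h1.eq_of_length h2).symm h
    have h3 : k ≤ ((unitRound f)^[k] (fixedLits v Y)).length := by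
      clear h1 h2
      induction k with
      | zero => simp
      | succ k ih =>
        have h4 := suffix_unitRound f ((unitRound f)^[k] (fixedLits v Y))
        rw [Function.iterate_succ_apply'] at h ⊢
        have h5 : ¬ unitRound f ((unitRound f)^[k] (fixedLits v Y))
            = (unitRound f)^[k] (fixedLits v Y) := by
          intro h6
          rw [h6] at h
          exact h h6
        have h7 := ih h5
        rcases h4.length_le.lt_or_eq with h2 | h2
        · omega
        · exact absurd (h4.eq_of_length h2).symm h5
    omega
  rw [unitClosure_eq_iterate]
  rcases key v.length with h | h
  · exact h
  · have := (hp (v.length + 1)).length_le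
    omega

/-- A model in the subcube satisfies every propagated literal. Hence a literal that it satisfies in
a clause is never struck out. -/
theorem satisfiable_of_model {f : List (List (ℕ × Bool))} {v Y : List Bool} {x : ℕ → Bool}
    (hx : ∀ i, Y.getD i false = false → x i = v.getD i false) (hf : ∀ C ∈ f, Holds x C) :
    satisfiable f v Y = true := by
  have h : ∀ a ∈ unitClosure f v Y, x a.1 = a.2 := by
    refine unitClosure_induction (P := fun T => ∀ a ∈ T, x a.1 = a.2) ?_ ?_
    · intro T C hC hT
      rcases unitStep_cases T C with ⟨a, ha, hu, haT, e⟩ | ⟨e, _⟩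
      · rw [e]
        intro b hb
        rcases List.mem_cons.1 hb with rfl | hb
        · obtain ⟨c, hc, hxc⟩ := hf C hC
          have : c ∈ live T C := mem_live.2 ⟨hc, fun h => by have := hT _ h; simp [hxc] at this⟩
          rw [← hu c this]
          exact hxc
        · exact hT b hb
      · rw [e]
        exact hT
    · intro a ha
      obtain ⟨_, h2, h3⟩ := mem_fixedLits.1 ha
      rw [hx _ h2, h3]
  simp only [satisfiable, List.all_eq_true, Bool.not_eq_true']
  intro C hC
  obtain ⟨c, hc, hxc⟩ := hf C hC
  have : c ∈ live (unitClosure f v Y) C :=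
    mem_live.2 ⟨hc, fun h' => by have := h _ h'; simp [hxc] at this⟩
  cases hl : live (unitClosure f v Y) C with
  | nil => simp [hl] at this
  | cons => rfl

theorem exists_live {f : List (List (ℕ × Bool))} {v Y : List Bool}
    (h : satisfiable f v Y = true) {C : List (ℕ × Bool)} (hC : C ∈ f) :
    ∃ a, a ∈ live (unitClosure f v Y) C := by
  simp only [satisfiable, List.all_eq_true, Bool.not_eq_true'] at h
  have := h C hC
  exact List.exists_mem_of_ne_nil _ (by simpa using this)

/-- Unit propagation is complete if some renaming makes the formula Horn; `V` holds the signs of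
the literals that become positive. -/
theorem model_of_satisfiable {f : List (List (ℕ × Bool))} {v Y : List Bool}
    (hf : ∀ C ∈ f, ∀ a ∈ C, a.1 < v.length) {V : ℕ → Bool}
    (hV : ∀ C ∈ f, ∀ a ∈ C, ∀ b ∈ C, a.2 = V a.1 → b.2 = V b.1 → a = b)
    (h : satisfiable f v Y = true) :
    ∃ x : ℕ → Bool, (∀ i < v.length, Y.getD i false = false → x i = v.getD i false) ∧
      ∀ C ∈ f, Holds x C := by
  set T := unitClosure f v Y with hT
  have hp : Proper v.length T := proper_unitClosure hf
  -- Variables left open by propagation get the value that is false after the renaming.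
  let x : ℕ → Bool := fun i => if (i, true) ∈ T then true else if (i, false) ∈ T then false
    else !V i
  have hx : ∀ a ∈ T, x a.1 = a.2 := by
    rintro ⟨i, s⟩ ha
    have := hp.notMem ha
    cases s <;> simp_all [x]
  refine ⟨x, fun i hi hY => ?_, fun C hC => ?_⟩
  · exact hx (i, v.getD i false) (fixedLits_subset f v Y (mem_fixedLits.2 ⟨hi, hY, rfl⟩))
  · obtain ⟨a, ha⟩ := exists_live h hC
    have he := unitStep_eq_of_unitRound_eq (unitRound_unitClosure (Y := Y) hf) hC
    rw [← hT] at he ha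
    rcases unitStep_cases T C with ⟨b, _, _, _, e⟩ | ⟨_, e⟩
    · rw [he] at e
      simpa using congrArg List.length e
    · by_cases hl : ∃ b ∈ live T C, b ∈ T
      · obtain ⟨b, hb, hbT⟩ := hl
        exact ⟨b, (mem_live.1 hb).1, hx b hbT⟩
      · push Not at hl
        have hval : ∀ b ∈ live T C, b.2 ≠ V b.1 → x b.1 = b.2 := by
          rintro ⟨i, s⟩ hb hbV
          have h1 := hl _ hb
          have h2 := (mem_live.1 hb).2
          cases s <;> simp_all [x]
        -- The clause has two distinct live literals, since a single one would have been propagated.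
        -- At most one of them is positive after the renaming, and `hval` makes the other true.
        rcases e a ha with h1 | ⟨b, hb, c, hc, hbc⟩
        · exact absurd h1 (hl a ha)
        · by_cases hb' : b.2 = V b.1
          · by_cases hc' : c.2 = V c.1
            · exact absurd (hV C hC b (mem_live.1 hb).1 c (mem_live.1 hc).1 hb' hc') hbc
            · exact ⟨c, (mem_live.1 hc).1, hval c hc hc'⟩
          · exact ⟨b, (mem_live.1 hb).1, hval b hb hb'⟩

/-! ### The CNF tests for renH-C, PI and IP -/

variable {m : ℕ}

theorem holds_map {x : Point m} {C : List (Literal m)} :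
    Holds (fun i => (List.ofFn x).getD i false) (C.map rawLit) ↔ Flat.clauseVal C x = true := by
  simp only [Holds, List.mem_map, Flat.clauseVal, List.any_eq_true, beq_iff_eq]
  constructor
  · rintro ⟨_, ⟨a, ha, rfl⟩, h⟩
    exact ⟨a, ha, (getD_ofFn x a.1 false).symm.trans h⟩
  · rintro ⟨a, ha, h⟩
    exact ⟨_, ⟨a, ha, rfl⟩, (getD_ofFn x a.1 false).trans h⟩

theorem holds_map' {x : ℕ → Bool} {C : List (Literal m)} :
    Holds x (C.map rawLit) ↔ Flat.clauseVal C (fun i => x i) = true := by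
  simp only [Holds, List.mem_map, Flat.clauseVal, List.any_eq_true, beq_iff_eq]
  constructor
  · rintro ⟨_, ⟨a, ha, rfl⟩, h⟩
    exact ⟨a, ha, h⟩
  · rintro ⟨a, ha, h⟩
    exact ⟨_, ⟨a, ha, rfl⟩, h⟩

theorem vars_lt (f : Flat m) (v : Point m) :
    ∀ C ∈ f.map (List.map rawLit), ∀ a ∈ C, a.1 < (List.ofFn v).length := by
  simp only [List.mem_map, List.length_ofFn]
  rintro _ ⟨C, _, rfl⟩ a ha
  obtain ⟨b, _, rfl⟩ := List.mem_map.1 ha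
  exact b.1.2

theorem agree_getD {v Y x : Point m} (h : Agree v Y x) (i : ℕ)
    (hi : (List.ofFn Y).getD i false = false) :
    (List.ofFn x).getD i false = (List.ofFn v).getD i false := by
  by_cases him : i < m
  · have h1 := getD_ofFn Y ⟨i, him⟩ false
    have h2 := getD_ofFn x ⟨i, him⟩ false
    have h3 := getD_ofFn v ⟨i, him⟩ false
    simp only at h1 h2 h3
    rw [h2, h3]
    exact h _ (h1.symm.trans hi)
  · simp [List.getD_eq_getElem?_getD, him]

theorem agree_of_getD {v Y : Point m} {x : ℕ → Bool} (h : ∀ i < m,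
    (List.ofFn Y).getD i false = false → x i = (List.ofFn v).getD i false) :
    Agree v Y fun i => x i := fun j hj => by
  rw [← getD_ofFn v j false]
  exact h j j.2 (by rw [getD_ofFn]; exact hj)

/-- The program decides the falsifiability of every CNF, and the satisfiability of those CNFs for
which unit propagation is complete. -/
theorem sat_iff {f : Flat m} {v Y : Point m}
    (h : satisfiable (f.map (List.map rawLit)) (List.ofFn v) (List.ofFn Y) = true →
      ∃ x, Agree v Y x ∧ f.evalCNF x = true) (b : Bool) :
    sat f.encode (List.ofFn v) (List.ofFn Y) b = true ↔ ∃ x, Agree v Y x ∧ f.evalCNF x = b := by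
  rw [sat, toFlat_encode]
  cases b with
  | true =>
    rw [cond_true]
    refine ⟨h, ?_⟩
    rintro ⟨x, hx, hf⟩
    refine satisfiable_of_model (agree_getD hx) fun C hC => ?_
    obtain ⟨D, hD, rfl⟩ := List.mem_map.1 hC
    rw [Flat.evalCNF, List.all_eq_true] at hf
    exact holds_map.2 (hf D hD)
  | false =>
    rw [cond_false, falsifiable, List.any_eq_true]
    constructor
    · rintro ⟨C, hC, h⟩
      obtain ⟨D, hD, rfl⟩ := List.mem_map.1 hC
      obtain ⟨x, hx, hn⟩ := clauseFalsifiable_iff.1 h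
      refine ⟨fun i => x i, agree_of_getD fun i _ => hx i, ?_⟩
      rw [holds_map'] at hn
      rw [← Bool.not_eq_true, Flat.evalCNF, List.all_eq_true]
      exact fun h => hn (h D hD)
    · rintro ⟨x, hx, hf⟩
      rw [← Bool.not_eq_true, Flat.evalCNF, List.all_eq_true] at hf
      push Not at hf
      obtain ⟨D, hD, hn⟩ := hf
      refine ⟨_, List.mem_map_of_mem hD, clauseFalsifiable_iff.2 ⟨_, agree_getD hx, ?_⟩⟩
      rwa [holds_map]

theorem sat_iff_of_isRenHorn {f : Flat m} (hf : f.IsRenHorn) (v Y : Point m) (b : Bool) :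
    sat f.encode (List.ofFn v) (List.ofFn Y) b = true ↔
      ∃ x, Agree v Y x ∧ f.evalCNF x = b := by
  refine sat_iff (fun h => ?_) b
  obtain ⟨V, hV⟩ := hf
  obtain ⟨x, hx, h⟩ := model_of_satisfiable (vars_lt f v)
    -- The sign that becomes positive is `true` outside the renamed set and `false` inside; indices
    -- from `m` on play no role.
    (V := fun i => decide (∀ hi : i < m, (⟨i, hi⟩ : Fin m) ∉ V)) (by
      simp only [List.mem_map]
      rintro _ ⟨C, hC, rfl⟩ a ha b hb h1 h2
      obtain ⟨a, ha', rfl⟩ := List.mem_map.1 ha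
      obtain ⟨b, hb', rfl⟩ := List.mem_map.1 hb
      rw [hV C hC a ha' b hb' (by
        simp only [rawLit] at h1
        simp [h1]) (by
        simp only [rawLit] at h2
        simp [h2])]) h
  refine ⟨fun i => x i, agree_of_getD fun i hi => hx i (by simpa using hi), ?_⟩
  rw [Flat.evalCNF, List.all_eq_true]
  exact fun C hC => holds_map'.1 (h _ (List.mem_map_of_mem hC))

/-- If no model lies in the subcube, the formula entails the clause `E` of the complements of the
fixed literals. Some clause `D` of the formula then entails `E`, so its literals all belong to `E`.
The fixed literals strike out all of `D`, and propagation reports a conflict. -/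
theorem sat_iff_of_isPI {f : Flat m} (hf : f.IsPI) (v Y : Point m) (b : Bool) :
    sat f.encode (List.ofFn v) (List.ofFn Y) b = true ↔
      ∃ x, Agree v Y x ∧ f.evalCNF x = b := by
  refine sat_iff (fun h => ?_) b
  by_contra hne
  push Not at hne
  let E : List (Literal m) := ((List.finRange m).filter fun i => !Y i).map fun i => (i, !v i)
  have hE : ∀ a, a ∈ E ↔ Y a.1 = false ∧ a.2 = !v a.1 := by
    rintro ⟨i, s⟩
    simp only [E, List.mem_map, List.mem_filter, List.mem_finRange, true_and, Prod.mk.injEq,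
      Bool.not_eq_true']
    constructor
    · rintro ⟨j, h1, rfl, rfl⟩
      exact ⟨h1, rfl⟩
    · rintro ⟨h1, h2⟩
      exact ⟨i, h1, rfl, h2.symm⟩
  have hsimple : Flat.Simple E := by
    simp only [Flat.Simple, E, List.map_map, Function.comp_def, List.map_id']
    exact (List.nodup_finRange m).filter _
  obtain ⟨D, hD, hDE⟩ := hf.2.1 E hsimple fun x hx => by
    have h1 : ¬ Agree v Y x := fun h' => hne x h' hx
    unfold Agree at h1
    push Not at h1
    obtain ⟨j, h2, h3⟩ := h1
    rw [Flat.clauseVal, List.any_eq_true]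
    exact ⟨(j, !v j), (hE _).2 ⟨h2, rfl⟩, by simpa [Bool.eq_not] using h3⟩
  have hsub : ∀ a ∈ D, a ∈ E := by
    intro a ha
    by_contra haE
    -- The point `v` falsifies `E`. After changing it just enough to satisfy `a`, only a literal
    -- over the variable of `a` can make `E` true, and this literal is `a`.
    have h1 := hDE (Function.update v a.1 a.2)
      (by rw [Flat.clauseVal, List.any_eq_true]; exact ⟨a, ha, by simp⟩)
    rw [Flat.clauseVal, List.any_eq_true] at h1
    obtain ⟨c, hc, h2⟩ := h1
    obtain ⟨h3, h4⟩ := (hE c).1 hc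
    rw [beq_iff_eq, h4] at h2
    by_cases hca : c.1 = a.1
    · rw [hca, Function.update_self] at h2
      exact haE ((hE a).2 ⟨hca ▸ h3, h2⟩)
    · rw [Function.update_of_ne hca] at h2
      simp at h2
  obtain ⟨a, ha⟩ := exists_live h (List.mem_map_of_mem hD)
  obtain ⟨h1, h2⟩ := mem_live.1 ha
  obtain ⟨c, hc, rfl⟩ := List.mem_map.1 h1
  obtain ⟨h3, h4⟩ := (hE c).1 (hsub c hc)
  refine h2 (fixedLits_subset _ _ _ (mem_fixedLits.2 ⟨by simp [rawLit], ?_, ?_⟩))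
  · exact (getD_ofFn Y c.1 false).trans h3
  · simp only [rawLit, h4, Bool.not_not]
    exact (getD_ofFn v c.1 false).symm

theorem termVal_eq (C : List (Literal m)) (x : Point m) :
    Flat.termVal C x = !Flat.clauseVal C fun i => !x i := by
  have h : ∀ a b : Bool, (!(a == b)) = ((!a) == b) := by decide
  simp only [Flat.termVal, Flat.clauseVal, List.all_eq_not_any_not, h]

theorem evalDNF_eq (f : Flat m) (x : Point m) :
    f.evalDNF x = !f.evalCNF fun i => !x i := by
  simp only [Flat.evalDNF, Flat.evalCNF, termVal_eq, List.all_eq_not_any_not, Bool.not_not]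

/-- By De Morgan, complementing all coordinates turns the DNF reading into the negated CNF reading
of the same list and reverses entailment between its members. -/
theorem isPI_of_isIP {f : Flat m} (hf : f.IsIP) : f.IsPI := by
  have key : ∀ C D : List (Literal m), Flat.Entails (Flat.termVal C) (Flat.termVal D) ↔
      Flat.Entails (Flat.clauseVal D) (Flat.clauseVal C) := by
    intro C D
    constructor
    · intro h x hx
      by_contra hn
      have := h (fun i => !x i) (by simpa [termVal_eq] using hn)
      simp [termVal_eq, hx] at this
    · intro h x hx
      rw [termVal_eq, Bool.not_eq_true'] at hx ⊢
      by_contra hn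
      have := h _ (by simpa using hn)
      simp [hx] at this
  obtain ⟨h1, h2, h3⟩ := hf
  refine ⟨h1, fun C hC h => ?_, h3.imp fun h => ?_⟩
  · obtain ⟨D, hD, h4⟩ := h2 C hC fun x hx => by
      rw [termVal_eq, Bool.not_eq_true'] at hx
      rw [evalDNF_eq, Bool.not_eq_true']
      by_contra hn
      have := h _ (by simpa using hn)
      simp [hx] at this
    exact ⟨D, hD, (key C D).1 h4⟩
  · rw [key, key] at h
    exact ⟨h.2, h.1⟩

theorem sat_iff_of_isIP {f : Flat m} (hf : f.IsIP) (v Y : Point m) (b : Bool) :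
    sat f.encode ((List.ofFn v).map fun a => !a) (List.ofFn Y) (!b) = true ↔
      ∃ x, Agree v Y x ∧ f.evalDNF x = b := by
  rw [List.map_ofFn]
  refine (sat_iff_of_isPI (isPI_of_isIP hf) (fun i => !v i) Y !b).trans ?_
  constructor
  · rintro ⟨x, hx, h⟩
    refine ⟨fun i => !x i, fun j hj => by simp [hx j hj], ?_⟩
    simp [evalDNF_eq, h]
  · rintro ⟨x, hx, h⟩
    refine ⟨fun i => !x i, fun j hj => by simp [hx j hj], ?_⟩
    rw [← h, evalDNF_eq, Bool.not_not]

end CNF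

theorem oneCXp_renHC : OneCXpInPolyTime renHC :=
  OneCXpInPolyTime.of_sat (S := CNF.sat) (by fun_prop)
    fun _ _ hφ _ v Y b => CNF.sat_iff_of_isRenHorn hφ v Y b

theorem oneCXp_PI : OneCXpInPolyTime PI :=
  OneCXpInPolyTime.of_sat (S := CNF.sat) (by fun_prop)
    fun _ _ hφ _ v Y b => CNF.sat_iff_of_isPI hφ v Y b

theorem oneCXp_IP : OneCXpInPolyTime IP :=
  OneCXpInPolyTime.of_sat (S := fun d v Y b => CNF.sat d (v.map fun a => !a) Y !b)
    (by fun_prop) fun _ _ hφ _ v Y b => CNF.sat_iff_of_isIP hφ v Y b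

/-! ## Systems of affine clauses -/

def Data.toXor (d : Data) : List (ℕ × Bool) × Bool := (d.hd.toLits, d.tl.toBool)

/-- An affine clause, with variables as numbers. -/
def rawXor {m : ℕ} (δ : XorClause m) : List (ℕ × Bool) × Bool := (δ.lits.map rawLit, δ.parity)

@[simp] theorem toXor_encode {m : ℕ} (δ : XorClause m) : δ.encode.toXor = rawXor δ := by
  simp [Data.toXor, XorClause.encode, rawXor]

def XorClause.not {m : ℕ} (δ : XorClause m) : XorClause m := ⟨δ.lits, !δ.parity⟩

@[simp] theorem XorClause.eval_not {m : ℕ} (δ : XorClause m) (x : Point m) :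
    δ.not.eval x = !δ.eval x := by
  obtain ⟨l, p⟩ := δ
  simp only [XorClause.not, XorClause.eval]
  induction l with
  | nil => rfl
  | cons a l ih => simp [ih]

namespace Affine

/-- An equation is written as the list of its coefficients, followed by its constant. -/
def flip (i : ℕ) (r : List Bool) : List Bool := r.set i (!r.getD i false)

/-- The row represents the negated clause, so that the clause holds iff the row has value 0; hence
the initial constant `!δ.2`. A negative literal is its variable plus 1 and also flips the constant,
at position `m`. Repeated variables cancel. -/
def toRow (m : ℕ) (δ : List (ℕ × Bool) × Bool) : List Bool :=
  δ.1.foldl (fun r a => bif a.2 then flip a.1 r else flip m (flip a.1 r))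
    ((List.range m).map (fun _ => false) ++ [!δ.2])

def xorRow (r p : List Bool) : List Bool :=
  (List.range r.length).map fun i => Bool.xor (r.getD i false) (p.getD i false)

/-- Eliminates the first variable. -/
def elim (R : List (List Bool)) : List (List Bool) :=
  -- The pivot is the first row with leading coefficient 1. It is also added to itself and becomes
  -- zero, so the number of rows is preserved.
  R.map fun r => bif r.headD false then
    (xorRow r ((R.filter fun p => p.headD false).headD [])).tail else r.tail

def solvable (m : ℕ) (R : List (List Bool)) : Bool :=
  ((List.range m).foldl (fun R _ => elim R) R).all fun r => !r.headD false

def affSat (m : ℕ) (S : List (List (ℕ × Bool) × Bool)) : Bool := solvable m (S.map (toRow m))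

/-- The affine clauses that fix the features outside of `Y`. -/
def units (v Y : List Bool) : List (List (ℕ × Bool) × Bool) :=
  (List.range v.length).map fun i =>
    -- The empty clause with constant `true` always holds and stands for a free feature.
    bif Y.getD i false then ([], true) else ([(i, v.getD i false)], false)

def sat (d : Data) (v Y : List Bool) (b : Bool) : Bool :=
  bif b then affSat v.length (units v Y ++ d.toList.map Data.toXor)
  else (d.toList.map Data.toXor).any fun δ => affSat v.length ((δ.1, !δ.2) :: units v Y)

/-! ### Running time of Gaussian elimination -/

section PolyTime

variable {α : Type} [Enc α]

@[fun_prop] theorem toLits_polyTime {d : α → Data} (hd : PolyTime d) :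
    PolyTime fun x => (d x).toLits := by
  unfold Data.toLits Data.toLit
  fun_prop

@[fun_prop] theorem toXor_polyTime {d : α → Data} (hd : PolyTime d) :
    PolyTime fun x => (d x).toXor := by
  unfold Data.toXor
  fun_prop

@[fun_prop] theorem flip_polyTime {i : α → ℕ} {r : α → List Bool} (hi : PolyTime i)
    (hr : PolyTime r) : PolyTime fun x => flip (i x) (r x) := by
  unfold flip
  fun_prop

@[fun_prop] theorem toRow_polyTime {m : α → ℕ} {δ : α → List (ℕ × Bool) × Bool} (hm : PolyTime m)
    (hδ : PolyTime δ) : PolyTime fun x => toRow (m x) (δ x) := by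
  unfold toRow
  refine PolyTime.foldl (by fun_prop) (by fun_prop) (by fun_prop) (b := fun _ => 6)
    (by fun_prop) fun i s a _ => ?_
  have h : ∀ k r, sz (flip k r) ≤ sz r + 3 := fun k r =>
    (sz_set_le _ _ _).trans (Nat.add_le_add_left (sz_bool_le _) _)
  have h1 := h a.1 s
  have h2 := h (m i) (flip a.1 s)
  cases a.2 <;> simp only [cond_true, cond_false] <;> omega

@[fun_prop] theorem elim_polyTime {R : α → List (List Bool)} (hR : PolyTime R) :
    PolyTime fun x => elim (R x) := by
  unfold elim xorRow
  fun_prop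

theorem foldl_elim_induction {τ : Type} {P : List (List Bool) → Prop}
    (hP : ∀ R, P R → P (elim R)) (l : List τ) {R : List (List Bool)} (h : P R) :
    P (l.foldl (fun R _ => elim R) R) := by
  induction l generalizing R with
  | nil => exact h
  | cons a l ih => exact ih (hP R h)

theorem length_of_mem_elim {R : List (List Bool)} {r : List Bool} (h : r ∈ elim R) :
    ∃ s ∈ R, r.length = s.length - 1 := by
  obtain ⟨s, hs, rfl⟩ := List.mem_map.1 h
  refine ⟨s, hs, ?_⟩
  cases s.headD false <;> simp [xorRow]

@[fun_prop] theorem solvable_polyTime {m : α → ℕ} {R : α → List (List Bool)} (hm : PolyTime m)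
    (hR : PolyTime R) : PolyTime fun x => solvable (m x) (R x) := by
  unfold solvable
  refine PolyTime.all ?_ (by fun_prop)
  refine PolyTime.foldl_of_bdd (by fun_prop) hR (by fun_prop)
    (b := fun x => (R x).length * (sz (R x) * (3 + 1) + 1 + 1) + 1) (by fun_prop) fun x k => ?_
  -- Elimination keeps the number of rows and never lengthens a row, which bounds all intermediate
  -- matrices at once.
  have key := foldl_elim_induction
    (P := fun S => S.length = (R x).length ∧ ∀ r ∈ S, r.length ≤ sz (R x))
    (fun S hS => ⟨by simp [elim, hS.1], fun r hr => by
      obtain ⟨s, hs, h⟩ := length_of_mem_elim hr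
      have := hS.2 s hs
      omega⟩) ((List.range (m x)).take k) (R := R x)
    ⟨rfl, fun r hr => (length_le_sz r).trans (sz_mem_le hr)⟩
  rw [← key.1]
  refine sz_list_le fun r hr => (sz_list_le fun b _ => sz_bool_le b).trans ?_
  have := key.2 r hr
  omega

@[fun_prop] theorem affSat_polyTime {m : α → ℕ} {S : α → List (List (ℕ × Bool) × Bool)}
    (hm : PolyTime m) (hS : PolyTime S) : PolyTime fun x => affSat (m x) (S x) := by
  unfold affSat
  fun_prop

@[fun_prop] theorem units_polyTime {v Y : α → List Bool} (hv : PolyTime v) (hY : PolyTime Y) :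
    PolyTime fun x => units (v x) (Y x) := by
  unfold units
  fun_prop

@[fun_prop] theorem sat_polyTime {d : α → Data} {v Y : α → List Bool} {b : α → Bool}
    (hd : PolyTime d) (hv : PolyTime v) (hY : PolyTime Y) (hb : PolyTime b) :
    PolyTime fun x => sat (d x) (v x) (Y x) (b x) := by
  unfold sat
  fun_prop

end PolyTime

/-! ### Correctness of Gaussian elimination -/

/-- The difference of the two sides of an equation. -/
def rowVal : List Bool → List Bool → Bool
  | [], r => r.headD false
  | x :: xs, r => Bool.xor (r.headD false && x) (rowVal xs r.tail)

theorem length_flip (i : ℕ) (r : List Bool) : (flip i r).length = r.length := by simp [flip]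

/-- The default `true` covers the position `i = xs.length` of the constant, which behaves like the
coefficient of a variable with value 1. -/
theorem rowVal_flip (xs : List Bool) {r : List Bool} {i : ℕ} (hr : r.length = xs.length + 1)
    (hi : i ≤ xs.length) : rowVal xs (flip i r) = Bool.xor (rowVal xs r) (xs.getD i true) := by
  induction xs generalizing r i with
  | nil =>
    obtain ⟨c, rfl⟩ := List.length_eq_one_iff.1 hr
    obtain rfl : i = 0 := by simpa using hi
    simp [flip, rowVal]
  | cons x xs ih =>
    obtain ⟨c, r, rfl⟩ := List.exists_cons_of_length_eq_add_one hr
    cases i with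
    | zero => simp [flip, rowVal]; cases c <;> cases x <;> simp
    | succ i =>
      have := @ih r i (by simpa using hr) (by simpa using hi)
      simp only [flip, rowVal, List.getD_cons_succ, List.set_cons_succ, List.headD_cons,
        List.tail_cons] at this ⊢
      rw [this, Bool.xor_assoc]

theorem rowVal_const (xs : List Bool) (c : Bool) :
    rowVal xs ((List.range xs.length).map (fun _ => false) ++ [c]) = c := by
  have : ∀ n, (List.range n).map (fun _ => false) = List.replicate n false := by
    intro n
    simp
  rw [this]
  induction xs with
  | nil => simp [rowVal]
  | cons x xs ih => simp [rowVal, List.replicate_succ, ih]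

/-- The value of an affine clause. -/
def xorVal (x : ℕ → Bool) (δ : List (ℕ × Bool) × Bool) : Bool :=
  δ.1.foldr (fun a b => Bool.xor (x a.1 == a.2) b) δ.2

theorem length_toRow (m : ℕ) (δ : List (ℕ × Bool) × Bool) : (toRow m δ).length = m + 1 := by
  have key : ∀ (l : List (ℕ × Bool)) (r : List Bool),
      (l.foldl (fun r a => bif a.2 then flip a.1 r else flip m (flip a.1 r)) r).length
        = r.length := by
    intro l
    induction l with
    | nil => simp
    | cons a l ih =>
      intro r
      rw [List.foldl_cons, ih]
      cases a.2 <;> simp [length_flip]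
  rw [toRow, key]
  simp

theorem rowVal_toRow (xs : List Bool) {δ : List (ℕ × Bool) × Bool}
    (hδ : ∀ a ∈ δ.1, a.1 < xs.length) :
    rowVal xs (toRow xs.length δ) = !xorVal (fun i => xs.getD i true) δ := by
  obtain ⟨l, p⟩ := δ
  -- Generalized over the row and the parity, so that the parity absorbs the literals already
  -- processed.
  have key : ∀ (l : List (ℕ × Bool)) (r : List Bool) (p : Bool), (∀ a ∈ l, a.1 < xs.length) →
      r.length = xs.length + 1 → rowVal xs r = !p →
      rowVal xs (l.foldl (fun r a => bif a.2 then flip a.1 r else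
        flip xs.length (flip a.1 r)) r) = !xorVal (fun i => xs.getD i true) (l, p) := by
    intro l
    induction l with
    | nil => intro r p _ _ h; simpa [xorVal] using h
    | cons a l ih =>
      intro r p hl hr h
      have ha : a.1 < xs.length := hl a (by simp)
      rw [List.foldl_cons, ih _ (Bool.xor (xs.getD a.1 true == a.2) p)
        (fun b hb => hl b (by simp [hb]))]
      · congr 1
        simp only [xorVal, List.foldr_cons]
        clear ih hl
        induction l with
        | nil => rfl
        | cons b l ih =>
          rw [List.foldr_cons, List.foldr_cons, ih]
          exact Bool.xor_left_comm _ _ _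
      · cases a.2 <;> simp [length_flip, hr]
      · have h1 := rowVal_flip xs hr ha.le
        have h2 := rowVal_flip xs (r := flip a.1 r) (i := xs.length) (by rw [length_flip, hr]) le_rfl
        cases h3 : a.2
        · rw [cond_false, h2, h1, h]
          generalize xs.getD a.1 true = c
          simp
          cases c <;> cases p <;> rfl
        · rw [cond_true, h1, h]
          generalize xs.getD a.1 true = c
          cases c <;> cases p <;> rfl
  exact key l _ p hδ (by simp) (rowVal_const xs _)

theorem xorRow_cons (a b : Bool) (r p : List Bool) :
    xorRow (a :: r) (b :: p) = Bool.xor a b :: xorRow r p := by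
  simp [xorRow, List.range_succ_eq_map, Function.comp_def]

theorem rowVal_xorRow (xs : List Bool) {r p : List Bool} (hr : r.length = xs.length + 1)
    (hp : p.length = xs.length + 1) :
    rowVal xs (xorRow r p) = Bool.xor (rowVal xs r) (rowVal xs p) := by
  induction xs generalizing r p with
  | nil =>
    obtain ⟨c, rfl⟩ := List.length_eq_one_iff.1 hr
    obtain ⟨d, rfl⟩ := List.length_eq_one_iff.1 hp
    simp [xorRow, rowVal]
  | cons x xs ih =>
    obtain ⟨c, r, rfl⟩ := List.exists_cons_of_length_eq_add_one hr
    obtain ⟨d, p, rfl⟩ := List.exists_cons_of_length_eq_add_one hp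
    rw [xorRow_cons]
    simp only [rowVal, List.headD_cons, List.tail_cons]
    rw [ih (by simpa using hr) (by simpa using hp)]
    generalize rowVal xs r = e
    generalize rowVal xs p = f
    cases c <;> cases d <;> cases x <;> cases e <;> cases f <;> rfl

/-- Adding the pivot row cancels the first variable in every other row containing it. Conversely,
the pivot row determines that variable from a solution of the remaining system. -/
theorem exists_elim_iff {n : ℕ} {R : List (List Bool)} (hR : ∀ r ∈ R, r.length = n + 2) :
    (∃ xs, xs.length = n + 1 ∧ ∀ r ∈ R, rowVal xs r = false) ↔
      ∃ xs, xs.length = n ∧ ∀ r ∈ elim R, rowVal xs r = false := by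
  set p := (R.filter fun p => p.headD false).headD [] with hp
  have hpR : ∀ r ∈ R, r.headD false = true → p ∈ R ∧ p.headD false = true := by
    intro r hr h
    have h1 : r ∈ R.filter fun p => p.headD false := List.mem_filter.2 ⟨hr, h⟩
    cases hf : R.filter fun p => p.headD false with
    | nil =>
      rw [hf] at h1
      simp at h1
    | cons q l =>
      have h2 : q ∈ R.filter fun p => p.headD false := by rw [hf]; simp
      have h3 : p = q := by rw [hp, hf]; rfl
      rw [h3]
      exact List.mem_filter.1 h2
  have hval : ∀ r ∈ R, r.headD false = true → ∀ xs : List Bool, xs.length = n →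
      rowVal xs (xorRow r p).tail = Bool.xor (rowVal xs r.tail) (rowVal xs p.tail) := by
    intro r hr h xs hxs
    have h1 := hR r hr
    have h2 := hR p (hpR r hr h).1
    obtain ⟨c, r, rfl⟩ := List.exists_cons_of_length_eq_add_one h1
    obtain ⟨d, q, hq⟩ := List.exists_cons_of_length_eq_add_one h2
    rw [hq, xorRow_cons]
    simp only [List.tail_cons]
    refine rowVal_xorRow xs (by simpa [hxs] using h1) ?_
    rw [hq] at h2
    simpa [hxs] using h2
  constructor
  · rintro ⟨xs, hxs, h⟩
    obtain ⟨x, xs, rfl⟩ := List.exists_cons_of_length_eq_add_one hxs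
    have hxs' : xs.length = n := by simpa using hxs
    refine ⟨xs, hxs', fun r hr => ?_⟩
    obtain ⟨s, hs, rfl⟩ := List.mem_map.1 hr
    have h1 := h s hs
    cases hc : s.headD false with
    | true =>
      rw [cond_true, ← hp, hval s hs hc xs hxs']
      have h2 := h p (hpR s hs hc).1
      simp only [rowVal, hc, (hpR s hs hc).2] at h1 h2
      revert h1 h2
      generalize rowVal xs s.tail = e
      generalize rowVal xs p.tail = f
      cases x <;> cases e <;> cases f <;> simp
    | false =>
      rw [cond_false]
      rw [rowVal, hc] at h1
      simpa using h1
  · rintro ⟨xs, hxs, h⟩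
    -- This first coordinate solves the pivot row, and with it all rows with leading coefficient 1.
    -- If there is no pivot, any value would do.
    refine ⟨rowVal xs p.tail :: xs, by simp [hxs], fun r hr => ?_⟩
    have h1 := h _ (List.mem_map.2 ⟨r, hr, rfl⟩)
    rw [← hp] at h1
    cases hc : r.headD false with
    | true =>
      rw [hc, cond_true, hval r hr hc xs hxs] at h1
      simp only [rowVal, hc]
      revert h1
      generalize rowVal xs r.tail = e
      generalize rowVal xs p.tail = f
      revert e f
      decide
    | false =>
      rw [hc, cond_false] at h1
      rw [rowVal, hc, h1]
      rfl

theorem solvable_iff {n : ℕ} {R : List (List Bool)} (hR : ∀ r ∈ R, r.length = n + 1) :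
    solvable n R = true ↔ ∃ xs, xs.length = n ∧ ∀ r ∈ R, rowVal xs r = false := by
  induction n generalizing R with
  | zero => simp [solvable, rowVal]
  | succ n ih =>
    rw [exists_elim_iff hR, ← ih fun r hr => by
      obtain ⟨s, hs, h⟩ := length_of_mem_elim hr
      rw [h, hR s hs]
      omega]
    unfold solvable
    rw [List.range_succ_eq_map, List.foldl_cons, List.foldl_map]

/-! ### From rows back to affine clauses -/

variable {m : ℕ}

theorem xorVal_rawXor (x : Point m) (δ : XorClause m) (d : Bool) :
    xorVal (fun i => (List.ofFn x).getD i d) (rawXor δ) = δ.eval x := by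
  simp only [xorVal, rawXor, XorClause.eval, List.foldr_map]
  congr 1
  funext a b
  congr 2
  exact getD_ofFn x a.1 d

theorem affSat_iff (S : List (XorClause m)) :
    affSat m (S.map rawXor) = true ↔ ∃ x : Point m, ∀ δ ∈ S, δ.eval x = true := by
  have hval : ∀ (x : Point m) (δ : XorClause m),
      rowVal (List.ofFn x) (toRow m (rawXor δ)) = !δ.eval x := by
    intro x δ
    have h := rowVal_toRow (List.ofFn x) (δ := rawXor δ) (by
      intro a ha
      obtain ⟨b, _, rfl⟩ := List.mem_map.1 ha
      simp [rawLit])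
    rw [List.length_ofFn, xorVal_rawXor] at h
    exact h
  rw [affSat, solvable_iff (by
    intro r hr
    obtain ⟨δ, _, rfl⟩ := List.mem_map.1 hr
    exact length_toRow m δ)]
  constructor
  · rintro ⟨xs, hxs, h⟩
    obtain ⟨x, rfl⟩ : ∃ x : Point m, xs = List.ofFn x :=
      ⟨fun i => xs[i], by subst hxs; simp⟩
    refine ⟨x, fun δ hδ => ?_⟩
    have := h _ (List.mem_map_of_mem (List.mem_map_of_mem hδ))
    simpa [hval] using this
  · rintro ⟨x, hx⟩
    refine ⟨List.ofFn x, by simp, fun r hr => ?_⟩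
    obtain ⟨_, h1, rfl⟩ := List.mem_map.1 hr
    obtain ⟨δ, hδ, rfl⟩ := List.mem_map.1 h1
    simp [hval, hx δ hδ]

/-- The affine clauses that fix the features outside of `Y`. -/
def unitClauses (v Y : Point m) : List (XorClause m) :=
  (List.finRange m).map fun i => bif Y i then ⟨[], true⟩ else ⟨[(i, v i)], false⟩

theorem units_eq (v Y : Point m) :
    units (List.ofFn v) (List.ofFn Y) = (unitClauses v Y).map rawXor := by
  simp only [units, unitClauses, List.map_map, List.length_ofFn]
  refine List.ext_getElem (by simp) fun k h1 h2 => ?_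
  have hk : k < m := by simpa using h1
  have h3 := getD_ofFn Y ⟨k, hk⟩ false
  have h4 := getD_ofFn v ⟨k, hk⟩ false
  simp only at h3 h4
  simp only [List.getElem_map, List.getElem_range, h3, h4, List.getElem_finRange,
    Function.comp_apply]
  change _ = rawXor (bif Y ⟨k, hk⟩ then _ else _)
  cases Y ⟨k, hk⟩ <;> rfl

theorem eval_unitClauses {v Y x : Point m} :
    (∀ δ ∈ unitClauses v Y, δ.eval x = true) ↔ Agree v Y x := by
  simp only [unitClauses, List.forall_mem_map, List.mem_finRange, true_implies, Agree]
  refine forall_congr' fun j => ?_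
  cases Y j <;> simp [XorClause.eval]

theorem sat_iff (f : List (XorClause m)) (v Y : Point m) (b : Bool) :
    sat (AFF.encode f) (List.ofFn v) (List.ofFn Y) b = true ↔
      ∃ x, Agree v Y x ∧ AFF.eval f x = b := by
  have hd : (AFF.encode f).toList.map Data.toXor = f.map rawXor := by
    simp [AFF, Function.comp_def]
  have he : ∀ x, AFF.eval f x = f.all fun δ => δ.eval x := fun _ => rfl
  simp only [sat, hd, he, units_eq, List.length_ofFn]
  cases b with
  | true =>
    rw [cond_true, ← List.map_append, affSat_iff]
    refine exists_congr fun x => ?_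
    rw [List.forall_mem_append, eval_unitClauses, List.all_eq_true]
  | false =>
    rw [cond_false, List.any_eq_true]
    constructor
    · rintro ⟨_, hδ, h⟩
      obtain ⟨δ, hδ', rfl⟩ := List.mem_map.1 hδ
      obtain ⟨x, hx⟩ := (affSat_iff (δ.not :: unitClauses v Y)).1 h
      rw [List.forall_mem_cons, eval_unitClauses] at hx
      refine ⟨x, hx.2, ?_⟩
      rw [← Bool.not_eq_true, List.all_eq_true]
      intro h'
      simpa [h' δ hδ'] using hx.1
    · rintro ⟨x, hx, h⟩
      rw [← Bool.not_eq_true, List.all_eq_true] at h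
      push Not at h
      obtain ⟨δ, hδ, h⟩ := h
      refine ⟨_, List.mem_map_of_mem hδ, (affSat_iff (δ.not :: unitClauses v Y)).2 ⟨x, ?_⟩⟩
      rw [List.forall_mem_cons, eval_unitClauses]
      exact ⟨by simpa using h, hx⟩

end Affine

theorem oneCXp_AFF : OneCXpInPolyTime AFF :=
  OneCXpInPolyTime.of_sat (S := Affine.sat) (by fun_prop)
    fun _ φ _ _ v Y b => Affine.sat_iff φ v Y b

/-! ## Evaluation of graphs -/

section Dag

variable {α β γ : Type}

theorem dagFold_map (f : γ → List β → β) (h : α → γ) (l : List α) :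
    dagFold f (l.map h) = dagFold (fun a => f (h a)) l := by
  induction l with
  | nil => rfl
  | cons a l ih => simp [dagFold, ih]

theorem dagFold_drop (f : α → List β → β) (l : List α) (j : ℕ) :
    (dagFold f l).drop j = dagFold f (l.drop j) := by
  induction l generalizing j with
  | nil => simp [dagFold]
  | cons a l ih =>
    cases j with
    | zero => rfl
    | succ j => simpa [dagFold] using ih j

theorem dagFold_getD (f : α → List β → β) (l : List α) (j : ℕ) (d : β) :
    (dagFold f l).getD j d = (dagFold f (l.drop j)).headD d := by
  rw [← dagFold_drop]
  simp [List.getD_eq_getElem?_getD, List.headD_eq_head?_getD, List.head?_drop]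

theorem length_dagFold (f : α → List β → β) (l : List α) : (dagFold f l).length = l.length := by
  induction l with
  | nil => rfl
  | cons a l ih => simp [dagFold, ih]

theorem drop_suffix_of_cons_suffix {g : α} {r c : List α} (h : (g :: r) <:+ c) (j : ℕ) :
    r.drop j <:+ c :=
  (List.drop_suffix j r).trans ((List.suffix_cons g r).trans h)

/-- Induction along the edges of a graph. -/
theorem dag_induction {P : List α → Prop} (nil : P [])
    (cons : ∀ g r, (∀ j, P (r.drop j)) → P (g :: r)) (c : List α) : P c := by
  suffices h : ∀ n (c : List α), c.length ≤ n → P c from h _ c le_rfl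
  intro n
  induction n with
  | zero =>
    intro c hc
    rw [List.eq_nil_of_length_eq_zero (by omega : c.length = 0)]
    exact nil
  | succ n ih =>
    intro c hc
    cases c with
    | nil => exact nil
    | cons g r =>
      refine cons g r fun j => ih _ ?_
      simp only [List.length_cons, List.length_drop] at *
      omega

end Dag

/-! ## Set-labeled diagrams -/

theorem dagReach_drop {α : Type} {refs : α → List ℕ} {g : α} {r : List α} {j : ℕ}
    (hj : j ∈ refs g) : DagReach refs (g :: r) (r.drop j) :=
  Relation.ReflTransGen.single ⟨g, r, rfl, j, hj, rfl⟩

namespace SetLabeled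

/-- The label of the edge contains a value that the variable `i` may take. -/
def meets (v Y : List Bool) (i : ℕ) (e : Data) : Bool :=
  (Y.getD i false || !v.getD i false) && e.hd.hd.toBool ||
    (Y.getD i false || v.getD i false) && e.hd.tl.toBool

def isSink (g : Data) : Bool := g.hd.toNat == 0

/-- A point in which the variable `i` has the value `b` gets stuck at the node. -/
def isStuck (i : ℕ) (b : Bool) (g : Data) : Bool :=
  (g.hd.toNat == 1 && g.tl.toList.isEmpty) ||
    (g.hd.toNat == 2 && g.tl.hd.toNat == i &&
      !(g.tl.tl.toList.any fun e => bif b then e.hd.tl.toBool else e.hd.hd.toBool))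

/-- There is an edge that allows to continue. -/
def continues (v Y : List Bool) (g : Data) (vs : List Bool) : Bool :=
  (g.hd.toNat == 1 && g.tl.toList.any fun j => vs.getD j.toNat false) ||
    (g.hd.toNat == 2 && g.tl.tl.toList.any fun e =>
      meets v Y g.tl.hd.toNat e && vs.getD e.tl.toNat false)

def satisfiable (d : Data) (v Y : List Bool) : Bool :=
  (dagFold (fun g vs => isSink g || continues v Y g vs) d.toList).headD false

def stuck (d : Data) (v Y : List Bool) (i : ℕ) (b : Bool) : Bool :=
  (dagFold (fun g vs => isStuck i b g || continues v Y g vs) d.toList).headD false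

/-- The variable and value at which a point gets stuck are guessed and fixed beforehand; otherwise
an earlier label on the path could force a different value of that variable. -/
def falsifiable (d : Data) (v Y : List Bool) : Bool :=
  (List.range v.length).any fun i => [false, true].any fun b =>
    (Y.getD i false || v.getD i false == b) && stuck d (v.set i b) (Y.set i false) i b

def sat (d : Data) (v Y : List Bool) (b : Bool) : Bool :=
  bif b then satisfiable d v Y else falsifiable d v Y

/-! ### Running time of the reachability tests -/

section PolyTime

variable {α : Type} [Enc α]

@[fun_prop] theorem isStuck_polyTime {i : α → ℕ} {b : α → Bool} {g : α → Data}
    (hi : PolyTime i) (hb : PolyTime b) (hg : PolyTime g) :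
    PolyTime fun x => isStuck (i x) (b x) (g x) := by
  unfold isStuck
  fun_prop

@[fun_prop] theorem continues_polyTime {v Y : α → List Bool} {g : α → Data} {vs : α → List Bool}
    (hv : PolyTime v) (hY : PolyTime Y) (hg : PolyTime g) (hvs : PolyTime vs) :
    PolyTime fun x => continues (v x) (Y x) (g x) (vs x) := by
  unfold continues meets
  fun_prop

@[fun_prop] theorem satisfiable_polyTime {d : α → Data} {v Y : α → List Bool} (hd : PolyTime d)
    (hv : PolyTime v) (hY : PolyTime Y) : PolyTime fun x => satisfiable (d x) (v x) (Y x) := by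
  unfold satisfiable isSink
  refine PolyTime.headD (PolyTime.dagFold (by fun_prop) (by fun_prop) (b := fun _ => 3)
    (by fun_prop) fun _ _ _ _ => sz_bool_le _) (by fun_prop)

@[fun_prop] theorem stuck_polyTime {d : α → Data} {v Y : α → List Bool} {i : α → ℕ}
    {b : α → Bool} (hd : PolyTime d) (hv : PolyTime v) (hY : PolyTime Y) (hi : PolyTime i)
    (hb : PolyTime b) : PolyTime fun x => stuck (d x) (v x) (Y x) (i x) (b x) := by
  unfold stuck
  refine PolyTime.headD (PolyTime.dagFold (by fun_prop) (by fun_prop) (b := fun _ => 3)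
    (by fun_prop) fun _ _ _ _ => sz_bool_le _) (by fun_prop)

@[fun_prop] theorem sat_polyTime {d : α → Data} {v Y : α → List Bool} {b : α → Bool}
    (hd : PolyTime d) (hv : PolyTime v) (hY : PolyTime Y) (hb : PolyTime b) :
    PolyTime fun x => sat (d x) (v x) (Y x) (b x) := by
  unfold sat falsifiable
  fun_prop

end PolyTime

/-! ### Paths in set-labeled diagrams and the points that follow them -/

variable {m : ℕ}

/-- The label contains a value that the variable `i` may take. -/
def Meets (v Y : Point m) (i : Fin m) (S : Finset Bool) : Prop := ∃ b ∈ S, Y i = true ∨ b = v i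

/-- Bottom-up, from which nodes there is a path with suitable labels to a node in `Q`. -/
inductive Reach (Q : SetNode m → Bool) (v Y : Point m) : SetDiagram m → Prop
  | arrive (g r) : Q g = true → Reach Q v Y (g :: r)
  | disj (js r j) : j ∈ js → Reach Q v Y (r.drop j) → Reach Q v Y (SetNode.disj js :: r)
  | var (i es r e) : e ∈ es → Meets v Y i e.1 → Reach Q v Y (r.drop e.2) →
      Reach Q v Y (SetNode.var i es :: r)

theorem meets_iff {v Y : Point m} {i : Fin m} {S : Finset Bool} {d : Data} :
    meets (List.ofFn v) (List.ofFn Y) i (.cons (.cons (.ofBool (decide (false ∈ S)))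
      (.ofBool (decide (true ∈ S)))) d) = true ↔ Meets v Y i S := by
  simp only [meets, getD_ofFn, Data.hd_cons, Data.tl_cons, Data.toBool_ofBool, Meets]
  cases v i <;> cases Y i <;> simp [Bool.exists_bool]

theorem continues_sink (v Y vs : List Bool) :
    continues v Y (SetNode.sink : SetNode m).encode vs = false := rfl

theorem continues_disj (v Y vs : List Bool) (js : List ℕ) :
    continues v Y (SetNode.disj js : SetNode m).encode vs = js.any fun j => vs.getD j false := by
  simp only [continues, SetNode.encode, Data.hd_cons, Data.tl_cons, Data.toNat_ofNat,
    Data.toList_ofList, List.any_map, Function.comp_def]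
  simp only [beq_self_eq_true, Bool.true_and, Nat.reduceBEq, Bool.false_and, Bool.or_false]

theorem continues_var (v Y vs : List Bool) (i : Fin m) (es : List (Finset Bool × ℕ)) :
    continues v Y (SetNode.var i es).encode vs = es.any fun e =>
      meets v Y i (.cons (.cons (.ofBool (decide (false ∈ e.1))) (.ofBool (decide (true ∈ e.1))))
        (.ofNat e.2)) && vs.getD e.2 false := by
  simp only [continues, SetNode.encode, Data.hd_cons, Data.tl_cons, Data.toNat_ofNat,
    Data.toList_ofList, List.any_map, Function.comp_def]
  simp only [beq_self_eq_true, Bool.true_and, Nat.reduceBEq, Bool.false_and, Bool.false_or]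

theorem reach_iff {q : Data → Bool} {Q : SetNode m → Bool} (hq : ∀ g, q (SetNode.encode g) = Q g)
    (v Y : Point m) (c : SetDiagram m) :
    (dagFold (fun g vs => q g || continues (List.ofFn v) (List.ofFn Y) g vs)
      (c.map SetNode.encode)).headD false = true ↔ Reach Q v Y c := by
  rw [dagFold_map]
  refine dag_induction (P := fun c => (dagFold (fun g vs => q (SetNode.encode g) ||
    continues (List.ofFn v) (List.ofFn Y) (SetNode.encode g) vs) c).headD false = true ↔
      Reach Q v Y c) ?_ ?_ c
  · simp only [dagFold, List.headD_nil, Bool.false_eq_true, false_iff]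
    intro h
    cases h
  · intro g r ih
    rw [dagFold, List.headD_cons, Bool.or_eq_true, hq]
    constructor
    · rintro (h | h)
      · exact .arrive g r h
      · cases g with
        | sink => rw [continues_sink] at h; cases h
        | disj js =>
          rw [continues_disj, List.any_eq_true] at h
          obtain ⟨j, hj, h⟩ := h
          rw [dagFold_getD] at h
          exact .disj js r j hj ((ih j).1 h)
        | var i es =>
          rw [continues_var, List.any_eq_true] at h
          obtain ⟨e, he, h⟩ := h
          rw [Bool.and_eq_true, dagFold_getD] at h
          exact .var i es r e he (meets_iff.1 h.1) ((ih _).1 h.2)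
    · intro h
      cases h with
      | arrive _ _ h => exact Or.inl h
      | disj js _ j hj h =>
        right
        rw [continues_disj, List.any_eq_true]
        exact ⟨j, hj, by rw [dagFold_getD]; exact (ih j).2 h⟩
      | var i es _ e he h1 h2 =>
        right
        rw [continues_var, List.any_eq_true]
        refine ⟨e, he, ?_⟩
        rw [Bool.and_eq_true, dagFold_getD]
        exact ⟨meets_iff.2 h1, (ih _).2 h2⟩

/-- `x` follows a path to a node in `Q` on which exactly the variables in `D` are tested. -/
inductive Run (Q : SetNode m → Bool) (x : Point m) : SetDiagram m → Finset (Fin m) → Prop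
  | arrive (g r) : Q g = true → Run Q x (g :: r) ∅
  | disj (js r j D) : j ∈ js → Run Q x (r.drop j) D → Run Q x (SetNode.disj js :: r) D
  | var (i es r e D) : e ∈ es → x i ∈ e.1 → Run Q x (r.drop e.2) D →
      Run Q x (SetNode.var i es :: r) (insert i D)

theorem Run.congr {Q : SetNode m → Bool} {x y : Point m} {c : SetDiagram m} {D : Finset (Fin m)}
    (h : Run Q x c D) (hxy : ∀ i ∈ D, x i = y i) : Run Q y c D := by
  induction h with
  | arrive g r h => exact .arrive g r h
  | disj js r j D hj _ ih => exact .disj js r j D hj (ih hxy)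
  | var i es r e D he hx _ ih =>
    exact .var i es r e D he (by rw [← hxy i (by simp)]; exact hx)
      (ih fun k hk => hxy k (by simp [hk]))

theorem Run.exists_test {Q : SetNode m → Bool} {x : Point m} {c : SetDiagram m}
    {D : Finset (Fin m)} (h : Run Q x c D) {i : Fin m} (hi : i ∈ D) :
    ∃ es r, DagReach SetNode.refs c (SetNode.var i es :: r) ∧ ∃ e ∈ es, x i ∈ e.1 := by
  induction h with
  | arrive g r h => simp at hi
  | disj js r j D hj _ ih =>
    obtain ⟨es, r', h1, h2⟩ := ih hi
    exact ⟨es, r', (dagReach_drop (by simpa [SetNode.refs] using hj)).trans h1, h2⟩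
  | var k es r e D he hx _ ih =>
    by_cases hik : i = k
    · subst hik
      exact ⟨es, r, .refl, e, he, hx⟩
    · obtain ⟨es', r', h1, h2⟩ := ih (by simpa [hik] using hi)
      exact ⟨es', r', (dagReach_drop (g := SetNode.var k es) (List.mem_map_of_mem he)).trans h1, h2⟩

theorem focusing_drop {g : SetNode m} {r : SetDiagram m}
    (h : SetDiagram.Focusing (g :: r)) {j : ℕ} (hj : j ∈ g.refs) :
    SetDiagram.Focusing (r.drop j) := fun i es r' h1 =>
  h i es r' ((dagReach_drop hj).trans h1)

/-- The point is built from the target upwards. If the variable of a node is tested again below, its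
value lies in a later label, which by focusing is contained in the present one. Otherwise its value
can be changed without disturbing the path below. -/
theorem Reach.exists_run {Q : SetNode m → Bool} {v Y : Point m} {c : SetDiagram m}
    (h : Reach Q v Y c) (hc : c.Focusing) : ∃ x, Agree v Y x ∧ ∃ D, Run Q x c D := by
  induction h with
  | arrive g r h => exact ⟨v, fun _ _ => rfl, ∅, .arrive g r h⟩
  | disj js r j hj _ ih =>
    obtain ⟨x, hx, D, h⟩ := ih (focusing_drop hc hj)
    exact ⟨x, hx, D, .disj js r j D hj h⟩
  | var i es r e he hm _ ih =>
    have hr : e.2 ∈ (SetNode.var i es).refs := List.mem_map_of_mem he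
    obtain ⟨x, hx, D, h⟩ := ih (focusing_drop hc hr)
    by_cases hi : i ∈ D
    · obtain ⟨es', r', h1, e', he', hxe⟩ := h.exists_test hi
      exact ⟨x, hx, _, .var i es r e D he (hc i es r .refl e he es' r' h1 e' he' hxe) h⟩
    · obtain ⟨b, hb, hY⟩ := hm
      refine ⟨Function.update x i b, fun j hj => ?_, _, .var i es r e D he ?_
        (h.congr fun k hk => ?_)⟩
      · by_cases hji : j = i
        · subst hji
          rw [Function.update_self]
          simpa [hj] using hY
        · rw [Function.update_of_ne hji, hx j hj]
      · rwa [Function.update_self]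
      · rw [Function.update_of_ne]
        rintro rfl
        exact hi hk

theorem eval_nil (x : Point m) : SetDiagram.eval ([] : SetDiagram m) x = false := rfl

theorem eval_sink (r : SetDiagram m) (x : Point m) :
    SetDiagram.eval (SetNode.sink :: r) x = true := rfl

theorem eval_disj (js : List ℕ) (r : SetDiagram m) (x : Point m) :
    SetDiagram.eval (SetNode.disj js :: r) x = js.any fun j => SetDiagram.eval (r.drop j) x := by
  simp only [SetDiagram.eval, dagFold, List.headD_cons, SetNode.val, dagFold_getD]

theorem eval_var (i : Fin m) (es : List (Finset Bool × ℕ)) (r : SetDiagram m) (x : Point m) :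
    SetDiagram.eval (SetNode.var i es :: r) x =
      es.any fun e => decide (x i ∈ e.1) && SetDiagram.eval (r.drop e.2) x := by
  simp only [SetDiagram.eval, dagFold, List.headD_cons, SetNode.val, dagFold_getD]

def sinkNode : SetNode m → Bool
  | .sink => true
  | _ => false

def stuckNode (i : Fin m) (b : Bool) : SetNode m → Bool
  | .sink => false
  | .disj js => js.isEmpty
  | .var k es => k == i && !(es.any fun e => decide (b ∈ e.1))

theorem isSink_encode (g : SetNode m) : isSink g.encode = sinkNode g := by
  cases g <;> simp [isSink, SetNode.encode, sinkNode]

theorem isStuck_encode (i : Fin m) (b : Bool) (g : SetNode m) :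
    isStuck i b g.encode = stuckNode i b g := by
  cases g with
  | sink => simp [isStuck, SetNode.encode, stuckNode]
  | disj js => cases js <;> simp [isStuck, SetNode.encode, stuckNode, Data.ofList, Data.toList]
  | var k es =>
    simp only [isStuck, SetNode.encode, stuckNode, Data.hd_cons, Data.tl_cons, Data.toNat_ofNat,
      Data.toList_ofList, List.any_map, Function.comp_def, Data.toBool_ofBool]
    have : ((k : ℕ) == (i : ℕ)) = (k == i) := by
      rw [Bool.eq_iff_iff]
      simp [Fin.ext_iff]
    cases b <;> simp [this]

theorem Run.eval_eq_true {x : Point m} {c : SetDiagram m} {D : Finset (Fin m)}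
    (h : Run sinkNode x c D) : c.eval x = true := by
  induction h with
  | arrive g r h =>
    cases g with
    | sink => rfl
    | _ => simp [sinkNode] at h
  | disj js r j D hj _ ih => rw [eval_disj, List.any_eq_true]; exact ⟨j, hj, ih⟩
  | var i es r e D he hx _ ih =>
    rw [eval_var, List.any_eq_true]
    exact ⟨e, he, by simp [hx, ih]⟩

theorem deterministic_drop {g : SetNode m} {r : SetDiagram m}
    (h : SetDiagram.Deterministic (g :: r)) (j : ℕ) : SetDiagram.Deterministic (r.drop j) :=
  ⟨fun js hjs => h.1 js (List.mem_cons_of_mem _ (List.mem_of_mem_drop hjs)),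
    fun i es hes => h.2 i es (List.mem_cons_of_mem _ (List.mem_of_mem_drop hes))⟩

theorem eq_of_mem_labels {es : List (Finset Bool × ℕ)}
    (h : es.Pairwise fun e e' => Disjoint e.1 e'.1) {e e' : Finset Bool × ℕ} (he : e ∈ es)
    (he' : e' ∈ es) {b : Bool} (hb : b ∈ e.1) (hb' : b ∈ e'.1) : e = e' := by
  by_contra hne
  have hs : Std.Symm fun e e' : Finset Bool × ℕ => Disjoint e.1 e'.1 := ⟨fun _ _ h => h.symm⟩
  have := h.forall he he' hne
  exact Finset.disjoint_left.1 this hb hb'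

/-- Determinism leaves the point no other edge at any node of the path, so being stuck at its end
excludes every path to the sink. -/
theorem Run.eval_eq_false {i : Fin m} {x : Point m} {c : SetDiagram m} {D : Finset (Fin m)}
    (h : Run (stuckNode i (x i)) x c D) (hc : c.Deterministic) : c.eval x = false := by
  induction h with
  | arrive g r h =>
    cases g with
    | sink => simp [stuckNode] at h
    | disj js =>
      rw [stuckNode, List.isEmpty_iff] at h
      rw [h, eval_disj]
      rfl
    | var k es =>
      simp only [stuckNode, Bool.and_eq_true, beq_iff_eq, Bool.not_eq_true', List.any_eq_false,
        decide_eq_true_eq] at h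
      rw [eval_var, h.1, List.any_eq_false]
      intro e he
      simp [h.2 e he]
  | disj js r j D hj _ ih =>
    have h1 := hc.1 js (by simp)
    obtain rfl : js = [j] := by
      match js, h1, hj with
      | [k], _, hj => rw [List.mem_singleton.1 hj]
    rw [eval_disj]
    simpa using ih (deterministic_drop hc j)
  | var k es r e D he hx _ ih =>
    rw [eval_var, List.any_eq_false]
    intro e' he'
    by_cases hx' : x k ∈ e'.1
    · obtain rfl := eq_of_mem_labels (hc.2 k es (by simp)) he he' hx hx'
      simp [ih (deterministic_drop hc e.2)]
    · simp [hx']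

theorem reach_of_eval_eq_true {v Y x : Point m} (hx : Agree v Y x) (c : SetDiagram m) :
    c.eval x = true → Reach sinkNode v Y c := by
  refine dag_induction (P := fun c => SetDiagram.eval c x = true → Reach sinkNode v Y c)
    (fun h => by simp [eval_nil] at h) (fun g r ih h => ?_) c
  cases g with
  | sink => exact .arrive _ _ rfl
  | disj js =>
    rw [eval_disj, List.any_eq_true] at h
    obtain ⟨j, hj, h⟩ := h
    exact .disj js r j hj (ih j h)
  | var i es =>
    rw [eval_var, List.any_eq_true] at h
    obtain ⟨e, he, h⟩ := h
    simp only [Bool.and_eq_true, decide_eq_true_eq] at h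
    refine .var i es r e he ⟨x i, h.1, ?_⟩ (ih e.2 h.2)
    cases hY : Y i
    · exact Or.inr (hx i hY)
    · exact Or.inl rfl

/-- A non-model is followed downwards as long as it has an edge to take. Edges lead to nodes and the
sink has value true, so the walk ends at a node where the point is stuck; the variable tested there
is the witness. -/
theorem reach_of_eval_eq_false {v Y x : Point m} (hx : Agree v Y x) (hm : 0 < m)
    (c : SetDiagram m) : c ≠ [] →
    (∀ g r, (g :: r) <:+ c → ∀ j ∈ SetNode.refs g, j < r.length) → c.eval x = false →
    ∃ i, Reach (stuckNode i (x i)) (Function.update v i (x i)) (Function.update Y i false) c := by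
  refine dag_induction (P := fun c => c ≠ [] →
    (∀ g r, (g :: r) <:+ c → ∀ j ∈ SetNode.refs g, j < r.length) → SetDiagram.eval c x = false →
    ∃ i, Reach (stuckNode i (x i)) (Function.update v i (x i)) (Function.update Y i false) c)
    (fun h => absurd rfl h) (fun g r ih _ hd h => ?_) c
  have hdrop : ∀ j ∈ g.refs, r.drop j ≠ [] := fun j hj => by
    have := hd g r List.suffix_rfl j hj
    rw [ne_eq, List.drop_eq_nil_iff]
    omega
  have hd' : ∀ j g' r', (g' :: r') <:+ r.drop j → ∀ j ∈ SetNode.refs g', j < r'.length :=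
    fun j g' r' h => hd g' r' (h.trans ((List.drop_suffix j r).trans (List.suffix_cons g r)))
  cases g with
  | sink => simp [eval_sink] at h
  | disj js =>
    cases js with
    -- A childless disjunctive node is stuck for every variable, so the first one serves.
    | nil => exact ⟨⟨0, hm⟩, .arrive _ _ rfl⟩
    | cons j js =>
      rw [eval_disj, List.any_eq_false] at h
      obtain ⟨i, hi⟩ := ih j (hdrop j (by simp [SetNode.refs])) (hd' j)
        (by simpa using h j (by simp))
      exact ⟨i, .disj _ _ j (by simp) hi⟩
  | var k es =>
    by_cases he : ∃ e ∈ es, x k ∈ e.1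
    · obtain ⟨e, he, hxe⟩ := he
      rw [eval_var, List.any_eq_false] at h
      have h1 := h e he
      simp only [hxe, decide_true, Bool.true_and, Bool.not_eq_true] at h1
      obtain ⟨i, hi⟩ := ih e.2 (hdrop e.2 (List.mem_map_of_mem he)) (hd' e.2) h1
      refine ⟨i, .var k es r e he ⟨x k, hxe, ?_⟩ hi⟩
      by_cases hki : k = i
      · subst hki
        exact Or.inr (by simp)
      · rw [Function.update_of_ne hki, Function.update_of_ne hki]
        cases hY : Y k
        · exact Or.inr (hx k hY)
        · exact Or.inl rfl
    · refine ⟨k, .arrive _ _ ?_⟩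
      simp only [stuckNode, beq_self_eq_true, Bool.true_and, Bool.not_eq_true', List.any_eq_false,
        decide_eq_true_eq]
      exact fun e h1 h2 => he ⟨e, h1, h2⟩

theorem sat_iff {c : SetDiagram m} (hc : c.IsDFSD) (hm : 0 < m) (v Y : Point m) (b : Bool) :
    sat c.encode (List.ofFn v) (List.ofFn Y) b = true ↔ ∃ x, Agree v Y x ∧ c.eval x = b := by
  obtain ⟨⟨hne, hdag, _⟩, hdet, hfoc⟩ := hc
  have hl : c.encode.toList = c.map SetNode.encode := by simp [SetDiagram.encode]
  cases b with
  | true =>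
    rw [sat, cond_true, satisfiable, hl, reach_iff isSink_encode]
    constructor
    · intro h
      obtain ⟨x, hx, D, h⟩ := h.exists_run hfoc
      exact ⟨x, hx, h.eval_eq_true⟩
    · rintro ⟨x, hx, h⟩
      exact reach_of_eval_eq_true hx c h
  | false =>
    have hs : ∀ (i : Fin m) b, stuck c.encode ((List.ofFn v).set i b) ((List.ofFn Y).set i false)
        i b = true ↔ Reach (stuckNode i b) (Function.update v i b) (Function.update Y i false) c := by
      intro i b
      rw [stuck, hl, ofFn_set, ofFn_set, reach_iff (isStuck_encode i b)]
    rw [sat, cond_false, falsifiable, List.any_eq_true]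
    constructor
    · rintro ⟨i, hi, h⟩
      rw [List.any_eq_true] at h
      obtain ⟨b, _, h⟩ := h
      have him : i < m := by simpa using hi
      have h2 := hs ⟨i, him⟩ b
      have h3 := getD_ofFn Y ⟨i, him⟩ false
      have h4 := getD_ofFn v ⟨i, him⟩ false
      simp only at h2 h3 h4
      rw [Bool.and_eq_true, h2, h3, h4] at h
      obtain ⟨x, hx, D, h5⟩ := h.2.exists_run hfoc
      have hxb : x ⟨i, him⟩ = b := by
        have := hx ⟨i, him⟩ (by simp)
        simpa using this
      refine ⟨x, fun j hj => ?_, ?_⟩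
      · by_cases hji : j = ⟨i, him⟩
        · rw [hji] at hj ⊢
          have := h.1
          rw [hj, Bool.false_or, beq_iff_eq] at this
          rw [hxb, this]
        · have := hx j (by rw [Function.update_of_ne hji]; exact hj)
          rwa [Function.update_of_ne hji] at this
      · rw [← hxb] at h5
        exact h5.eval_eq_false hdet
    · rintro ⟨x, hx, h⟩
      obtain ⟨i, hi⟩ := reach_of_eval_eq_false hx hm c hne hdag h
      refine ⟨i, by simp, List.any_eq_true.2 ⟨x i, by cases x i <;> simp, ?_⟩⟩
      rw [Bool.and_eq_true, hs, getD_ofFn, getD_ofFn]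
      refine ⟨?_, hi⟩
      cases hY : Y i
      · simp [hx i hY]
      · simp

end SetLabeled

theorem oneCXp_dFSD : OneCXpInPolyTime dFSD :=
  OneCXpInPolyTime.of_sat (S := SetLabeled.sat) (by fun_prop)
    fun _ _ hφ hm v Y b => SetLabeled.sat_iff hφ hm v Y b

/-! ## Expectations over independent bits -/

section Expect

variable {m : ℕ} {R : Type*} [CommRing R]

/-- Weight of a point if the bits are independent and the bit `i` is true with weight `p i`. -/
def weight (p : Fin m → R) (x : Point m) : R := ∏ i, bif x i then p i else 1 - p i

def expect (p : Fin m → R) (F : Point m → R) : R := ∑ x, F x * weight p x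

/-- The weight of the models of `f`. -/
def density (p : Fin m → R) (f : Point m → Bool) : R := expect p fun x => bif f x then 1 else 0

/-- Expand the product of the factors `p i + (1 - p i) = 1`. -/
theorem expect_one (p : Fin m → R) : expect p (fun _ => 1) = 1 := by
  have h := Fintype.prod_sum fun (i : Fin m) (b : Bool) => bif b then p i else 1 - p i
  simp only [Fintype.sum_bool, cond_true, cond_false, add_sub_cancel, Finset.prod_const_one] at h
  simp only [expect, weight, one_mul]
  exact h.symm

/-- Take two independent copies of the point and swap their coordinates outside `S`. The joint
weight is unchanged, `F` keeps looking at the first copy, and `G` now looks at the second. -/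
theorem expect_mul (p : Fin m → R) (S : Finset (Fin m)) {F G : Point m → R}
    (hF : ∀ x y, (∀ i ∈ S, x i = y i) → F x = F y)
    (hG : ∀ x y, (∀ i ∉ S, x i = y i) → G x = G y) :
    expect p (fun x => F x * G x) = expect p F * expect p G := by
  let φ : Point m × Point m → Point m × Point m := fun z =>
    (S.piecewise z.1 z.2, S.piecewise z.2 z.1)
  have hφ : Function.Involutive φ := by
    rintro ⟨x, y⟩
    refine Prod.ext (funext fun i => ?_) (funext fun i => ?_) <;>
      by_cases hi : i ∈ S <;> simp [φ, hi]
  calc expect p (fun x => F x * G x)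
      = expect p (fun x => F x * G x) * expect p (fun _ => 1) := by rw [expect_one, mul_one]
    _ = ∑ z : Point m × Point m, F z.1 * G z.1 * weight p z.1 * (1 * weight p z.2) := by
        rw [expect, expect, Finset.sum_mul_sum, ← Finset.univ_product_univ, Finset.sum_product]
    _ = ∑ z : Point m × Point m, F (φ z).1 * G (φ z).1 * weight p (φ z).1 *
          (1 * weight p (φ z).2) :=
        (Equiv.sum_comp (hφ.toPerm φ) fun z : Point m × Point m =>
          F z.1 * G z.1 * weight p z.1 * (1 * weight p z.2)).symm
    _ = ∑ z : Point m × Point m, F z.1 * weight p z.1 * (G z.2 * weight p z.2) := by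
        refine Finset.sum_congr rfl fun z _ => ?_
        have h1 : F (φ z).1 = F z.1 := hF _ _ fun i hi => by simp [φ, hi]
        have h2 : G (φ z).1 = G z.2 := hG _ _ fun i hi => by simp [φ, hi]
        have h3 : weight p (φ z).1 * weight p (φ z).2 = weight p z.1 * weight p z.2 := by
          simp only [weight, ← Finset.prod_mul_distrib]
          refine Finset.prod_congr rfl fun i _ => ?_
          by_cases hi : i ∈ S
          · simp [φ, hi]
          · simp only [φ, Finset.piecewise_eq_of_notMem _ _ _ hi]
            rw [mul_comm]
        rw [h1, h2]
        linear_combination F z.1 * G z.2 * h3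
    _ = expect p F * expect p G := by
        rw [expect, expect, Finset.sum_mul_sum, ← Finset.univ_product_univ, Finset.sum_product]

theorem density_and (p : Fin m → R) (S : Finset (Fin m)) {f g : Point m → Bool}
    (hf : ∀ x y, (∀ i ∈ S, x i = y i) → f x = f y)
    (hg : ∀ x y, (∀ i ∉ S, x i = y i) → g x = g y) :
    density p (fun x => f x && g x) = density p f * density p g := by
  rw [density, density, density, ← expect_mul p S (fun x y h => by rw [hf x y h])
    (fun x y h => by rw [hg x y h])]
  congr 1
  funext x
  cases f x <;> cases g x <;> simp

theorem density_or (p : Fin m → R) {f g : Point m → Bool} (h : ∀ x, ¬ (f x = true ∧ g x = true)) :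
    density p (fun x => f x || g x) = density p f + density p g := by
  simp only [density, expect, ← Finset.sum_add_distrib, ← add_mul]
  refine Finset.sum_congr rfl fun x _ => ?_
  have := h x
  cases h1 : f x <;> cases h2 : g x <;> simp_all

theorem density_true (p : Fin m → R) : density p (fun _ => true) = 1 := expect_one p

theorem density_false (p : Fin m → R) : density p (fun _ => false) = 0 := by
  simp [density, expect]

theorem density_not (p : Fin m → R) (f : Point m → Bool) :
    density p (fun x => !f x) = 1 - density p f := by
  have h := density_or p (f := fun x => !f x) (g := f) (by simp)
  simp only [Bool.not_or_self, density_true] at h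
  rw [h, add_sub_cancel_right]

/-- Expand the same product of sums after deleting the summand of coordinate `i` that contradicts
the literal. -/
theorem density_lit (p : Fin m → R) (i : Fin m) (b : Bool) :
    density p (fun x => x i == b) = bif b then p i else 1 - p i := by
  have h := Fintype.prod_sum fun (k : Fin m) (c : Bool) =>
    if k = i ∧ c ≠ b then 0 else bif c then p k else 1 - p k
  have h1 : ∀ x : Point m, (∏ k, if k = i ∧ x k ≠ b then 0 else bif x k then p k else 1 - p k)
      = (bif x i == b then 1 else 0) * weight p x := by
    intro x
    by_cases hx : x i = b
    · have : ∀ k, ¬ (k = i ∧ x k ≠ b) := by rintro k ⟨rfl, h'⟩; exact h' hx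
      simp [this, hx, weight]
    · rw [Finset.prod_eq_zero (Finset.mem_univ i) (by simp [hx])]
      have : (x i == b) = false := by simpa using hx
      simp [this]
  simp only [h1] at h
  rw [density, expect, ← h, Finset.prod_eq_single i]
  · cases b <;> simp
  · intro k _ hk
    simp [hk]
  · simp

/-- The bits outside of `Y` are fixed, the others are uniformly distributed. -/
def bitWeight (half : R) (v Y : Point m) (i : Fin m) : R :=
  bif Y i then half else bif v i then 1 else 0

open Classical in
-- All points of the subcube have the same weight, one factor `half` per free feature, and all
-- others have weight 0. The ring only needs an inverse of 2.
theorem density_bitWeight {half : R} (h : 2 * half = 1) (v Y : Point m) (f : Point m → Bool) :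
    density (bitWeight half v Y) f = (Finset.univ.filter fun x : Point m =>
      Agree v Y x ∧ f x = true).card * half ^ (Finset.univ.filter fun i => Y i = true).card := by
  have hw : ∀ x : Point m, weight (bitWeight half v Y) x =
      if Agree v Y x then half ^ (Finset.univ.filter fun i => Y i = true).card else 0 := by
    intro x
    have h2 : (1 : R) - half = half := by linear_combination -h
    split_ifs with hx
    · rw [← Finset.prod_const, Finset.prod_filter]
      refine Finset.prod_congr rfl fun i _ => ?_
      cases hY : Y i
      · have h3 := hx i hY
        simp only [bitWeight, hY, h3]
        cases v i <;> simp
      · simp only [bitWeight, hY]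
        cases x i <;> simp [h2]
    · unfold Agree at hx
      push Not at hx
      obtain ⟨i, hY, hi⟩ := hx
      refine Finset.prod_eq_zero (Finset.mem_univ i) ?_
      simp only [bitWeight, hY]
      cases h3 : x i <;> cases h4 : v i <;> simp_all
  simp only [density, expect, hw]
  rw [← nsmul_eq_mul, ← Finset.sum_const, Finset.sum_filter]
  refine Finset.sum_congr rfl fun x _ => ?_
  by_cases hx : Agree v Y x <;> cases f x <;> simp [hx]

end Expect

/-! ### Small odd non-divisors -/

/-- A positive number that is at most exponential has a small odd non-divisor. -/
theorem exists_odd_not_dvd {m N : ℕ} (hN : N ≠ 0) (h : N ≤ 2 ^ m) :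
    ∃ k < m + 4, ¬ (2 * k + 1) ∣ N := by
  by_contra! hdvd
  -- Suppose all odd numbers below `2 * n` divide `N`. Every prime power in the central binomial
  -- coefficient is at most `2 * n`, so its odd part divides `N`, while its power of 2 is at most `2
  -- * n`. The coefficient is then too small for the lower bound `4 ^ n / (2 * n)`.
  set n := m + 4 with hn
  set C := n.centralBinom with hC
  have hCpos : C ≠ 0 := Nat.centralBinom_ne_zero n
  have hpow : ∀ p, p ^ C.factorization p ≤ 2 * n := fun p =>
    Nat.pow_factorization_choose_le (by omega)
  have h1 : C ∣ 2 ^ C.factorization 2 * N := by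
    rw [← Nat.factorization_prime_le_iff_dvd hCpos (by positivity)]
    intro p hp
    rw [← hp.pow_dvd_iff_le_factorization (by positivity)]
    rcases hp.eq_two_or_odd' with rfl | hodd
    · exact Dvd.intro _ rfl
    · obtain ⟨k, hk⟩ := hodd.pow (n := C.factorization p)
      have h2 := hpow p
      rw [hk]
      exact (hdvd k (by omega)).mul_left _
  have h2 := Nat.le_of_dvd (by positivity) h1
  have h3 := Nat.four_pow_le_two_mul_self_mul_centralBinom n (by omega)
  have h4 : 2 ^ C.factorization 2 * N ≤ 2 * n * 2 ^ m := Nat.mul_le_mul (hpow 2) h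
  have h5 : 4 ^ n ≤ 2 * n * (2 * n * 2 ^ m) :=
    h3.trans (Nat.mul_le_mul_left _ (h2.trans h4))
  -- The shift by 4 in `n` makes this hold from `k = 0` on; it is the contradiction after division
  -- by `4 * 2 ^ m`.
  have h6 : ∀ k : ℕ, (k + 4) ^ 2 < 64 * 2 ^ k := by
    intro k
    induction k with
    | zero => norm_num
    | succ k ih =>
      have : (k + 1 + 4) ^ 2 + (k ^ 2 + 6 * k + 7) = 2 * (k + 4) ^ 2 := by ring
      rw [pow_succ 2 k]
      omega
  have h7 : 4 ^ n = 2 ^ m * 2 ^ m * 256 := by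
    rw [hn, pow_add, show (4 : ℕ) = 2 * 2 from rfl, mul_pow]
    norm_num
  have h8 := h6 m
  rw [← hn] at h8
  have h9 : 2 * n * (2 * n * 2 ^ m) < 2 ^ m * 2 ^ m * 256 := by
    have : 0 < 2 ^ m := by positivity
    calc 2 * n * (2 * n * 2 ^ m) = 4 * 2 ^ m * n ^ 2 := by ring
      _ < 4 * 2 ^ m * (64 * 2 ^ m) := Nat.mul_lt_mul_of_pos_left h8 (by positivity)
      _ = _ := by ring
  omega

/-! ## Circuits -/

namespace Counting

/-- Density of the models of a node, modulo `2 * k + 1`. -/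
def gateVal (k : ℕ) (v Y : List Bool) (g : Data) (vs : List ℕ) : ℕ :=
  bif g.hd.toNat == 0 then bif g.tl.toBool then 1 else 0
  else bif g.hd.toNat == 1 then
    -- `k + 1` is the inverse of 2 modulo `2 * k + 1`, the density of a literal over a free feature.
    bif Y.getD g.tl.hd.toNat false then k + 1
    else bif v.getD g.tl.hd.toNat false == g.tl.tl.toBool then 1 else 0
  -- Congruent to `1 - a`, where `a` is the value below, and free of subtraction.
  else bif g.hd.toNat == 2 then (1 + 2 * k * vs.getD g.tl.toNat 0) % (2 * k + 1)
  else bif g.hd.toNat == 3 then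
    g.tl.toList.foldl (fun s j => s * vs.getD j.toNat 0 % (2 * k + 1)) 1
  else g.tl.toList.foldl (fun s j => (s + vs.getD j.toNat 0) % (2 * k + 1)) 0

def value (k : ℕ) (d : Data) (v Y : List Bool) : ℕ :=
  (dagFold (gateVal k v Y) d.toList).headD 0

def sat (d : Data) (v Y : List Bool) (b : Bool) : Bool :=
  (List.range (v.length + 4)).any fun k =>
    !((bif b then value k d v Y else 1 + 2 * k * value k d v Y) % (2 * k + 1) == 0)

/-! ### Running time of the modular evaluation -/

section PolyTime

variable {α : Type} [Enc α]

theorem foldl_mod_le {τ : Type} (f : ℕ → τ → ℕ) {q s : ℕ} (hs : s ≤ q) (hq : 0 < q)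
    (l : List τ) : l.foldl (fun s j => f s j % q) s ≤ q := by
  induction l generalizing s with
  | nil => exact hs
  | cons a l ih => exact ih (Nat.mod_lt _ hq).le

/-- The reductions make the bound independent of the values below. It is not strict because for `k =
0` the unreduced constant 1 equals the modulus. -/
theorem gateVal_le (k : ℕ) (v Y : List Bool) (g : Data) (vs : List ℕ) :
    gateVal k v Y g vs ≤ 2 * k + 1 := by
  have h1 : ∀ c : Bool, (bif c then 1 else 0) ≤ 2 * k + 1 := by
    intro c
    cases c <;> simp
  unfold gateVal
  cases g.hd.toNat == 0
  · cases g.hd.toNat == 1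
    · cases g.hd.toNat == 2
      · cases g.hd.toNat == 3
        · exact foldl_mod_le _ (by omega) (by omega) _
        · exact foldl_mod_le _ (by omega) (by omega) _
      · exact (Nat.mod_lt _ (by omega)).le
    · cases Y.getD g.tl.hd.toNat false
      · exact h1 _
      · simp only [cond_true, cond_false]
        omega
  · exact h1 _

@[fun_prop] theorem gateVal_polyTime {k : α → ℕ} {v Y : α → List Bool} {g : α → Data}
    {vs : α → List ℕ} (hk : PolyTime k) (hv : PolyTime v) (hY : PolyTime Y) (hg : PolyTime g)
    (hvs : PolyTime vs) : PolyTime fun x => gateVal (k x) (v x) (Y x) (g x) (vs x) := by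
  have h1 : PolyTime fun x => (g x).tl.toList.foldl
      (fun s j => s * (vs x).getD j.toNat 0 % (2 * k x + 1)) 1 := by
    refine PolyTime.foldl (by fun_prop) (by fun_prop) (by fun_prop)
      (b := fun x => sz (2 * k x + 1)) (by fun_prop) fun x s j _ => ?_
    have := Nat.mod_lt (s * (vs x).getD j.toNat 0) (y := 2 * k x + 1) (by omega)
    simp only [sz_nat]
    omega
  have h2 : PolyTime fun x => (g x).tl.toList.foldl
      (fun s j => (s + (vs x).getD j.toNat 0) % (2 * k x + 1)) 0 := by
    refine PolyTime.foldl (by fun_prop) (by fun_prop) (by fun_prop)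
      (b := fun x => sz (2 * k x + 1)) (by fun_prop) fun x s j _ => ?_
    have := Nat.mod_lt (s + (vs x).getD j.toNat 0) (y := 2 * k x + 1) (by omega)
    simp only [sz_nat]
    omega
  unfold gateVal
  fun_prop

@[fun_prop] theorem value_polyTime {k : α → ℕ} {d : α → Data} {v Y : α → List Bool}
    (hk : PolyTime k) (hd : PolyTime d) (hv : PolyTime v) (hY : PolyTime Y) :
    PolyTime fun x => value (k x) (d x) (v x) (Y x) := by
  unfold value
  refine PolyTime.headD (PolyTime.dagFold (by fun_prop) (by fun_prop)
    (b := fun x => sz (2 * k x + 1)) (by fun_prop) fun x vs g _ => ?_) (by fun_prop)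
  have := gateVal_le (k x) (v x) (Y x) g vs
  simp only [sz_nat]
  omega

@[fun_prop] theorem sat_polyTime {d : α → Data} {v Y : α → List Bool} {b : α → Bool}
    (hd : PolyTime d) (hv : PolyTime v) (hY : PolyTime Y) (hb : PolyTime b) :
    PolyTime fun x => sat (d x) (v x) (Y x) (b x) := by
  unfold sat
  fun_prop

end PolyTime

/-! ### Decomposable deterministic circuits, with OBDD and SDD as special cases -/

variable {m : ℕ}

section Circuit

open Circuit

@[simp] theorem eval_const (b : Bool) (r : Circuit m) (x : Point m) :
    Circuit.eval (Gate.const b :: r) x = b := rfl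

@[simp] theorem eval_lit (i : Fin m) (b : Bool) (r : Circuit m) (x : Point m) :
    Circuit.eval (Gate.lit i b :: r) x = (x i == b) := rfl

@[simp] theorem eval_neg (j : ℕ) (r : Circuit m) (x : Point m) :
    Circuit.eval (Gate.neg j :: r) x = !Circuit.eval (r.drop j) x := by
  simp only [Circuit.eval, dagFold, List.headD_cons, Gate.val, dagFold_getD]

@[simp] theorem eval_and (js : List ℕ) (r : Circuit m) (x : Point m) :
    Circuit.eval (Gate.and js :: r) x = js.all fun j => Circuit.eval (r.drop j) x := by
  simp only [Circuit.eval, dagFold, List.headD_cons, Gate.val, dagFold_getD]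

@[simp] theorem eval_or (js : List ℕ) (r : Circuit m) (x : Point m) :
    Circuit.eval (Gate.or js :: r) x = js.any fun j => Circuit.eval (r.drop j) x := by
  simp only [Circuit.eval, dagFold, List.headD_cons, Gate.val, dagFold_getD]

@[simp] theorem vars_const (b : Bool) (r : Circuit m) :
    Circuit.vars (Gate.const b :: r) = ∅ := rfl

@[simp] theorem vars_lit (i : Fin m) (b : Bool) (r : Circuit m) :
    Circuit.vars (Gate.lit i b :: r) = {i} := rfl

@[simp] theorem vars_neg (j : ℕ) (r : Circuit m) :
    Circuit.vars (Gate.neg j :: r) = Circuit.vars (r.drop j) := by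
  simp only [Circuit.vars, dagFold, List.headD_cons, Gate.supp, dagFold_getD]

@[simp] theorem vars_and (js : List ℕ) (r : Circuit m) :
    Circuit.vars (Gate.and js :: r) = js.toFinset.biUnion fun j => Circuit.vars (r.drop j) := by
  simp only [Circuit.vars, dagFold, List.headD_cons, Gate.supp, dagFold_getD]

@[simp] theorem vars_or (js : List ℕ) (r : Circuit m) :
    Circuit.vars (Gate.or js :: r) = js.toFinset.biUnion fun j => Circuit.vars (r.drop j) := by
  simp only [Circuit.vars, dagFold, List.headD_cons, Gate.supp, dagFold_getD]

theorem eval_congr {x y : Point m} (c : Circuit m) :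
    (∀ i ∈ c.vars, x i = y i) → c.eval x = c.eval y := by
  refine dag_induction (P := fun c : Circuit m =>
    (∀ i ∈ c.vars, x i = y i) → c.eval x = c.eval y) (fun _ => rfl) (fun g r ih h => ?_) c
  cases g with
  | const b => rfl
  | lit i b => simp [h i (by simp)]
  | neg j =>
    rw [eval_neg, eval_neg, ih j (by simpa using h)]
  | and js =>
    simp only [vars_and, Finset.mem_biUnion, List.mem_toFinset] at h
    rw [eval_and, eval_and, Bool.eq_iff_iff, List.all_eq_true, List.all_eq_true]
    exact forall₂_congr fun j hj => by rw [ih j fun i hi => h i ⟨j, hj, hi⟩]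
  | or js =>
    simp only [vars_or, Finset.mem_biUnion, List.mem_toFinset] at h
    rw [eval_or, eval_or, Bool.eq_iff_iff, List.any_eq_true, List.any_eq_true]
    refine exists_congr fun j => and_congr_right fun hj => by
      rw [ih j fun i hi => h i ⟨j, hj, hi⟩]

/-- The nodes below the root are decomposable and deterministic. -/
inductive Tractable : Circuit m → Prop
  | nil : Tractable []
  | const (b r) : Tractable (Gate.const b :: r)
  | lit (i b r) : Tractable (Gate.lit i b :: r)
  | neg (j r) : Tractable (r.drop j) → Tractable (Gate.neg j :: r)
  | and (js r) : (∀ j ∈ js, Tractable (r.drop j)) →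
      (js.Pairwise fun j k => Disjoint (vars (r.drop j)) (vars (r.drop k))) →
      Tractable (Gate.and js :: r)
  | or (js r) : (∀ j ∈ js, Tractable (r.drop j)) →
      (js.Pairwise fun j k => Exclusive (r.drop j) (r.drop k)) → Tractable (Gate.or js :: r)

theorem tractable_of_decomposable (c : Circuit m) :
    c.Decomposable → c.Deterministic → Tractable c := by
  refine dag_induction (P := fun c : Circuit m => c.Decomposable → c.Deterministic →
    Tractable c) (fun _ _ => .nil) (fun g r ih h1 h2 => ?_) c
  have ih' : ∀ j, Tractable (r.drop j) := fun j =>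
    ih j (fun js s h => h1 js s (h.trans (drop_suffix_of_cons_suffix List.suffix_rfl j)))
      (fun js s h => h2 js s (h.trans (drop_suffix_of_cons_suffix List.suffix_rfl j)))
  cases g with
  | const b => exact .const b r
  | lit i b => exact .lit i b r
  | neg j => exact .neg j r (ih' j)
  | and js => exact .and js r (fun j _ => ih' j) (h1 js r List.suffix_rfl)
  | or js => exact .or js r (fun j _ => ih' j) (h2 js r List.suffix_rfl)

/-- The branches only contain variables of higher rank than the decision variable, which makes the
conjunctions decomposable; the opposite literals make the disjunction deterministic. The rank bound
is carried through the induction for this purpose. -/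
theorem tractable_of_OBDDFrom {rank : Fin m → ℕ} {k : ℕ} {c : Circuit m}
    (h : OBDDFrom rank k c) : Tractable c ∧ ∀ i ∈ c.vars, k ≤ rank i := by
  induction h with
  | const k b r => exact ⟨.const b r, by simp⟩
  | decision k i j₁ j₀ a₁ a₀ b₁ b₀ r r₁ r₀ s₁ s₀ hk h1 h2 h3 h4 _ _ ih1 ih0 =>
    have key : ∀ (j a b : ℕ) (c : Bool) (r' s : Circuit m), r.drop j = Gate.and [a, b] :: r' →
        r'.drop a = Gate.lit i c :: s → Tractable (r'.drop b) →
        (∀ l ∈ vars (r'.drop b), rank i + 1 ≤ rank l) →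
        Tractable (r.drop j) ∧ (∀ l ∈ vars (r.drop j), k ≤ rank l) ∧
          ∀ x, Circuit.eval (r.drop j) x = true → x i = c := by
      intro j a b c r' s e1 e2 ht hv
      rw [e1]
      refine ⟨.and _ _ ?_ ?_, ?_, ?_⟩
      · intro l hl
        simp only [List.mem_cons, List.not_mem_nil, or_false] at hl
        rcases hl with rfl | rfl
        · rw [e2]
          exact .lit i c s
        · exact ht
      · simp only [List.pairwise_cons, List.mem_singleton, forall_eq, List.not_mem_nil,
          IsEmpty.forall_iff, implies_true, List.Pairwise.nil, and_true]
        rw [e2, vars_lit, Finset.disjoint_singleton_left]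
        intro hi
        have := hv i hi
        omega
      · intro l hl
        simp only [vars_and, Finset.mem_biUnion, List.mem_toFinset, List.mem_cons,
          List.not_mem_nil, or_false] at hl
        obtain ⟨l', rfl | rfl, hl⟩ := hl
        · rw [e2, vars_lit, Finset.mem_singleton] at hl
          rw [hl]
          exact hk
        · have := hv l hl
          omega
      · intro x hx
        rw [eval_and, List.all_eq_true] at hx
        have := hx a (by simp)
        rw [e2, eval_lit] at this
        simpa using this
    obtain ⟨t1, v1, x1⟩ := key _ _ _ _ _ _ h1 h2 ih1.1 ih1.2
    obtain ⟨t0, v0, x0⟩ := key _ _ _ _ _ _ h3 h4 ih0.1 ih0.2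
    refine ⟨.or _ _ ?_ ?_, ?_⟩
    · intro l hl
      simp only [List.mem_cons, List.not_mem_nil, or_false] at hl
      rcases hl with rfl | rfl
      · exact t1
      · exact t0
    · simp only [List.pairwise_cons, List.mem_singleton, forall_eq, List.not_mem_nil,
        IsEmpty.forall_iff, implies_true, List.Pairwise.nil, and_true]
      rintro x ⟨h1, h0⟩
      have := (x1 x h1).symm.trans (x0 x h0)
      cases this
    · intro l hl
      simp only [vars_or, Finset.mem_biUnion, List.mem_toFinset, List.mem_cons,
        List.not_mem_nil, or_false] at hl
      obtain ⟨l', rfl | rfl, hl⟩ := hl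
      · exact v1 l hl
      · exact v0 l hl

/-- Primes and subs have their variables in disjoint subtrees of the vtree, and the elements of a
decision node inherit exclusiveness from their primes. -/
theorem tractable_of_SDDUnder (T : Vtree m) (hT : T.leaves.Nodup) (c : Circuit m)
    (h : SDDUnder T c) : Tractable c ∧ ∀ i ∈ c.vars, i ∈ T.leaves := by
  induction T generalizing c with
  | leaf i =>
    rcases h with ⟨b, r, rfl⟩ | ⟨b, r, rfl⟩
    · exact ⟨.const b r, by simp⟩
    · exact ⟨.lit i b r, by simp [Vtree.leaves]⟩
  | node l r ihl ihr =>
    simp only [Vtree.leaves] at hT ⊢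
    obtain ⟨hl, hr, hlr⟩ := List.nodup_append.1 hT
    rcases h with h | h | ⟨js, d, rfl, h1, h2⟩
    · obtain ⟨h3, h4⟩ := ihl hl c h
      exact ⟨h3, fun i hi => List.mem_append_left _ (h4 i hi)⟩
    · obtain ⟨h3, h4⟩ := ihr hr c h
      exact ⟨h3, fun i hi => List.mem_append_right _ (h4 i hi)⟩
    · have key : ∀ j ∈ js, Tractable (d.drop j) ∧
          (∀ i ∈ vars (d.drop j), i ∈ l.leaves ++ r.leaves) ∧
          ∀ x, Circuit.eval (d.drop j) x = true →
            Circuit.eval (prime (d.drop j)) x = true := by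
        intro j hj
        obtain ⟨p, s, e, h3, h4, h5⟩ := h1 j hj
        obtain ⟨tp, vp⟩ := ihl hl _ h4
        obtain ⟨ts, vs⟩ := ihr hr _ h5
        rw [h3]
        refine ⟨.and _ _ ?_ ?_, ?_, ?_⟩
        · intro l hl
          simp only [List.mem_cons, List.not_mem_nil, or_false] at hl
          rcases hl with rfl | rfl
          · exact tp
          · exact ts
        · simp only [List.pairwise_cons, List.mem_singleton, forall_eq, List.not_mem_nil,
            IsEmpty.forall_iff, implies_true, List.Pairwise.nil, and_true]
          rw [Finset.disjoint_left]
          intro i hi1 hi2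
          exact hlr i (vp i hi1) i (vs i hi2) rfl
        · intro i hi
          simp only [vars_and, Finset.mem_biUnion, List.mem_toFinset, List.mem_cons,
            List.not_mem_nil, or_false] at hi
          obtain ⟨l', rfl | rfl, hi⟩ := hi
          · exact List.mem_append_left _ (vp i hi)
          · exact List.mem_append_right _ (vs i hi)
        · intro x hx
          rw [eval_and, List.all_eq_true] at hx
          exact hx p (by simp)
      refine ⟨.or _ _ (fun j hj => (key j hj).1) ?_, ?_⟩
      · have h3 := List.pairwise_map.1 h2.2.1
        refine h3.imp_of_mem fun hj hk h x hx => h x ⟨?_, ?_⟩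
        · exact (key _ hj).2.2 x hx.1
        · exact (key _ hk).2.2 x hx.2
      · intro i hi
        simp only [vars_or, Finset.mem_biUnion, List.mem_toFinset] at hi
        obtain ⟨j, hj, hi⟩ := hi
        exact (key j hj).2.1 i hi

end Circuit

/-! ### The modular evaluation computes the density -/

theorem two_mul_half (k : ℕ) : 2 * ((k : ZMod (2 * k + 1)) + 1) = 1 := by
  have h : ((2 * k + 1 : ℕ) : ZMod (2 * k + 1)) = 0 := ZMod.natCast_self _
  push_cast at h
  linear_combination h

theorem cast_not (k a : ℕ) : ((1 + 2 * k * a : ℕ) : ZMod (2 * k + 1)) = 1 - a := by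
  have h : ((2 * k + 1 : ℕ) : ZMod (2 * k + 1)) = 0 := ZMod.natCast_self _
  push_cast at h ⊢
  linear_combination a * h

theorem gateVal_const (k : ℕ) (v Y : List Bool) (b : Bool) (vs : List ℕ) :
    gateVal k v Y (Gate.const b : Gate m).encode vs = bif b then 1 else 0 := by
  simp [gateVal, Gate.encode]

theorem gateVal_lit (k : ℕ) (v Y : Point m) (i : Fin m) (b : Bool) (vs : List ℕ) :
    gateVal k (List.ofFn v) (List.ofFn Y) (Gate.lit i b).encode vs =
      bif Y i then k + 1 else bif v i == b then 1 else 0 := by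
  simp only [gateVal, Gate.encode, Data.hd_cons, Data.tl_cons, Data.toNat_ofNat,
    Data.toBool_ofBool, getD_ofFn]
  rfl

theorem gateVal_neg (k : ℕ) (v Y : List Bool) (j : ℕ) (vs : List ℕ) :
    gateVal k v Y (Gate.neg j : Gate m).encode vs = (1 + 2 * k * vs.getD j 0) % (2 * k + 1) := by
  simp only [gateVal, Gate.encode, Data.hd_cons, Data.tl_cons, Data.toNat_ofNat]
  rfl

theorem gateVal_and (k : ℕ) (v Y : List Bool) (js : List ℕ) (vs : List ℕ) :
    gateVal k v Y (Gate.and js : Gate m).encode vs =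
      js.foldl (fun s j => s * vs.getD j 0 % (2 * k + 1)) 1 := by
  simp only [gateVal, Gate.encode, Data.hd_cons, Data.tl_cons, Data.toNat_ofNat,
    Data.toList_ofList, List.foldl_map]
  rfl

theorem gateVal_or (k : ℕ) (v Y : List Bool) (js : List ℕ) (vs : List ℕ) :
    gateVal k v Y (Gate.or js : Gate m).encode vs =
      js.foldl (fun s j => (s + vs.getD j 0) % (2 * k + 1)) 0 := by
  simp only [gateVal, Gate.encode, Data.hd_cons, Data.tl_cons, Data.toNat_ofNat,
    Data.toList_ofList, List.foldl_map]
  rfl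

theorem density_all {R : Type*} [CommRing R] (p : Fin m → R) (r : Circuit m) (js : List ℕ)
    (h : js.Pairwise fun j k => Disjoint (Circuit.vars (r.drop j)) (Circuit.vars (r.drop k))) :
    density p (fun x => js.all fun j => Circuit.eval (r.drop j) x) =
      (js.map fun j => density p (Circuit.eval (r.drop j))).prod := by
  induction js with
  | nil => exact density_true p
  | cons j js ih =>
    rw [List.pairwise_cons] at h
    simp only [List.all_cons, List.map_cons, List.prod_cons]
    rw [density_and p (Circuit.vars (r.drop j)) (fun x y h => eval_congr _ h), ih h.2]
    intro x y hxy
    rw [Bool.eq_iff_iff, List.all_eq_true, List.all_eq_true]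
    refine forall₂_congr fun l hl => ?_
    rw [eval_congr _ fun i hi => hxy i fun hi' =>
      Finset.disjoint_left.1 (h.1 l hl) hi' hi]

theorem density_any {R : Type*} [CommRing R] (p : Fin m → R) (r : Circuit m) (js : List ℕ)
    (h : js.Pairwise fun j k => Circuit.Exclusive (r.drop j) (r.drop k)) :
    density p (fun x => js.any fun j => Circuit.eval (r.drop j) x) =
      (js.map fun j => density p (Circuit.eval (r.drop j))).sum := by
  induction js with
  | nil => exact density_false p
  | cons j js ih =>
    rw [List.pairwise_cons] at h
    simp only [List.any_cons, List.map_cons, List.sum_cons]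
    rw [density_or p, ih h.2]
    rintro x ⟨h1, h2⟩
    rw [List.any_eq_true] at h2
    obtain ⟨l, hl, h2⟩ := h2
    exact h.1 l hl x ⟨h1, h2⟩

/-- The program computes the density of the models. -/
theorem cast_value {c : Circuit m} (hc : Tractable c) (k : ℕ) (v Y : Point m) :
    ((value k c.encode (List.ofFn v) (List.ofFn Y) : ℕ) : ZMod (2 * k + 1)) =
      density (bitWeight ((k : ZMod (2 * k + 1)) + 1) v Y) c.eval := by
  have hl : c.encode.toList = c.map Gate.encode := by simp [Circuit.encode]
  rw [value, hl, dagFold_map]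
  induction hc with
  | nil => exact Nat.cast_zero.trans (density_false _).symm
  | const b r =>
    rw [dagFold, List.headD_cons, gateVal_const]
    cases b
    · exact Nat.cast_zero.trans (density_false _).symm
    · exact Nat.cast_one.trans (density_true _).symm
  | lit i b r =>
    rw [dagFold, List.headD_cons, gateVal_lit]
    refine Eq.trans ?_ (density_lit _ i b).symm
    have := two_mul_half k
    have h2 : (1 : ZMod (2 * k + 1)) - (k + 1) = k + 1 := by linear_combination -this
    cases b <;> cases hY : Y i <;> cases hv : v i <;> simp [bitWeight, hY, hv]
    all_goals linear_combination this
  | neg j r h ih =>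
    rw [dagFold, List.headD_cons, gateVal_neg, dagFold_getD, ZMod.natCast_mod, cast_not,
      ih (by simp [Circuit.encode])]
    exact (density_not _ _).symm.trans (congrArg _ (funext fun x => (eval_neg j r x).symm))
  | and js r h hp ih =>
    rw [dagFold, List.headD_cons, gateVal_and]
    have e : Circuit.eval (Gate.and js :: r) =
      fun x => js.all fun j => Circuit.eval (r.drop j) x := funext fun x => eval_and js r x
    rw [e, density_all _ _ _ hp, ← List.map_congr_left fun j hj => ih j hj (by
      simp [Circuit.encode])]
    have key : ∀ (l : List ℕ) (s : ℕ) (f : ℕ → ℕ), ((l.foldl (fun s j => s * f j % (2 * k + 1)) s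
        : ℕ) : ZMod (2 * k + 1)) = s * (l.map fun j => (f j : ZMod (2 * k + 1))).prod := by
      intro l
      induction l with
      | nil => simp
      | cons a l ih => intro s f; simp [ih, mul_assoc]
    rw [key, Nat.cast_one, one_mul]
    simp only [dagFold_getD]
  | or js r h hp ih =>
    rw [dagFold, List.headD_cons, gateVal_or]
    have e : Circuit.eval (Gate.or js :: r) =
      fun x => js.any fun j => Circuit.eval (r.drop j) x := funext fun x => eval_or js r x
    rw [e, density_any _ _ _ hp, ← List.map_congr_left fun j hj => ih j hj (by
      simp [Circuit.encode])]
    have key : ∀ (l : List ℕ) (s : ℕ) (f : ℕ → ℕ), ((l.foldl (fun s j => (s + f j) % (2 * k + 1)) s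
        : ℕ) : ZMod (2 * k + 1)) = s + (l.map fun j => (f j : ZMod (2 * k + 1))).sum := by
      intro l
      induction l with
      | nil => simp
      | cons a l ih => intro s f; simp [ih, add_assoc]
    rw [key, Nat.cast_zero, zero_add]
    simp only [dagFold_getD]

open Classical in
/-- A function has a model iff its density is nonzero modulo some small odd number. -/
theorem exists_density_ne_zero_iff (v Y : Point m) (f : Point m → Bool) :
    (∃ k < m + 4, density (bitWeight ((k : ZMod (2 * k + 1)) + 1) v Y) f ≠ 0) ↔
      ∃ x, Agree v Y x ∧ f x = true := by
  set N := (Finset.univ.filter fun x : Point m => Agree v Y x ∧ f x = true).card with hN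
  have h0 : N ≠ 0 ↔ ∃ x, Agree v Y x ∧ f x = true := by
    rw [hN, Finset.card_ne_zero]
    simp [Finset.Nonempty]
  have hk : ∀ k : ℕ, density (bitWeight ((k : ZMod (2 * k + 1)) + 1) v Y) f ≠ 0 ↔
      ¬ (2 * k + 1) ∣ N := by
    intro k
    rw [density_bitWeight (two_mul_half k), ← ZMod.natCast_eq_zero_iff]
    -- The modulus need not be prime, but powers of a unit can be cancelled. So the density vanishes
    -- iff the modulus divides the number of models.
    have hu : IsUnit ((k : ZMod (2 * k + 1)) + 1) :=
      isUnit_iff_exists_inv'.2 ⟨2, two_mul_half k⟩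
    rw [ne_eq, (hu.pow _).mul_left_eq_zero]
  simp only [hk]
  rw [← h0]
  constructor
  · rintro ⟨k, _, h⟩ h'
    rw [h'] at h
    exact h (dvd_zero _)
  · intro h
    refine exists_odd_not_dvd h ?_
    calc N ≤ Fintype.card (Point m) := Finset.card_le_univ _
      _ = 2 ^ m := by simp

theorem sat_iff {c : Circuit m} (hc : Tractable c) (v Y : Point m) (b : Bool) :
    sat c.encode (List.ofFn v) (List.ofFn Y) b = true ↔ ∃ x, Agree v Y x ∧ c.eval x = b := by
  simp only [sat, List.any_eq_true, List.mem_range, List.length_ofFn, Bool.not_eq_true',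
    beq_eq_false_iff_ne, ne_eq, ← Nat.dvd_iff_mod_eq_zero, ← ZMod.natCast_eq_zero_iff]
  cases b with
  | true =>
    simp only [cond_true, cast_value hc]
    exact exists_density_ne_zero_iff v Y c.eval
  | false =>
    simp only [cond_false, cast_not, cast_value hc, ← density_not]
    refine (exists_density_ne_zero_iff v Y fun x => !c.eval x).trans ?_
    simp

end Counting

theorem oneCXp_cdPDAG : OneCXpInPolyTime cdPDAG :=
  OneCXpInPolyTime.of_sat (S := Counting.sat) (by fun_prop)
    fun _ c hc _ v Y b => Counting.sat_iff (Counting.tractable_of_decomposable c hc.2.1 hc.2.2) v Y b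

theorem oneCXp_dDNNF : OneCXpInPolyTime dDNNF :=
  OneCXpInPolyTime.of_sat (S := Counting.sat) (by fun_prop)
    fun _ c hc _ v Y b => Counting.sat_iff (Counting.tractable_of_decomposable c hc.2.1 hc.2.2) v Y b

theorem oneCXp_SDD : OneCXpInPolyTime SDD := by
  refine OneCXpInPolyTime.of_sat (S := Counting.sat) (by fun_prop) fun m c hc _ v Y b => ?_
  obtain ⟨_, T, hT, _, h⟩ := hc
  exact Counting.sat_iff (Counting.tractable_of_SDDUnder T hT c h).1 v Y b

theorem oneCXp_OBDD : OneCXpInPolyTime OBDD := by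
  refine OneCXpInPolyTime.of_sat (S := Counting.sat) (by fun_prop) fun m c hc _ v Y b => ?_
  obtain ⟨_, rank, _, h⟩ := hc
  exact Counting.sat_iff (Counting.tractable_of_OBDDFrom h).1 v Y b

/-! ## Extended affine decision trees -/

namespace AffineTree

/-- One step on the way from a node up to the root; the state holds the distance to the last node
of the path and the affine clauses that have been decided on it. -/
def upStep (g : Data) (s : ℕ × List (List (ℕ × Bool) × Bool)) :
    ℕ × List (List (ℕ × Bool) × Bool) :=
  bif g.hd.toNat == 1 then
    -- An edge `j` skips `j` entries, so it leads to the last path node iff `j` equals the distance.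
    -- In that case the node read is the parent and becomes the new reference point, at distance 0.
    bif s.1 == g.tl.tl.hd.toNat then
      (0, (g.tl.hd.toXor.1, !g.tl.hd.toXor.2) :: s.2)
    else bif s.1 == g.tl.tl.tl.toNat then (0, g.tl.hd.toXor :: s.2)
    else (s.1 + 1, s.2)
  else bif !(g.hd.toNat == 0) && g.tl.toList.any fun j => s.1 == j.toNat then (0, s.2)
  else (s.1 + 1, s.2)

/-- The affine clauses decided on the path to a node, computed from the list of the nodes that
precede it. -/
def pathClauses (pre : List Data) : List (List (ℕ × Bool) × Bool) :=
  (pre.foldr upStep (0, [])).2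

/-- Some point satisfies the affine clauses and agrees with the fixed features. -/
def consistent (v Y : List Bool) (pre : List Data) : Bool :=
  Affine.affSat v.length (Affine.units v Y ++ pathClauses pre)

/-- Tells whether the node takes the value `b` at a point consistent with the fixed features and
with the path to the node. `vs` holds the values of all later nodes, so dropping `vs.length + 1`
entries from the end of `c` leaves the predecessors. -/
def nodeVal (c : List Data) (v Y : List Bool) (b : Bool) (g : Data) (vs : List Bool) : Bool :=
  bif g.hd.toNat == 0 then
    g.tl.toBool == b && consistent v Y (c.take (c.length - (vs.length + 1)))
  else bif g.hd.toNat == 1 then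
    vs.getD g.tl.tl.hd.toNat false || vs.getD g.tl.tl.tl.toNat false
  -- The case in which all children need the value `b`: a conjunction made true or a disjunction
  -- made false. Consistency is tested separately because there may be no children.
  else bif (g.hd.toNat == 2) == b then
    consistent v Y (c.take (c.length - (vs.length + 1))) &&
      g.tl.toList.all fun j => vs.getD j.toNat false
  else g.tl.toList.any fun j => vs.getD j.toNat false

def sat (d : Data) (v Y : List Bool) (b : Bool) : Bool :=
  (dagFold (nodeVal d.toList v Y b) d.toList).headD false

/-! ### Running time of the test for affine trees -/

section PolyTime

variable {α : Type} [Enc α]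

@[fun_prop] theorem pathClauses_polyTime {pre : α → List Data} (hpre : PolyTime pre) :
    PolyTime fun x => pathClauses (pre x) := by
  obtain ⟨b, hb, h⟩ := PolyTime.exists_bdd_mem (g := fun _ (g : Data) => g.tl.hd.toXor) hpre
    (by fun_prop)
  unfold pathClauses
  refine PolyTime.snd (PolyTime.foldr hpre (by fun_prop) ?_ (b := fun x => b x + 10)
    (by fun_prop) fun x s g hg => ?_)
  · unfold upStep
    fun_prop
  · have h1 := h x g hg
    obtain ⟨k, S⟩ := s
    have h2 := sz_bool_le (!g.tl.hd.toXor.2)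
    have h3 : sz g.tl.hd.toXor = sz g.tl.hd.toXor.1 + sz g.tl.hd.toXor.2 + 1 := rfl
    have h4 := sz_pos g.tl.hd.toXor.2
    have h5 := sz_nat k
    unfold upStep
    generalize (g.hd.toNat == 1) = c1
    generalize (!(g.hd.toNat == 0) && g.tl.toList.any fun j => (k, S).1 == j.toNat) = c2
    generalize ((k, S).1 == g.tl.tl.hd.toNat) = c3
    generalize ((k, S).1 == g.tl.tl.tl.toNat) = c4
    cases c1 <;> cases c2 <;> cases c3 <;> cases c4 <;>
      simp only [cond_true, cond_false, sz_pair, sz_cons, sz_succ, sz_zero] <;> omega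

@[fun_prop] theorem consistent_polyTime {v Y : α → List Bool} {pre : α → List Data}
    (hv : PolyTime v) (hY : PolyTime Y) (hpre : PolyTime pre) :
    PolyTime fun x => consistent (v x) (Y x) (pre x) := by
  unfold consistent
  fun_prop

@[fun_prop] theorem nodeVal_polyTime {c : α → List Data} {v Y : α → List Bool} {b : α → Bool}
    {g : α → Data} {vs : α → List Bool} (hc : PolyTime c) (hv : PolyTime v) (hY : PolyTime Y)
    (hb : PolyTime b) (hg : PolyTime g) (hvs : PolyTime vs) :
    PolyTime fun x => nodeVal (c x) (v x) (Y x) (b x) (g x) (vs x) := by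
  unfold nodeVal
  fun_prop

@[fun_prop] theorem sat_polyTime {d : α → Data} {v Y : α → List Bool} {b : α → Bool}
    (hd : PolyTime d) (hv : PolyTime v) (hY : PolyTime Y) (hb : PolyTime b) :
    PolyTime fun x => sat (d x) (v x) (Y x) (b x) := by
  unfold sat
  exact PolyTime.headD (PolyTime.dagFold (by fun_prop) (by fun_prop) (b := fun _ => 3)
    (by fun_prop) fun _ _ _ _ => sz_bool_le _) (by fun_prop)

end PolyTime

/-! ### Paths in affine trees and correctness of the test -/

variable {m : ℕ}

section Tree

open AffTree

@[simp] theorem eval_leaf (b : Bool) (r : AffTree m) (x : Point m) :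
    AffTree.eval (AffNode.leaf b :: r) x = b := rfl

@[simp] theorem eval_decide (δ : XorClause m) (j₀ j₁ : ℕ) (r : AffTree m) (x : Point m) :
    AffTree.eval (AffNode.decide δ j₀ j₁ :: r) x =
      if δ.eval x then AffTree.eval (r.drop j₁) x else AffTree.eval (r.drop j₀) x := by
  simp only [AffTree.eval, dagFold, List.headD_cons, AffNode.val, dagFold_getD]

@[simp] theorem eval_conj (js : List ℕ) (r : AffTree m) (x : Point m) :
    AffTree.eval (AffNode.conj js :: r) x = js.all fun j => AffTree.eval (r.drop j) x := by
  simp only [AffTree.eval, dagFold, List.headD_cons, AffNode.val, dagFold_getD]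

@[simp] theorem eval_disj (js : List ℕ) (r : AffTree m) (x : Point m) :
    AffTree.eval (AffNode.disj js :: r) x = js.any fun j => AffTree.eval (r.drop j) x := by
  simp only [AffTree.eval, dagFold, List.headD_cons, AffNode.val, dagFold_getD]

theorem vars_decide (δ : XorClause m) (j₀ j₁ : ℕ) (r : AffTree m) :
    AffTree.vars (AffNode.decide δ j₀ j₁ :: r) =
      δ.vars ∪ AffTree.vars (r.drop j₀) ∪ AffTree.vars (r.drop j₁) := by
  simp only [AffTree.vars, dagFold, List.headD_cons, AffNode.supp, dagFold_getD]

theorem vars_conj (js : List ℕ) (r : AffTree m) :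
    AffTree.vars (AffNode.conj js :: r) = js.toFinset.biUnion fun j => AffTree.vars (r.drop j) := by
  simp only [AffTree.vars, dagFold, List.headD_cons, AffNode.supp, dagFold_getD]

theorem vars_disj (js : List ℕ) (r : AffTree m) :
    AffTree.vars (AffNode.disj js :: r) = js.toFinset.biUnion fun j => AffTree.vars (r.drop j) := by
  simp only [AffTree.vars, dagFold, List.headD_cons, AffNode.supp, dagFold_getD]

theorem xorClause_eval_congr {x y : Point m} {δ : XorClause m} (h : ∀ i ∈ δ.vars, x i = y i) :
    δ.eval x = δ.eval y := by
  obtain ⟨l, p⟩ := δ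
  simp only [XorClause.vars, List.mem_toFinset] at h
  simp only [XorClause.eval]
  induction l with
  | nil => rfl
  | cons a l ih =>
    rw [List.foldr_cons, List.foldr_cons, h a.1 (by simp),
      ih fun i hi => h i (by rw [List.map_cons]; exact List.mem_cons_of_mem _ hi)]

theorem eval_congr {x y : Point m} (c : AffTree m) :
    (∀ i ∈ c.vars, x i = y i) → c.eval x = c.eval y := by
  refine dag_induction (P := fun c : AffTree m =>
    (∀ i ∈ c.vars, x i = y i) → c.eval x = c.eval y) (fun _ => rfl) (fun g r ih h => ?_) c
  cases g with
  | leaf b => rfl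
  | decide δ j₀ j₁ =>
    simp only [vars_decide, Finset.mem_union] at h
    rw [eval_decide, eval_decide, xorClause_eval_congr fun i hi => h i (Or.inl (Or.inl hi)),
      ih j₀ fun i hi => h i (Or.inl (Or.inr hi)), ih j₁ fun i hi => h i (Or.inr hi)]
  | conj js =>
    simp only [vars_conj, Finset.mem_biUnion, List.mem_toFinset] at h
    rw [eval_conj, eval_conj, Bool.eq_iff_iff, List.all_eq_true, List.all_eq_true]
    exact forall₂_congr fun j hj => by rw [ih j fun i hi => h i ⟨j, hj, hi⟩]
  | disj js =>
    simp only [vars_disj, Finset.mem_biUnion, List.mem_toFinset] at h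
    rw [eval_disj, eval_disj, Bool.eq_iff_iff, List.any_eq_true, List.any_eq_true]
    refine exists_congr fun j => and_congr_right fun hj => by
      rw [ih j fun i hi => h i ⟨j, hj, hi⟩]

/-- The affine clauses that hold along an edge. -/
def edgeClauses : AffNode m → ℕ → List (XorClause m)
  | .decide δ j₀ j₁, j => if j = j₀ then [δ.not] else if j = j₁ then [δ] else []
  | _, _ => []

def upStepTyped (g : AffNode m) (s : ℕ × List (XorClause m)) : ℕ × List (XorClause m) :=
  if s.1 ∈ g.refs then (0, edgeClauses g s.1 ++ s.2) else (s.1 + 1, s.2)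

/-- The affine clauses decided on the path to the node that is preceded by the nodes in `pre`. -/
def pathSystem (pre : AffTree m) : List (XorClause m) := (pre.foldr upStepTyped (0, [])).2

theorem upStep_encode (g : AffNode m) (s : ℕ × List (XorClause m)) :
    upStep g.encode (s.1, s.2.map rawXor) =
      ((upStepTyped g s).1, (upStepTyped g s).2.map rawXor) := by
  obtain ⟨k, S⟩ := s
  cases g with
  | leaf b => rfl
  | decide δ j₀ j₁ =>
    simp only [upStep, AffNode.encode, Data.hd_cons, Data.tl_cons, Data.toNat_ofNat, toXor_encode,
      upStepTyped, AffNode.refs, edgeClauses, beq_self_eq_true, cond_true]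
    by_cases h0 : k = j₀
    · simp [h0, rawXor, XorClause.not]
    · by_cases h1 : k = j₁
      · have h2 : ¬ j₁ = j₀ := h1 ▸ h0
        have e : (j₁ == j₀) = false := by simpa using h2
        simp [h1, h2, e]
      · have e0 : (k == j₀) = false := by simpa using h0
        have e1 : (k == j₁) = false := by simpa using h1
        simp [h0, h1, e0, e1]
  | conj js =>
    simp only [upStep, AffNode.encode, Data.hd_cons, Data.tl_cons, Data.toNat_ofNat,
      Data.toList_ofList, List.any_map, Function.comp_def, upStepTyped, AffNode.refs, edgeClauses]
    by_cases h : k ∈ js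
    · have e : (js.any fun x => k == x) = true := by simpa using h
      simp [h, e]
    · have e : (js.any fun x => k == x) = false := by
        rw [← Bool.not_eq_true]
        simpa using h
      simp [h, e]
  | disj js =>
    simp only [upStep, AffNode.encode, Data.hd_cons, Data.tl_cons, Data.toNat_ofNat,
      Data.toList_ofList, List.any_map, Function.comp_def, upStepTyped, AffNode.refs, edgeClauses]
    by_cases h : k ∈ js
    · have e : (js.any fun x => k == x) = true := by simpa using h
      simp [h, e]
    · have e : (js.any fun x => k == x) = false := by
        rw [← Bool.not_eq_true]
        simpa using h
      simp [h, e]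

theorem pathClauses_encode (pre : AffTree m) :
    pathClauses (pre.map AffNode.encode) = (pathSystem pre).map rawXor := by
  have h : (pre.map AffNode.encode).foldr upStep (0, []) =
      ((pre.foldr upStepTyped (0, [])).1, (pre.foldr upStepTyped (0, [])).2.map rawXor) := by
    induction pre with
    | nil => rfl
    | cons g pre ih => rw [List.map_cons, List.foldr_cons, ih, upStep_encode]; rfl
  rw [pathClauses, h]
  rfl

/-- The clauses collected so far do not influence the further way up. -/
theorem foldr_upStepTyped (pre : AffTree m) (k : ℕ) (S : List (XorClause m)) :
    pre.foldr upStepTyped (k, S) = ((pre.foldr upStepTyped (k, [])).1,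
      (pre.foldr upStepTyped (k, [])).2 ++ S) := by
  induction pre with
  | nil => rfl
  | cons g pre ih =>
    rw [List.foldr_cons, List.foldr_cons, ih]
    simp only [upStepTyped]
    split_ifs <;> simp

theorem mem_dagTargets {α : Type} {refs : α → List ℕ} {g : α} {r c : List α}
    (h : (g :: r) <:+ c) {j : ℕ} (hj : j ∈ refs g) : r.drop j ∈ dagTargets refs c := by
  induction c with
  | nil => simp at h
  | cons a c ih =>
    rcases List.suffix_cons_iff.1 h with h | h
    · obtain ⟨rfl, rfl⟩ := List.cons.inj h
      exact List.mem_append_left _ (List.mem_map_of_mem hj)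
    · exact List.mem_append_right _ (ih h)

theorem dagTargets_nodup_suffix {α : Type} {refs : α → List ℕ} {n c : List α} (h : n <:+ c)
    (hc : (dagTargets refs c).Nodup) : (dagTargets refs n).Nodup := by
  induction c with
  | nil => rwa [List.suffix_nil.1 h]
  | cons a c ih =>
    rcases List.suffix_cons_iff.1 h with rfl | h
    · exact hc
    · exact ih h (List.nodup_append.1 hc).2.1

/-- In a tree, the path to a child is the path to its parent and one more edge. -/
theorem pathSystem_child {pre r : AffTree m} {g : AffNode m}
    (hc : (dagTargets AffNode.refs (pre ++ g :: r)).Nodup) {j : ℕ} (hj : j ∈ g.refs)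
    (hjr : j < r.length) :
    pathSystem (pre ++ g :: r.take j) = pathSystem pre ++ edgeClauses g j := by
  have hnd := dagTargets_nodup_suffix (List.suffix_append pre (g :: r)) hc
  -- In a tree the child has no second incoming edge. The walk up from it therefore passes all nodes
  -- between, merely counting them, until it meets its parent `g`.
  have hdisj : ∀ h s, (h :: s) <:+ r → ∀ i ∈ AffNode.refs h, s.drop i ≠ r.drop j := by
    intro h s hs i hi he
    have h1 := mem_dagTargets hs hi
    rw [he] at h1
    exact (List.nodup_append.1 hnd).2.2 _ (List.mem_map_of_mem hj) _ h1 rfl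
  have key : ∀ t : AffTree m, (t ++ r.drop j) <:+ r →
      t.foldr upStepTyped (0, []) = (t.length, []) := by
    intro t
    induction t with
    | nil => intro _; rfl
    | cons h t ih =>
      intro ht
      rw [List.foldr_cons, ih ((List.suffix_cons h _).trans ht), upStepTyped]
      rw [if_neg]
      · rfl
      · intro hi
        refine hdisj h (t ++ r.drop j) ht _ hi ?_
        simp
  have h1 := key (r.take j) (by rw [List.take_append_drop])
  rw [List.length_take, min_eq_left hjr.le] at h1
  rw [pathSystem, List.foldr_append, List.foldr_cons, h1, upStepTyped, if_pos hj, List.append_nil,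
    foldr_upStepTyped]
  rfl

/-- The clauses of the path system are decided at ancestors of the node. -/
theorem exists_ancestor {n : AffTree m} (pre : AffTree m) {δ : XorClause m}
    (hδ : δ ∈ pathSystem pre) : ∃ δ' j₀ j₁ r, (AffNode.decide δ' j₀ j₁ :: r) <:+ pre ++ n ∧
      DagReach AffNode.refs (AffNode.decide δ' j₀ j₁ :: r) n ∧ δ'.vars = δ.vars := by
  -- Invariant of the walk: the node at the recorded distance reaches `n`. Only variable sets are
  -- compared, since the clause collected may be the negation of the one decided.
  have key : ∀ t : AffTree m,
      DagReach AffNode.refs ((t ++ n).drop (t.foldr upStepTyped (0, [])).1) n ∧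
      ∀ δ ∈ (t.foldr upStepTyped (0, [])).2, ∃ δ' j₀ j₁ r,
        (AffNode.decide δ' j₀ j₁ :: r) <:+ t ++ n ∧
        DagReach AffNode.refs (AffNode.decide δ' j₀ j₁ :: r) n ∧ δ'.vars = δ.vars := by
    intro t
    induction t with
    | nil => exact ⟨.refl, by simp⟩
    | cons h t ih =>
      obtain ⟨ih1, ih2⟩ := ih
      rw [List.foldr_cons, upStepTyped]
      have hs : t ++ n <:+ h :: t ++ n := List.suffix_cons h (t ++ n)
      split_ifs with hk
      · have hreach : DagReach AffNode.refs (h :: (t ++ n)) n := (dagReach_drop hk).trans ih1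
        refine ⟨hreach, fun δ hδ => ?_⟩
        rcases List.mem_append.1 hδ with hδ | hδ
        · cases h with
          | decide δ' j₀ j₁ =>
            refine ⟨δ', j₀, j₁, t ++ n, List.suffix_rfl, hreach, ?_⟩
            simp only [edgeClauses] at hδ
            split_ifs at hδ with h1 h2
            · rw [List.mem_singleton.1 hδ]
              rfl
            · rw [List.mem_singleton.1 hδ]
            · simp at hδ
          | _ => simp [edgeClauses] at hδ
        · obtain ⟨δ', j₀, j₁, r, h1, h2⟩ := ih2 δ hδ
          exact ⟨δ', j₀, j₁, r, h1.trans hs, h2⟩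
      · refine ⟨ih1, fun δ hδ => ?_⟩
        obtain ⟨δ', j₀, j₁, r, h1, h2⟩ := ih2 δ hδ
        exact ⟨δ', j₀, j₁, r, h1.trans hs, h2⟩
  exact (key pre).2 δ hδ

/-- The points that are consistent with the fixed features and with the path to a node. -/
def Compatible (v Y : Point m) (pre : AffTree m) (x : Point m) : Prop :=
  Agree v Y x ∧ ∀ δ ∈ pathSystem pre, δ.eval x = true

theorem consistent_iff (v Y : Point m) (pre : AffTree m) :
    consistent (List.ofFn v) (List.ofFn Y) (pre.map AffNode.encode) = true ↔
      ∃ x, Compatible v Y pre x := by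
  rw [consistent, List.length_ofFn, Affine.units_eq, pathClauses_encode, ← List.map_append,
    Affine.affSat_iff]
  refine exists_congr fun x => ?_
  rw [List.forall_mem_append, Affine.eval_unitClauses]
  rfl

/-- Values for the separated children of a node can be chosen independently. -/
theorem exists_compatible_forall {v Y : Point m} {pre r : AffTree m} {g : AffNode m}
    {js : List ℕ} (hs : Separated (pre ++ g :: r) (g :: r) r js) {b : Bool}
    (h : ∃ x, Compatible v Y pre x)
    (hj : ∀ j ∈ js, ∃ x, Compatible v Y pre x ∧ AffTree.eval (r.drop j) x = b) :
    ∃ x, Compatible v Y pre x ∧ ∀ j ∈ js, AffTree.eval (r.drop j) x = b := by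
  classical
  unfold Separated at hs
  induction js with
  | nil =>
    obtain ⟨x, hx⟩ := h
    exact ⟨x, hx, by simp⟩
  | cons j js ih =>
    rw [List.pairwise_cons] at hs
    obtain ⟨y, hy, hy'⟩ := ih hs.2 fun k hk => hj k (by simp [hk])
    obtain ⟨z, hz, hz'⟩ := hj j (by simp)
    -- The variables connected to the first child take their values from `z`, all others from `y`. A
    -- clause on the path has all its variables on one side, as they are linked, and by separation
    -- the other children only see `y`.
    let C : Fin m → Prop := fun i => ∃ a ∈ AffTree.vars (r.drop j),
      Relation.ReflTransGen (Linked (pre ++ g :: r) (g :: r)) a i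
    have hC : ∀ i, C i → (fun i => if C i then z i else y i) i = z i := fun i hi => if_pos hi
    have hC' : ∀ i, ¬ C i → (fun i => if C i then z i else y i) i = y i := fun i hi => if_neg hi
    refine ⟨fun i => if C i then z i else y i, ⟨fun i hi => ?_, fun δ hδ => ?_⟩, fun k hk => ?_⟩
    · by_cases hCi : C i
      · rw [hC i hCi, hz.1 i hi]
      · rw [hC' i hCi, hy.1 i hi]
    · obtain ⟨δ', j₀, j₁, s, h1, h2, h3⟩ := exists_ancestor (n := g :: r) pre hδ
      by_cases hδC : ∃ i ∈ δ.vars, C i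
      · obtain ⟨i, hi, a, ha, hai⟩ := hδC
        rw [xorClause_eval_congr fun k hk => hC k ⟨a, ha, hai.tail
          ⟨δ', j₀, j₁, s, h1, h2, h3 ▸ hi, h3 ▸ hk⟩⟩]
        exact hz.2 δ hδ
      · push Not at hδC
        rw [xorClause_eval_congr fun k hk => hC' k (hδC k hk)]
        exact hy.2 δ hδ
    · rcases List.mem_cons.1 hk with rfl | hk
      · rw [eval_congr _ fun i hi => hC i ⟨i, hi, .refl⟩]
        exact hz'
      · rw [eval_congr _ fun i hi => hC' i fun ⟨a, ha, hai⟩ => hs.1 k hk a ha i hi hai]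
        exact hy' k hk

theorem nodeVal_leaf (c : List Data) (v Y : List Bool) (b b' : Bool) (vs : List Bool) :
    nodeVal c v Y b (AffNode.leaf b' : AffNode m).encode vs =
      (b' == b && consistent v Y (c.take (c.length - (vs.length + 1)))) := by
  simp only [nodeVal, AffNode.encode, Data.hd_cons, Data.tl_cons, Data.toNat_ofNat,
    Data.toBool_ofBool]
  rfl

theorem nodeVal_decide (c : List Data) (v Y : List Bool) (b : Bool) (δ : XorClause m)
    (j₀ j₁ : ℕ) (vs : List Bool) : nodeVal c v Y b (AffNode.decide δ j₀ j₁).encode vs =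
      (vs.getD j₀ false || vs.getD j₁ false) := by
  simp only [nodeVal, AffNode.encode, Data.hd_cons, Data.tl_cons, Data.toNat_ofNat]
  rfl

theorem nodeVal_conj (c : List Data) (v Y : List Bool) (b : Bool) (js : List ℕ)
    (vs : List Bool) : nodeVal c v Y b (AffNode.conj js : AffNode m).encode vs =
      bif b then consistent v Y (c.take (c.length - (vs.length + 1))) &&
        js.all fun j => vs.getD j false
      else js.any fun j => vs.getD j false := by
  simp only [nodeVal, AffNode.encode, Data.hd_cons, Data.tl_cons, Data.toNat_ofNat,
    Data.toList_ofList, List.any_map, List.all_map, Function.comp_def]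
  cases b <;> rfl

theorem nodeVal_disj (c : List Data) (v Y : List Bool) (b : Bool) (js : List ℕ)
    (vs : List Bool) : nodeVal c v Y b (AffNode.disj js : AffNode m).encode vs =
      bif b then js.any fun j => vs.getD j false
      else consistent v Y (c.take (c.length - (vs.length + 1))) &&
        js.all fun j => vs.getD j false := by
  simp only [nodeVal, AffNode.encode, Data.hd_cons, Data.tl_cons, Data.toNat_ofNat,
    Data.toList_ofList, List.any_map, List.all_map, Function.comp_def]
  cases b <;> rfl

/-- Induction along the edges, with the path clauses as a growing side condition. A decision node
splits the compatible points by its clause, and the existential cases commute with the choice of a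
child. When all children must take the value `b`, the points found for them are glued. -/
theorem dagFold_nodeVal_iff {c : AffTree m} (hc : c.IsEADT) (v Y : Point m) (b : Bool)
    (n : AffTree m) : ∀ pre, c = pre ++ n → n ≠ [] →
    ((dagFold (fun g => nodeVal (c.map AffNode.encode) (List.ofFn v) (List.ofFn Y) b g.encode)
      n).headD false = true ↔ ∃ x, Compatible v Y pre x ∧ n.eval x = b) := by
  obtain ⟨⟨⟨_, hdag, _⟩, hnd⟩, hconj, hdisj⟩ := hc
  refine dag_induction (P := fun n : AffTree m => ∀ pre, c = pre ++ n → n ≠ [] →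
    ((dagFold (fun g => nodeVal (c.map AffNode.encode) (List.ofFn v) (List.ofFn Y) b g.encode)
      n).headD false = true ↔ ∃ x, Compatible v Y pre x ∧ AffTree.eval n x = b))
    (fun _ _ h => absurd rfl h) (fun g r ih pre hpre _ => ?_) n
  have hsuf : (g :: r) <:+ c := hpre ▸ List.suffix_append pre (g :: r)
  have hcons : ∀ vs : List Bool, vs.length = r.length →
      (consistent (List.ofFn v) (List.ofFn Y) ((c.map AffNode.encode).take
        ((c.map AffNode.encode).length - (vs.length + 1))) = true ↔
        ∃ x, Compatible v Y pre x) := by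
    intro vs hvs
    rw [← consistent_iff, ← List.map_take, List.length_map, hvs, hpre, List.length_append,
      List.length_cons, Nat.add_sub_cancel, List.take_left']
    rfl
  have hchild : ∀ j ∈ g.refs, ((dagFold (fun g => nodeVal (c.map AffNode.encode) (List.ofFn v)
      (List.ofFn Y) b g.encode) (r.drop j)).headD false = true ↔
        ∃ x, (Compatible v Y pre x ∧ ∀ δ ∈ edgeClauses g j, δ.eval x = true) ∧
          AffTree.eval (r.drop j) x = b) := by
    intro j hj
    have hjr := hdag g r hsuf j hj
    rw [ih j (pre ++ g :: r.take j) (by simp [hpre]) (by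
      rw [ne_eq, List.drop_eq_nil_iff]
      omega)]
    refine exists_congr fun x => and_congr_left fun _ => ?_
    rw [Compatible, pathSystem_child (hpre ▸ hnd) hj hjr, List.forall_mem_append, ← and_assoc]
    rfl
  rw [dagFold, List.headD_cons]
  have hlen := length_dagFold (fun g => nodeVal (c.map AffNode.encode) (List.ofFn v)
    (List.ofFn Y) b g.encode) r
  cases g with
  | leaf b' =>
    rw [nodeVal_leaf, Bool.and_eq_true, hcons _ hlen, beq_iff_eq]
    simp only [eval_leaf]
    constructor
    · rintro ⟨rfl, x, hx⟩
      exact ⟨x, hx, rfl⟩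
    · rintro ⟨x, hx, rfl⟩
      exact ⟨rfl, x, hx⟩
  | decide δ j₀ j₁ =>
    -- No node of a tree has two incoming edges, so the two branches differ and `edgeClauses`
    -- assigns the right clause to each.
    have hne : j₁ ≠ j₀ := by
      rintro rfl
      have h1 := dagTargets_nodup_suffix hsuf hnd
      have h2 := (List.nodup_append.1 h1).1
      simp [AffNode.refs] at h2
    rw [nodeVal_decide, Bool.or_eq_true, dagFold_getD, dagFold_getD,
      hchild j₀ (by simp [AffNode.refs]), hchild j₁ (by simp [AffNode.refs]), ← exists_or]
    refine exists_congr fun x => ?_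
    simp only [edgeClauses, hne, if_true, if_false, List.forall_mem_singleton, eval_decide,
      XorClause.eval_not, Bool.not_eq_true']
    cases δ.eval x <;> simp
  | conj js =>
    have hchild' : ∀ j ∈ js, ((dagFold (fun g => nodeVal (c.map AffNode.encode) (List.ofFn v)
        (List.ofFn Y) b g.encode) (r.drop j)).headD false = true ↔
          ∃ x, Compatible v Y pre x ∧ AffTree.eval (r.drop j) x = b) := fun j hj => by
      simpa [edgeClauses] using hchild j hj
    rw [nodeVal_conj]
    cases b with
    | true =>
      rw [cond_true, Bool.and_eq_true, hcons _ hlen, List.all_eq_true]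
      simp only [dagFold_getD, eval_conj, List.all_eq_true]
      constructor
      · rintro ⟨h1, h2⟩
        have hs := hconj js r hsuf
        rw [hpre] at hs
        exact exists_compatible_forall hs h1 fun j hj => (hchild' j hj).1 (h2 j hj)
      · rintro ⟨x, hx, h⟩
        exact ⟨⟨x, hx⟩, fun j hj => (hchild' j hj).2 ⟨x, hx, h j hj⟩⟩
    | false =>
      rw [cond_false, List.any_eq_true]
      simp only [dagFold_getD, eval_conj, List.all_eq_false, Bool.not_eq_true]
      constructor
      · rintro ⟨j, hj, h⟩
        obtain ⟨x, hx, h'⟩ := (hchild' j hj).1 h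
        exact ⟨x, hx, j, hj, h'⟩
      · rintro ⟨x, hx, j, hj, h⟩
        exact ⟨j, hj, (hchild' j hj).2 ⟨x, hx, h⟩⟩
  | disj js =>
    have hchild' : ∀ j ∈ js, ((dagFold (fun g => nodeVal (c.map AffNode.encode) (List.ofFn v)
        (List.ofFn Y) b g.encode) (r.drop j)).headD false = true ↔
          ∃ x, Compatible v Y pre x ∧ AffTree.eval (r.drop j) x = b) := fun j hj => by
      simpa [edgeClauses] using hchild j hj
    rw [nodeVal_disj]
    cases b with
    | true =>
      rw [cond_true, List.any_eq_true]
      simp only [dagFold_getD, eval_disj, List.any_eq_true]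
      constructor
      · rintro ⟨j, hj, h⟩
        obtain ⟨x, hx, h'⟩ := (hchild' j hj).1 h
        exact ⟨x, hx, j, hj, h'⟩
      · rintro ⟨x, hx, j, hj, h⟩
        exact ⟨j, hj, (hchild' j hj).2 ⟨x, hx, h⟩⟩
    | false =>
      rw [cond_false, Bool.and_eq_true, hcons _ hlen, List.all_eq_true]
      simp only [dagFold_getD, eval_disj, List.any_eq_false, Bool.not_eq_true]
      constructor
      · rintro ⟨h1, h2⟩
        have hs := hdisj js r hsuf
        rw [hpre] at hs
        exact exists_compatible_forall hs h1 fun j hj => (hchild' j hj).1 (h2 j hj)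
      · rintro ⟨x, hx, h⟩
        exact ⟨⟨x, hx⟩, fun j hj => (hchild' j hj).2 ⟨x, hx, h j hj⟩⟩

theorem sat_iff {c : AffTree m} (hc : c.IsEADT) (v Y : Point m) (b : Bool) :
    sat c.encode (List.ofFn v) (List.ofFn Y) b = true ↔ ∃ x, Agree v Y x ∧ c.eval x = b := by
  have hl : c.encode.toList = c.map AffNode.encode := by simp [AffTree.encode]
  rw [sat, hl, dagFold_map, dagFold_nodeVal_iff hc v Y b c [] rfl hc.1.1.1]
  simp [Compatible, pathSystem]

end Tree

end AffineTree

theorem oneCXp_EADT : OneCXpInPolyTime EADT :=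
  OneCXpInPolyTime.of_sat (S := AffineTree.sat) (by fun_prop)
    fun _ _ hc _ v Y b => AffineTree.sat_iff hc v Y b

end KC

theorem mainTheorem2 :
    KC.OneCXpInPolyTime KC.dDNNF ∧ KC.OneCXpInPolyTime KC.cdPDAG ∧
    KC.OneCXpInPolyTime KC.SDD ∧ KC.OneCXpInPolyTime KC.OBDD ∧
    KC.OneCXpInPolyTime KC.PI ∧ KC.OneCXpInPolyTime KC.IP ∧
    KC.OneCXpInPolyTime KC.renHC ∧ KC.OneCXpInPolyTime KC.AFF ∧
    KC.OneCXpInPolyTime KC.dFSD ∧ KC.OneCXpInPolyTime KC.EADT :=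
  ⟨KC.oneCXp_dDNNF, KC.oneCXp_cdPDAG, KC.oneCXp_SDD, KC.oneCXp_OBDD, KC.oneCXp_PI, KC.oneCXp_IP,
    KC.oneCXp_renHC, KC.oneCXp_AFF, KC.oneCXp_dFSD, KC.oneCXp_EADT⟩
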